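/- Let $\Gamma$ be a torsion-free abelian group and let $\mathsf E=\bigoplus_{\gamma\in\Gamma}\mathsf E_\gamma$ be a graded division ring (a nonzero graded ring in which every nonzero homogeneous element is invertible) that is finite-dimensional over its center $\mathsf T$. Let $\tau$ be a unitary graded involution on $\mathsf E$, i.e. an antiautomorphism with $\tau^2=\mathrm{id}$, $\tau(\mathsf E_\gamma)=\mathsf E_\gamma$ for all $\gamma$, and $\tau|_{\mathsf T}\ne\mathrm{id}$. Put $\mathsf R=\mathsf T^\tau$, and for a graded subring $\mathsf S$ of $\mathsf E$ put $\Gamma_{\mathsf S}=\{\gamma\mid \mathsf S\cap\mathsf E_\gamma\neq0\}$ and $\mathsf S_0=\mathsf S\cap \mathsf E_0$. Suppose that $\mathsf T$ is unramified over $\mathsf R$, i.e. $\Gamma_{\mathsf T}=\Gamma_{\mathsf R}$. Notation. For a ring $A$ with involution $\rho$, $\Sigma_\rho(A)$ is the subgroup of $A^*$ generated by the units $a$ with $\rho(a)=a$; write $\Sigma_\tau=\Sigma_\tau(\mathsf E)$. Let $\mathrm{Nrd}_{\mathsf E}$ be the restriction to $\mathsf E$ of the reduced norm of the quotient division ring $q(\mathsf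 E)=\mathsf E\otimes_{\mathsf T}q(\mathsf T)$, where $q(\mathsf T)$ is the quotient field of $\mathsf T$. Put $\Sigma'_\tau=\{a\in\mathsf E^*\mid \mathrm{Nrd}_{\mathsf E}(a)\in\mathsf R^*\}$ and $\mathrm{SK}_1(\mathsf E,\tau)=\Sigma'_\tau/(\Sigma_\tau\,[\mathsf E^*,\mathsf E^*])$. The index $\mathrm{ind}(A)$ is defined by $\mathrm{ind}(A)^2=[A:Z(A)]$. Let $H=\mathrm{Gal}(Z(\mathsf E_0)/\mathsf T_0)$, a finite group, and $\overline\tau=\tau|_{Z(\mathsf E_0)}$. For every $h\in H$ there is an involution $\rho$ of $\mathsf E_0$ with $\rho|_{Z(\mathsf E_0)}=h\overline\tau$, and $\Sigma_\rho(\mathsf E_0)$ does not depend on the choice of $\rho$; it is denoted $\Sigma_{h\overline\tau}(\mathsf E_0)$. For each $\gamma\in\Gamma_{\mathsf E}$ there is a nonzero $x_\gamma\in\mathsf E_\gamma$ with $\tau(x_\gamma)=x_\gamma$; choose one arbitrarily. Then the inclusion $\mathsf E_0^*\subseteq\mathsf E^*$ induces an isomorphism $$(\Sigma'_\tau\cap\mathsf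 E_0)\big/(\Sigma_\tau\cap\mathsf E_0)\;\cong\;\mathrm{SK}_1(\mathsf E,\tau),$$ where $$\Sigma'_\tau\cap\mathsf E_0=\big\{a\in\mathsf E_0^*\mid N_{Z(\mathsf E_0)/\mathsf T_0}(\mathrm{Nrd}_{\mathsf E_0}(a))^{\partial}\in\mathsf R_0\big\},\qquad \partial=\mathrm{ind}(\mathsf E)\big/\big(\mathrm{ind}(\mathsf E_0)\,[Z(\mathsf E_0):\mathsf T_0]\big)\in\mathbb N,$$ and $$\Sigma_\tau\cap\mathsf E_0=P\cdot X,\qquad P=\prod_{h\in H}\Sigma_{h\overline\tau}(\mathsf E_0)\ \text{(a subgroup, the factors being taken in any order)},\qquad X=\langle x_\gamma x_\delta x_{\gamma+\delta}^{-1}\mid\gamma,\delta\in\Gamma_{\mathsf E}\rangle\subseteq\mathsf E_0^*.$$ Furthermore, if $H=\langle h_1,\dots,h_m\rangle$, then $$P=\prod_{(\varepsilon_1,\dots,\varepsilon_m)\in\{0,1\}^m}\Sigma_{h_1^{\varepsilon_1}\cdots h_m^{\varepsilon_m}\overline\tau}(\mathsf E_0).$$ -/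

import Mathlib

open scoped TensorProduct Pointwise

noncomputable section

/-! ### Reduced norm and index -/

/-- `f : A → K` is a reduced norm of the `K`-algebra `A`: for some isomorphism `φ` of
`A ⊗ K̄` with a full matrix algebra over an algebraic closure `K̄` of `K`, one has
`f a = det (φ (a ⊗ 1))` for all `a`. -/
def IsReducedNorm (K A : Type*) [Field K] [Ring A] [Algebra K A] (f : A →* K) : Prop :=
  ∃ (n : ℕ) (φ : (AlgebraicClosure K ⊗[K] A) ≃ₐ[AlgebraicClosure K]
      Matrix (Fin n) (Fin n) (AlgebraicClosure K)),
    ∀ a : A, algebraMap K (AlgebraicClosure K) (f a) = (φ (1 ⊗ₜ[K] a)).det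

open Classical in
/-- The reduced norm `Nrd : A → K` of a (finite-dimensional) central simple `K`-algebra `A`.
For such `A` a function as in `IsReducedNorm` exists and is unique (the value `1` is only used for
other algebras). -/
def reducedNorm (K A : Type*) [Field K] [Ring A] [Algebra K A] : A →* K :=
  if h : ∃ f : A →* K, IsReducedNorm K A f then h.choose else 1

/-- The index of a ring `A` over its center: `ind(A)² = [A : Z(A)]` (the rank is a perfect square for
the algebras considered here). -/
def centralIndex (A : Type*) [Ring A] : ℕ :=
  Nat.sqrt (Module.finrank (Subring.center A) A)

/-! ### Involutions -/

namespace RingInvo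

variable {A : Type*} [Ring A]

/-- `Σ_τ(A)`: the subgroup of `Aˣ` generated by the `τ`-symmetric units. -/
def sigma (τ : RingInvo A) : Subgroup Aˣ :=
  Subgroup.closure {u : Aˣ | (τ (u : A)).unop = u}

theorem unop_map_mul (τ : RingInvo A) (a b : A) :
    (τ (a * b)).unop = (τ b).unop * (τ a).unop := by
  rw [map_mul, MulOpposite.unop_mul]

theorem unop_map_one (τ : RingInvo A) : (τ (1 : A)).unop = 1 := by
  rw [map_one, MulOpposite.unop_one]

/-- The image of a unit under an involution. -/
def unitsMap (τ : RingInvo A) (u : Aˣ) : Aˣ where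
  val := (τ (u : A)).unop
  inv := (τ ((u⁻¹ : Aˣ) : A)).unop
  val_inv := by rw [← unop_map_mul, Units.inv_mul, unop_map_one]
  inv_val := by rw [← unop_map_mul, Units.mul_inv, unop_map_one]

instance sigma_normal (τ : RingInvo A) : τ.sigma.Normal := by
  refine ⟨fun n hn g => ?_⟩
  have key : ∀ s : Aˣ, (τ (s : A)).unop = s → g * s * g⁻¹ ∈ τ.sigma := by
    intro s hs
    have h1 : g * s * τ.unitsMap g ∈ τ.sigma := by
      apply Subgroup.subset_closure
      simp only [Set.mem_ofPred_eq, Units.val_mul, unop_map_mul, unitsMap, involution, hs, mul_assoc]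
    have h2 : g * τ.unitsMap g ∈ τ.sigma := by
      apply Subgroup.subset_closure
      simp only [Set.mem_ofPred_eq, Units.val_mul, unop_map_mul, unitsMap, involution]
    have h3 := τ.sigma.mul_mem h1 (τ.sigma.inv_mem h2)
    have h4 : g * s * τ.unitsMap g * (g * τ.unitsMap g)⁻¹ = g * s * g⁻¹ := by group
    rwa [h4] at h3
  induction hn using Subgroup.closure_induction with
  | mem x hx => exact key x hx
  | one => simp
  | mul x y _ _ hx hy =>
    have h : g * (x * y) * g⁻¹ = (g * x * g⁻¹) * (g * y * g⁻¹) := by group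
    rw [h]; exact mul_mem hx hy
  | inv x _ hx =>
    have h : g * x⁻¹ * g⁻¹ = (g * x * g⁻¹)⁻¹ := by group
    rw [h]; exact inv_mem hx

/-- The restriction of an involution to the center. -/
def onCenter (τ : RingInvo A) (z : Subring.center A) : Subring.center A :=
  ⟨(τ (z : A)).unop, by
    rw [Subring.mem_center_iff]
    intro a
    have h := Subring.mem_center_iff.mp z.2 (τ a).unop
    have h' := congrArg (fun y => (τ y).unop) h
    simp only [unop_map_mul, involution] at h'
    exact h'.symm⟩

/-- The involution is unitary (of the second kind): it moves some element of the center. -/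
def IsUnitary (τ : RingInvo A) : Prop := ∃ z : Subring.center A, τ.onCenter z ≠ z

/-- The subring of the center `T = Z(A)` of the elements fixed by `τ`, i.e. `R = T^τ`. -/
def fixedCenter (τ : RingInvo A) : Subring (Subring.center A) where
  carrier := {z | τ.onCenter z = z}
  mul_mem' {a b} ha hb := by
    have ha' : (τ (a : A)).unop = a := congrArg Subtype.val ha
    have hb' : (τ (b : A)).unop = b := congrArg Subtype.val hb
    refine Subtype.ext ?_
    change (τ ((a : A) * b)).unop = (a : A) * b
    rw [unop_map_mul, ha', hb']
    exact (Subring.mem_center_iff.mp a.2 b)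
  one_mem' := Subtype.ext (unop_map_one τ)
  add_mem' {a b} ha hb := by
    have ha' : (τ (a : A)).unop = a := congrArg Subtype.val ha
    have hb' : (τ (b : A)).unop = b := congrArg Subtype.val hb
    refine Subtype.ext ?_
    change (τ ((a : A) + b)).unop = (a : A) + b
    rw [map_add, MulOpposite.unop_add, ha', hb']
  zero_mem' := by
    refine Subtype.ext ?_
    change (τ (0 : A)).unop = 0
    rw [map_zero, MulOpposite.unop_zero]
  neg_mem' {a} ha := by
    have ha' : (τ (a : A)).unop = a := congrArg Subtype.val ha
    refine Subtype.ext ?_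
    change (τ (-(a : A))).unop = -(a : A)
    rw [map_neg, MulOpposite.unop_neg, ha']

end RingInvo

/-- `Σ_σ(A)` for a self-map `σ` of the center of `A`: the subgroup generated by all `Σ_ρ(A)`, `ρ`
an involution of `A` restricting to `σ` on the center (for a division algebra and unitary `ρ` all
these `Σ_ρ(A)` coincide). -/
def sigmaOver {A : Type*} [Ring A] (σ : Subring.center A → Subring.center A) : Subgroup Aˣ :=
  ⨆ ρ : {ρ : RingInvo A // ρ.onCenter = σ}, ρ.1.sigma

/-- The index set is finite and the set `P` is the product of the subgroups `W i`, the factors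
being taken in any order. -/
def IsProductOf {ι G : Type*} [Group G] (P : Set G) (W : ι → Subgroup G) : Prop :=
  Finite ι ∧ ∀ l : List ι, l.Nodup → (∀ i, i ∈ l) →
    P = (l.map fun i => (W i : Set G)).prod

/-! ### Graded division rings -/

section Graded

variable {Γ E : Type*} [AddCommGroup Γ] [DecidableEq Γ] [Ring E]
variable (𝒜 : Γ → AddSubgroup E) [GradedRing 𝒜]

/-- A graded division ring: the grading group is torsion-free, the ring is not zero and every
nonzero homogeneous element is invertible. -/
class IsGradedDivisionRing : Prop where
  torsionFree : IsAddTorsionFree Γ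
  nontrivial : Nontrivial E
  isUnit : ∀ (γ : Γ) (x : E), x ∈ 𝒜 γ → x ≠ 0 → IsUnit x

/-- The grade set `Γ_S` of a subring `S` of `E`; for `S = ⊤` it is `Γ_E`. -/
def gradeSet (S : Subring E) : Set Γ := {γ | ∃ s ∈ S, s ∈ 𝒜 γ ∧ s ≠ 0}

/-- The subring `E₀` of elements of degree `0`. -/
abbrev gradeZero : Subring E := SetLike.GradeZero.subring 𝒜

/-- The embedding `E₀ˣ → Eˣ`. -/
abbrev unitsIncl : (gradeZero 𝒜)ˣ →* Eˣ := Units.map ((gradeZero 𝒜).subtype : gradeZero 𝒜 →* E)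

theorem IsGradedDivisionRing.noZeroDivisors {Γ E : Type*} [AddCommGroup Γ] [DecidableEq Γ] [Ring E]
    (𝒜 : Γ → AddSubgroup E) [GradedRing 𝒜] [IsGradedDivisionRing 𝒜] :
    NoZeroDivisors E := by
  classical
  have := IsGradedDivisionRing.torsionFree 𝒜
  have := IsGradedDivisionRing.nontrivial 𝒜
  have hU : TwoUniqueSums Γ := TwoUniqueSums.of_injective_addHom
    (DivisibleHull.coeAddMonoidHom (M := Γ)).toAddHom DivisibleHull.coe_injective inferInstance
  refine ⟨fun {a b} hab => ?_⟩
  by_contra hne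
  rw [not_or] at hne
  have ha : (DirectSum.decompose 𝒜 a).support.Nonempty := by
    rw [Finset.nonempty_iff_ne_empty]
    intro h
    rw [DFinsupp.support_eq_empty] at h
    exact hne.1 ((DirectSum.decompose 𝒜).injective (h.trans (DirectSum.decompose_zero 𝒜).symm))
  have hb : (DirectSum.decompose 𝒜 b).support.Nonempty := by
    rw [Finset.nonempty_iff_ne_empty]
    intro h
    rw [DFinsupp.support_eq_empty] at h
    exact hne.2 ((DirectSum.decompose 𝒜).injective (h.trans (DirectSum.decompose_zero 𝒜).symm))
  obtain ⟨i, hi, j, hj, hij⟩ := UniqueSums.uniqueAdd_of_nonempty ha hb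
  have h0 : ((DirectSum.decompose 𝒜 (a * b)) (i + j) : E) = 0 := by
    rw [hab, DirectSum.decompose_zero]; rfl
  rw [DirectSum.decompose_mul, DirectSum.coe_mul_apply, Finset.sum_eq_single (i, j)] at h0
  · have hai : (DirectSum.decompose 𝒜 a i : E) ≠ 0 := by
      simpa [DFinsupp.mem_support_iff] using hi
    have hbj : (DirectSum.decompose 𝒜 b j : E) ≠ 0 := by
      simpa [DFinsupp.mem_support_iff] using hj
    have u1 := IsGradedDivisionRing.isUnit (𝒜 := 𝒜) i _ (DirectSum.decompose 𝒜 a i).2 hai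
    have u2 := IsGradedDivisionRing.isUnit (𝒜 := 𝒜) j _ (DirectSum.decompose 𝒜 b j).2 hbj
    exact (u1.mul u2).ne_zero h0
  · rintro ⟨k, l⟩ hkl hne'
    rw [Finset.mem_filter, Finset.mem_product] at hkl
    obtain ⟨rfl, rfl⟩ := hij hkl.1.1 hkl.1.2 hkl.2
    exact absurd rfl hne'
  · intro h
    exact (h (Finset.mem_filter.mpr ⟨Finset.mem_product.mpr ⟨hi, hj⟩, rfl⟩)).elim

theorem IsGradedDivisionRing.isDomain_center {Γ E : Type*} [AddCommGroup Γ] [DecidableEq Γ] [Ring E]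
    (𝒜 : Γ → AddSubgroup E) [GradedRing 𝒜] [IsGradedDivisionRing 𝒜] :
    IsDomain (Subring.center E) := by
  have := IsGradedDivisionRing.noZeroDivisors 𝒜
  have := IsGradedDivisionRing.nontrivial 𝒜
  have : NoZeroDivisors (Subring.center E) := inferInstance
  have : Nontrivial (Subring.center E) := inferInstance
  exact NoZeroDivisors.to_isDomain _

section Domain

variable [IsGradedDivisionRing 𝒜]

theorem IsGradedDivisionRing.isUnit_or_eq_zero (a : gradeZero 𝒜) : IsUnit a ∨ a = 0 := by
  by_cases h : (a : E) = 0
  · exact Or.inr (Subtype.ext h)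
  · left
    have ha : (a : E) ∈ 𝒜 0 := a.2
    obtain ⟨u, hu⟩ := IsGradedDivisionRing.isUnit (𝒜 := 𝒜) 0 (a : E) ha h
    have hv : ((u⁻¹ : Eˣ) : E) ∈ 𝒜 0 := by
      have h1 : (a : E) * ((DirectSum.decompose 𝒜 ((u⁻¹ : Eˣ) : E)) 0 : E) = 1 := by
        rw [← DirectSum.coe_decompose_mul_of_left_mem_zero 𝒜 ha, ← hu, Units.mul_inv,
          DirectSum.decompose_of_mem_same 𝒜 (SetLike.one_mem_graded 𝒜)]
      have h2 : ((u⁻¹ : Eˣ) : E) = ((DirectSum.decompose 𝒜 ((u⁻¹ : Eˣ) : E)) 0 : E) := by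
        rw [← hu] at h1
        exact Units.inv_eq_of_mul_eq_one_right h1
      rw [h2]
      exact SetLike.coe_mem _
    refine ⟨⟨a, ⟨_, hv⟩, Subtype.ext ?_, Subtype.ext ?_⟩, rfl⟩
    · change (a : E) * ((u⁻¹ : Eˣ) : E) = 1
      rw [← hu, Units.mul_inv]
    · change ((u⁻¹ : Eˣ) : E) * (a : E) = 1
      rw [← hu, Units.inv_mul]

/-- The center `Z(E₀)` is a field. -/
instance centerGradeZeroField : Field (Subring.center (gradeZero 𝒜)) :=
  have : Nontrivial E := IsGradedDivisionRing.nontrivial 𝒜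
  Field.ofIsUnitOrEqZero (R := Subring.center (gradeZero 𝒜)) fun z => by
    rcases IsGradedDivisionRing.isUnit_or_eq_zero 𝒜 (z : gradeZero 𝒜) with ⟨u, hu⟩ | h
    · left
      have hc : ((u⁻¹ : (gradeZero 𝒜)ˣ) : gradeZero 𝒜) ∈ Subring.center (gradeZero 𝒜) := by
        rw [Subring.mem_center_iff]
        intro g
        have hz := Subring.mem_center_iff.mp z.2 g
        rw [← hu] at hz
        rw [Units.eq_inv_mul_iff_mul_eq, ← mul_assoc, ← hz, mul_assoc, Units.mul_inv, mul_one]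
      refine ⟨⟨z, ⟨_, hc⟩, Subtype.ext ?_, Subtype.ext ?_⟩, rfl⟩
      · change (z : gradeZero 𝒜) * ((u⁻¹ : (gradeZero 𝒜)ˣ) : gradeZero 𝒜) = 1
        rw [← hu, Units.mul_inv]
      · change ((u⁻¹ : (gradeZero 𝒜)ˣ) : gradeZero 𝒜) * (z : gradeZero 𝒜) = 1
        rw [← hu, Units.inv_mul]
    · exact Or.inr (Subtype.ext h)

/-- `T₀ = Z(E) ∩ E₀`, as a subfield of `Z(E₀)`. -/
def centerZero : Subfield (Subring.center (gradeZero 𝒜)) where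
  __ := (Subring.center E).comap
    ((gradeZero 𝒜).subtype.comp (Subring.center (gradeZero 𝒜)).subtype)
  inv_mem' z hz := by
    change ((z⁻¹ : Subring.center (gradeZero 𝒜)) : E) ∈ Subring.center E
    have hz' : (z : E) ∈ Subring.center E := hz
    by_cases h : z = 0
    · rw [h, inv_zero]; exact (Subring.center E).zero_mem
    · have h1 : (z : E) * ((z⁻¹ : Subring.center (gradeZero 𝒜)) : E) = 1 :=
        congrArg (fun w : Subring.center (gradeZero 𝒜) => (w : E)) (mul_inv_cancel₀ h)
      have h2 : ((z⁻¹ : Subring.center (gradeZero 𝒜)) : E) * (z : E) = 1 :=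
        congrArg (fun w : Subring.center (gradeZero 𝒜) => (w : E)) (inv_mul_cancel₀ h)
      let u : Eˣ := ⟨(z : E), _, h1, h2⟩
      rw [Subring.mem_center_iff] at hz' ⊢
      intro g
      change g * ((u⁻¹ : Eˣ) : E) = ((u⁻¹ : Eˣ) : E) * g
      have hg : g * (u : E) = (u : E) * g := hz' g
      rw [Units.eq_inv_mul_iff_mul_eq, ← mul_assoc, ← hg, mul_assoc, Units.mul_inv, mul_one]

/-- The inclusion `T₀ → T = Z(E)`. -/
def centerZeroIncl : centerZero 𝒜 →+* Subring.center E :=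
  (((gradeZero 𝒜).subtype.comp (Subring.center (gradeZero 𝒜)).subtype).comp
    (centerZero 𝒜).subtype).codRestrict _ fun z => z.2

/-- The Galois group `H = Gal(Z(E₀)/T₀)`. -/
abbrev galH : Type _ :=
  Subring.center (gradeZero 𝒜) ≃ₐ[centerZero 𝒜] Subring.center (gradeZero 𝒜)

/-- The quotient field `q(T)` of the center `T` of `E`. -/
def quotCenter (_ : Γ → AddSubgroup E) : Type _ := FractionRing (Subring.center E)

instance quotCenterField : Field (quotCenter 𝒜) :=
  have : IsDomain (Subring.center E) := IsGradedDivisionRing.isDomain_center 𝒜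
  inferInstanceAs (Field (FractionRing (Subring.center E)))

instance quotCenterAlgebra : Algebra (Subring.center E) (quotCenter 𝒜) :=
  have : IsDomain (Subring.center E) := IsGradedDivisionRing.isDomain_center 𝒜
  inferInstanceAs (Algebra (Subring.center E) (FractionRing (Subring.center E)))

instance quotCenterIsFractionRing : IsFractionRing (Subring.center E) (quotCenter 𝒜) :=
  have : IsDomain (Subring.center E) := IsGradedDivisionRing.isDomain_center 𝒜
  inferInstanceAs (IsFractionRing (Subring.center E) (FractionRing (Subring.center E)))

/-- The quotient division ring `q(E) = q(T) ⊗_T E`, a `q(T)`-algebra. -/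
abbrev quotRing : Type _ := quotCenter 𝒜 ⊗[Subring.center E] E

/-- The reduced norm `Nrd_E(a) = Nrd_{q(E)}(a)` of the graded division ring `E`. -/
def gradedNrd : E →* quotCenter 𝒜 :=
  (reducedNorm (quotCenter 𝒜) (quotRing 𝒜)).comp
    ((Algebra.TensorProduct.includeRight : E →ₐ[Subring.center E] quotRing 𝒜) : E →* quotRing 𝒜)

/-- The reduced norm `Nrd_{E₀} : E₀ → Z(E₀)`. -/
def nrdZero : gradeZero 𝒜 →* Subring.center (gradeZero 𝒜) :=
  reducedNorm (Subring.center (gradeZero 𝒜)) (gradeZero 𝒜)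

/-- The number `∂ = ind(E) / (ind(E₀) [Z(E₀) : T₀])`. -/
def gradedDel : ℕ :=
  centralIndex E / (centralIndex (gradeZero 𝒜) *
    Module.finrank (centerZero 𝒜) (Subring.center (gradeZero 𝒜)))

end Domain

/-- A graded involution: an involution `τ` of `E` with `τ(E_γ) = E_γ` for all `γ`. -/
structure GradedInvolution extends RingInvo E where
  map_mem : ∀ (γ : Γ) (x : E), x ∈ 𝒜 γ → (toRingInvo x).unop ∈ 𝒜 γ

namespace GradedInvolution

variable {𝒜} (τ : GradedInvolution 𝒜)

/-- The restriction of a graded involution to `E₀`. -/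
def zero : RingInvo (gradeZero 𝒜) where
  toFun a := MulOpposite.op ⟨(τ.toRingInvo (a : E)).unop, τ.map_mem 0 a a.2⟩
  invFun a := ⟨(τ.toRingInvo (a.unop : E)).unop, τ.map_mem 0 a.unop a.unop.2⟩
  left_inv a := Subtype.ext (τ.toRingInvo.involution (a : E))
  right_inv a := MulOpposite.unop_injective (Subtype.ext (τ.toRingInvo.involution (a.unop : E)))
  map_mul' a b := MulOpposite.unop_injective (Subtype.ext (τ.toRingInvo.unop_map_mul (a : E) b))
  map_add' a b := MulOpposite.unop_injective (Subtype.ext (by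
    change (τ.toRingInvo ((a : E) + b)).unop =
      (τ.toRingInvo (a : E)).unop + (τ.toRingInvo (b : E)).unop
    rw [map_add, MulOpposite.unop_add]))
  involution' a := Subtype.ext (τ.toRingInvo.involution (a : E))

/-- `T` is unramified over `R = T^τ`: they have the same grade group. -/
def IsUnramified : Prop :=
  gradeSet 𝒜 (Subring.center E) =
    gradeSet 𝒜 (τ.toRingInvo.fixedCenter.map (Subring.center E).subtype)

variable [IsGradedDivisionRing 𝒜]

/-- `R₀ = R ∩ E₀`, as a subring of `T₀`. -/
def fixedZero : Subring (centerZero 𝒜) := τ.toRingInvo.fixedCenter.comap (centerZeroIncl 𝒜)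

/-- `Σ'_τ(E) = {a ∈ Eˣ | Nrd_E(a) ∈ Rˣ}`. -/
def sigma' : Subgroup Eˣ :=
  (Units.map (((algebraMap (Subring.center E) (quotCenter 𝒜)).comp
    τ.toRingInvo.fixedCenter.subtype : τ.toRingInvo.fixedCenter →+* quotCenter 𝒜) :
      τ.toRingInvo.fixedCenter →* quotCenter 𝒜)).range.comap (Units.map (gradedNrd 𝒜))

/-- `Σ_τ(E) · E'`, where `E' = [Eˣ, Eˣ]`. -/
abbrev sigmaComm : Subgroup Eˣ := τ.toRingInvo.sigma ⊔ commutator Eˣ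

/-- The reduced unitary Whitehead group `SK₁(E, τ) = Σ'_τ(E) / (Σ_τ(E) E')`. -/
abbrev SK1 : Type _ := τ.sigma' ⧸ τ.sigmaComm.subgroupOf τ.sigma'

/-- `Σ_τ(E) ∩ E₀`, as a subgroup of `E₀ˣ`. -/
abbrev sigmaZero : Subgroup (gradeZero 𝒜)ˣ := τ.toRingInvo.sigma.comap (unitsIncl 𝒜)

/-- `Σ'_τ(E) ∩ E₀`, as a subgroup of `E₀ˣ`. -/
abbrev sigma'Zero : Subgroup (gradeZero 𝒜)ˣ := τ.sigma'.comap (unitsIncl 𝒜)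

/-- The map `h τ̄` on `Z(E₀)`, where `τ̄` is the restriction of `τ` to `Z(E₀)`. -/
def twist (h : galH 𝒜) : Subring.center (gradeZero 𝒜) → Subring.center (gradeZero 𝒜) :=
  fun z => h (τ.zero.onCenter z)

/-- `Σ_{h τ̄}(E₀)`. -/
def sigmaTwist (h : galH 𝒜) : Subgroup (gradeZero 𝒜)ˣ := sigmaOver (τ.twist h)

/-- The subgroup `P` of `E₀ˣ` generated by the `Σ_{h τ̄}(E₀)`, `h ∈ H`. -/
def groupP : Subgroup (gradeZero 𝒜)ˣ := ⨆ h : galH 𝒜, τ.sigmaTwist h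

/-- A choice of nonzero symmetric elements `x_γ ∈ E_γ` for `γ ∈ Γ_E` (the values outside
`Γ_E` are irrelevant; nonzero homogeneous elements are units). -/
def IsSymmetricChoice (x : Γ → Eˣ) : Prop :=
  ∀ γ ∈ gradeSet 𝒜 (⊤ : Subring E), (x γ : E) ∈ 𝒜 γ ∧ (τ.toRingInvo (x γ : E)).unop = x γ

end GradedInvolution

/-- `X`: the subgroup of `Eˣ` generated by the `x_γ x_δ x_{γ+δ}⁻¹` with `γ, δ ∈ Γ_E`. -/
def groupX (x : Γ → Eˣ) : Subgroup Eˣ :=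
  Subgroup.closure {u | ∃ γ ∈ gradeSet 𝒜 (⊤ : Subring E), ∃ δ ∈ gradeSet 𝒜 (⊤ : Subring E),
    u = x γ * x δ * (x (γ + δ))⁻¹}

end Graded

end

/-! Let θ be the conjugation action of `Eˣ` on `Z(E₀)`. It fixes `T₀`, is trivial on `E₀ˣ`, and so
depends only on degrees; hence its image is abelian. Its fixed field is `T₀`, because homogeneous
elements generate `E`, so by Artin's theorem `Z(E₀)/T₀` is Galois and θ maps onto `H`, which is
therefore abelian.

As `T` is unramified over `R`, dividing a moved homogeneous central element by one of `R` of the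
same degree gives some t in `T₀` with τ(t) ≠ t. Symmetrizing y or ty then yields a symmetric unit in
every degree of `Γ_E`. Units are homogeneous because `Γ` is torsion-free, so `Eˣ = Σ_τ · E₀ˣ`
(`exists_eq_mul_unitsIncl`). In a division ring with unitary involution, commutators lie in Σ
(`RingInvo.commutator_le_sigma`); applied to `E₀`, this makes `Eˣ/Σ_τ` abelian. Thus `Σ_τ E' = Σ_τ`,
and the isomorphism onto `SK₁` follows once `Σ_τ ≤ Σ'_τ`.

Norms are computed with minimal polynomials. The minimal polynomial of a homogeneous element has
coefficients in `T`, fixed by τ if the element is symmetric, whence `Σ_τ ≤ Σ'_τ`. For a in `E₀` the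
minimal polynomial over `q(T)` is the one over `T₀`, which up to powers is the product of the Galois
conjugates of the one over `Z(E₀)`. This gives the formula with ∂.

For symmetric x with θ(x) = h, the map a ↦ x τ(a) x⁻¹ is an involution of `E₀` over hτ̄, and a is
symmetric for it exactly when ax is τ-symmetric. By Skolem–Noether its Σ depends only on h. So a
symmetric unit of degree γ is an element of `P` times `x_γ`; products of the `x_γ` collapse to a
single `x_γ` up to `X`, and degree 0 forces γ = 0. Finally `Σ_{α²hτ̄} ≤ Σ_{hτ̄} Σ_{αhτ̄}`
(`sigmaTwist_sq_mul_le`) reduces all exponents of generators of `H` to 0 and 1. -/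

noncomputable section

/-! ### Simplicity of tensor products of division algebras -/

section TensorSimple

variable {K D A : Type*} [Field K] [Ring D] [Algebra K D] [Ring A] [Algebra K A]

theorem basis_repr_tmul_one_mul {ι : Type*} (b : Module.Basis ι K A) (y : D) (x : D ⊗[K] A) (i : ι) :
    (Algebra.TensorProduct.basis D b).repr ((y ⊗ₜ 1) * x) i =
      y * (Algebra.TensorProduct.basis D b).repr x i := by
  induction x with
  | zero => simp
  | add x z hx hz => simp [mul_add, hx, hz]
  | tmul d a => simp [Algebra.TensorProduct.basis_repr_tmul, mul_assoc]

theorem basis_repr_mul_tmul_one {ι : Type*} (b : Module.Basis ι K A) (y : D) (x : D ⊗[K] A) (i : ι) :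
    (Algebra.TensorProduct.basis D b).repr (x * (y ⊗ₜ 1)) i =
      (Algebra.TensorProduct.basis D b).repr x i * y := by
  induction x with
  | zero => simp
  | add x z hx hz => simp [add_mul, hx, hz]
  | tmul d a => simp [Algebra.TensorProduct.basis_repr_tmul, mul_assoc, Algebra.commutes]

/-- Shortest-element argument. Expand a nonzero element of an ideal over `D` in a basis of `A` and
scale one coefficient to 1. Commutators with `D` have smaller support; if they all vanish, the
coefficients are central, hence in `K`, and the element is `1 ⊗ a` with `a` invertible. -/
theorem isSimpleRing_tensorProduct [Nontrivial D] [Nontrivial A] [Algebra.IsCentral K D]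
    (hD : ∀ a : D, a ≠ 0 → IsUnit a) (hA : ∀ a : A, a ≠ 0 → IsUnit a) :
    IsSimpleRing (D ⊗[K] A) := by
  classical
  have b := Module.Free.chooseBasis K A
  set B := Algebra.TensorProduct.basis D b with hB
  have key : ∀ I : TwoSidedIdeal (D ⊗[K] A), ∀ n : ℕ, ∀ x ∈ I, x ≠ 0 →
      (B.repr x).support.card = n → (1 : D ⊗[K] A) ∈ I := by
    intro I n
    induction n using Nat.strong_induction_on with
    | _ n ih =>
      intro x hxI hx hn
      have hsupp : (B.repr x).support.Nonempty := by
        rw [Finset.nonempty_iff_ne_empty, ne_eq, Finsupp.support_eq_empty]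
        simpa using hx
      obtain ⟨j, hj⟩ := hsupp
      obtain ⟨d, hd⟩ := hD _ (Finsupp.mem_support_iff.mp hj)
      set x' := (((d⁻¹ : Dˣ) : D) ⊗ₜ[K] (1 : A)) * x with hx'
      have hx'I : x' ∈ I := I.mul_mem_left _ _ hxI
      have hrep : ∀ i, B.repr x' i = ((d⁻¹ : Dˣ) : D) * B.repr x i :=
        fun i => basis_repr_tmul_one_mul b _ x i
      have hj1 : B.repr x' j = 1 := by rw [hrep, ← hd, Units.inv_mul]
      by_cases hc : ∀ y : D, (y ⊗ₜ[K] (1 : A)) * x' - x' * (y ⊗ₜ[K] (1 : A)) = 0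
      · have hcen : ∀ i, ∃ k : K, algebraMap K D k = B.repr x' i := by
          intro i
          have : B.repr x' i ∈ Subalgebra.center K D := by
            rw [Subalgebra.mem_center_iff]
            intro y
            have h := congrArg (fun z => B.repr z i) (sub_eq_zero.mp (hc y))
            simpa only [hB, basis_repr_tmul_one_mul, basis_repr_mul_tmul_one] using h
          obtain ⟨k, hk⟩ := Algebra.IsCentral.out this
          exact ⟨k, hk⟩
        choose k hk using hcen
        have hxa : x' = 1 ⊗ₜ (∑ i ∈ (B.repr x').support, k i • b i) := by
          conv_lhs => rw [← B.linearCombination_repr x', Finsupp.linearCombination_apply, Finsupp.sum]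
          rw [TensorProduct.tmul_sum]
          refine Finset.sum_congr rfl fun i _ => ?_
          rw [← hk i, hB, Algebra.TensorProduct.basis_apply, TensorProduct.tmul_smul,
            TensorProduct.smul_tmul', TensorProduct.smul_tmul', Algebra.smul_def, smul_eq_mul]
        have hne : (∑ i ∈ (B.repr x').support, k i • b i) ≠ 0 := by
          intro h0
          rw [h0, TensorProduct.tmul_zero] at hxa
          rw [hxa] at hj1
          simp at hj1
        obtain ⟨u, hu⟩ := hA _ hne
        have := I.mul_mem_left (1 ⊗ₜ[K] ((u⁻¹ : Aˣ) : A)) _ hx'I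
        rw [hxa, ← hu, Algebra.TensorProduct.tmul_mul_tmul, Units.inv_mul, one_mul] at this
        exact this
      · push Not at hc
        obtain ⟨y, hy⟩ := hc
        refine ih _ ?_ _ (I.sub_mem (I.mul_mem_left _ _ hx'I) (I.mul_mem_right _ _ hx'I)) hy rfl
        rw [← hn]
        apply Finset.card_lt_card
        rw [Finset.ssubset_iff]
        refine ⟨j, ?_, ?_⟩
        · simp only [hB, map_sub, Finsupp.mem_support_iff, Finsupp.sub_apply,
            basis_repr_tmul_one_mul, basis_repr_mul_tmul_one, not_not]
          rw [← hB, hj1, mul_one, one_mul, sub_self]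
        · intro i hi
          rw [Finset.mem_insert] at hi
          rcases hi with rfl | hi
          · exact hj
          · rw [Finsupp.mem_support_iff] at hi ⊢
            intro h0
            apply hi
            simp only [hB, map_sub, Finsupp.sub_apply, basis_repr_tmul_one_mul,
              basis_repr_mul_tmul_one]
            rw [← hB, hrep, h0]
            simp
  have : Nontrivial (D ⊗[K] A) := by
    obtain ⟨i⟩ := b.index_nonempty
    exact ⟨B i, 0, B.ne_zero i⟩
  refine ⟨⟨fun I => ?_⟩⟩
  by_cases h : I = ⊥
  · exact Or.inl h
  · right
    have : ∃ x ∈ I, x ≠ 0 := by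
      by_contra hcon
      push Not at hcon
      apply h
      rw [eq_bot_iff]
      intro x hx
      rw [TwoSidedIdeal.mem_bot]
      exact hcon x hx
    obtain ⟨x, hx, hx0⟩ := this
    rw [eq_top_iff]
    intro z _
    simpa using I.mul_mem_left z _ (key I _ x hx hx0 rfl)

end TensorSimple

/-! ### Endomorphisms of a central division algebra and Skolem–Noether -/

section Division

variable {K D : Type*} [Field K] [Ring D] [IsDomain D] [Algebra K D] [FiniteDimensional K D]

theorem isUnit_of_finiteDimensional (K : Type*) {D : Type*} [Field K] [Ring D] [IsDomain D]
    [Algebra K D] [FiniteDimensional K D] (a : D) (ha : a ≠ 0) : IsUnit a :=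
  IsIntegral.isUnit (Algebra.IsIntegral.isIntegral (R := K) a) ha

variable [Algebra.IsCentral K D]

/-- `D ⊗ Dᵐᵒᵖ` is simple, so its action on `D` by left and right multiplication has zero kernel. -/
theorem mulLeftRight_injective :
    Function.Injective (AlgHom.mulLeftRight K D) := by
  have hD := isUnit_of_finiteDimensional K (D := D)
  have hop : ∀ a : Dᵐᵒᵖ, a ≠ 0 → IsUnit a := fun a ha => by
    have := hD a.unop (by simpa using ha)
    simpa using this.op
  have := isSimpleRing_tensorProduct (K := K) hD hop
  exact RingHom.injective (AlgHom.mulLeftRight K D).toRingHom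

/-- With a basis `b`, every `K`-linear endomorphism of `D` is `x ↦ ∑ aᵢ x bᵢ` for unique `aᵢ`. -/
def endOfCoeffs {ι : Type*} [Fintype ι] (b : Module.Basis ι K D) :
    (ι → D) →ₗ[K] Module.End K D where
  toFun a := ∑ i, LinearMap.mulLeftRight K (a i, b i)
  map_add' a c := by
    ext x
    simp [add_mul, Finset.sum_add_distrib]
  map_smul' k a := by
    ext x
    simp [Finset.smul_sum]

omit [IsDomain D] [FiniteDimensional K D] [Algebra.IsCentral K D] in
theorem endOfCoeffs_apply {ι : Type*} [Fintype ι] (b : Module.Basis ι K D) (a : ι → D) (x : D) :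
    endOfCoeffs b a x = ∑ i, a i * x * b i := by
  simp [endOfCoeffs]

theorem endOfCoeffs_injective {ι : Type*} [Fintype ι] (b : Module.Basis ι K D) :
    Function.Injective (endOfCoeffs b) := by
  classical
  rw [← LinearMap.ker_eq_bot, LinearMap.ker_eq_bot']
  intro a ha
  let b' : Module.Basis ι K Dᵐᵒᵖ := b.map (MulOpposite.opLinearEquiv K)
  have h : AlgHom.mulLeftRight K D (∑ i, a i ⊗ₜ MulOpposite.op (b i)) = 0 := by
    ext x
    have := LinearMap.congr_fun ha x
    rw [endOfCoeffs_apply] at this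
    simpa [map_sum, LinearMap.sum_apply] using this
  have h0 := mulLeftRight_injective (h.trans (map_zero _).symm)
  have hr := congrArg (Algebra.TensorProduct.basis D b').repr h0
  funext j
  have hj := DFunLike.congr_fun hr j
  simp only [map_sum, Algebra.TensorProduct.basis_repr_tmul, map_zero, Finsupp.coe_zero,
    Pi.zero_apply, Finsupp.finsetSum_apply, Finsupp.smul_apply, Finsupp.mapRange_apply] at hj
  have hb' : ∀ i, b'.repr (MulOpposite.op (b i)) j = if i = j then 1 else 0 := by
    intro i
    have : MulOpposite.op (b i) = b' i := by simp [b']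
    rw [this, Module.Basis.repr_self, Finsupp.single_apply]
  simp only [hb'] at hj
  simpa using hj

/-- Both sides have dimension `(dim D)²` over `K`, so injectivity suffices. -/
theorem endOfCoeffs_surjective {ι : Type*} [Fintype ι] (b : Module.Basis ι K D) :
    Function.Surjective (endOfCoeffs b) := by
  refine (LinearMap.injective_iff_surjective_of_finrank_eq_finrank ?_).mp (endOfCoeffs_injective b)
  rw [Module.finrank_linearMap, Module.finrank_pi_fintype, Finset.sum_const, Finset.card_univ,
    smul_eq_mul, Module.finrank_eq_card_basis b]

/-- Skolem–Noether for division algebras. -/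
theorem exists_ne_zero_forall_mul_eq (ψ : D ≃+* D) (hψ : ∀ k : K, ψ (algebraMap K D k) = algebraMap K D k) :
    ∃ u : D, u ≠ 0 ∧ ∀ y, ψ y * u = u * y := by
  classical
  let b := Module.finBasis K D
  let ψ' : Module.End K D := (AlgEquiv.ofRingEquiv (f := ψ) hψ).toLinearMap
  have hψ' : ∀ y, ψ' y = ψ y := fun y => rfl
  obtain ⟨a, ha⟩ := endOfCoeffs_surjective b ψ'
  have hne : ∃ i, a i ≠ 0 := by
    by_contra h
    push Not at h
    have h1 : ψ' 1 = 0 := by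
      rw [← ha, endOfCoeffs_apply]
      simp [h]
    rw [hψ', map_one] at h1
    exact one_ne_zero h1
  obtain ⟨i, hi⟩ := hne
  refine ⟨a i, hi, fun y => ?_⟩
  -- Expand ψ(yx) = ψ(y)ψ(x) in the form ∑ aᵢ x bᵢ and compare coefficients: uniqueness gives ψ(y)aᵢ
  -- = aᵢy for every i.
  have h0 : endOfCoeffs b (fun i => ψ y * a i - a i * y) = 0 := by
    ext x
    rw [endOfCoeffs_apply]
    have h1 : ψ' (y * x) = ψ y * ψ' x := by simp [hψ']
    rw [← ha, endOfCoeffs_apply, endOfCoeffs_apply, Finset.mul_sum] at h1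
    rw [LinearMap.zero_apply, ← sub_eq_zero.mpr h1.symm, ← Finset.sum_sub_distrib]
    refine Finset.sum_congr rfl fun i _ => ?_
    noncomm_ring
  have := congrFun (endOfCoeffs_injective b (h0.trans (map_zero _).symm)) i
  exact sub_eq_zero.mp this

end Division

/-! ### Maximal commutative subalgebras and their dimension -/

section MaximalSubfield

variable {K D : Type*} [Field K] [Ring D] [IsDomain D] [Algebra K D] [FiniteDimensional K D]

omit [IsDomain D] [FiniteDimensional K D] in
/-- The map `x ↦ ∑ aᵢ x bᵢ` is `L`-linear if the `aᵢ` lie in the commutative subalgebra `L`. -/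
def endOfCoeffsOver (L : Subalgebra K D) (hL : Subalgebra.centralizer K (L : Set D) = L)
    {ι : Type*} [Fintype ι] (b : Module.Basis ι K D) :
    (ι → L) →ₗ[K] (D →ₗ[L] D) where
  toFun a :=
    { toFun := fun x => endOfCoeffs b (fun i => (a i : D)) x
      map_add' := map_add _
      map_smul' := fun l x => by
        simp only [endOfCoeffs_apply, RingHom.id_apply, Finset.smul_sum]
        refine Finset.sum_congr rfl fun i _ => ?_
        have h : (l : D) * a i = a i * l := by
          have h1 : (a i : D) ∈ Subalgebra.centralizer K (L : Set D) := by rw [hL]; exact (a i).2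
          exact Subalgebra.mem_centralizer_iff K |>.mp h1 l l.2
        rw [Subalgebra.smul_def, Subalgebra.smul_def, smul_eq_mul, smul_eq_mul, ← mul_assoc, ← h]
        simp only [mul_assoc] }
  map_add' a c := by
    ext x
    simp [endOfCoeffs_apply, add_mul, Finset.sum_add_distrib]
  map_smul' k a := by
    ext x
    simp [endOfCoeffs_apply, Finset.smul_sum]

variable [Algebra.IsCentral K D]

/-- An endomorphism ∑ aᵢ x bᵢ commutes with left multiplication by `L` exactly when each aᵢ
centralizes `L`, by uniqueness of coefficients; and `L` is its own centralizer. -/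
theorem endOfCoeffsOver_bijective (L : Subalgebra K D)
    (hL : Subalgebra.centralizer K (L : Set D) = L)
    {ι : Type*} [Fintype ι] (b : Module.Basis ι K D) :
    Function.Bijective (endOfCoeffsOver L hL b) := by
  constructor
  · intro a c hac
    have h : endOfCoeffs b (fun i => (a i : D)) = endOfCoeffs b (fun i => (c i : D)) := by
      ext x
      exact LinearMap.congr_fun hac x
    funext i
    exact Subtype.ext (congrFun (endOfCoeffs_injective b h) i)
  · intro φ
    obtain ⟨a, ha⟩ := endOfCoeffs_surjective b (φ.restrictScalars K)
    have hmem : ∀ i, a i ∈ L := by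
      intro i
      rw [← hL, Subalgebra.mem_centralizer_iff]
      intro l hl
      have h0 : endOfCoeffs b (fun i => l * a i - a i * l) = 0 := by
        ext x
        rw [endOfCoeffs_apply]
        have h1 : φ ((⟨l, hl⟩ : L) • x) = (⟨l, hl⟩ : L) • φ x := map_smul φ _ x
        have h2 : ∀ y, φ y = ∑ i, a i * y * b i := fun y => by
          rw [← endOfCoeffs_apply, ha]; rfl
        simp only [h2, Subalgebra.smul_def, smul_eq_mul, Finset.mul_sum] at h1
        rw [LinearMap.zero_apply, ← sub_eq_zero.mpr h1.symm, ← Finset.sum_sub_distrib]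
        refine Finset.sum_congr rfl fun i _ => ?_
        noncomm_ring
      exact sub_eq_zero.mp (congrFun (endOfCoeffs_injective b (h0.trans (map_zero _).symm)) i)
    refine ⟨fun i => ⟨a i, hmem i⟩, ?_⟩
    ext x
    exact LinearMap.congr_fun ha x

omit [Algebra.IsCentral K D] in
theorem finrank_mul_finrank_subalgebra (L : Subalgebra K D) :
    Module.Free L D ∧ StrongRankCondition L ∧
      Module.finrank K L * Module.finrank L D = Module.finrank K D := by
  let : DivisionRing L := divisionRingOfFiniteDimensional K L
  have h1 : Module.Free L D := Module.Free.of_divisionRing L D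
  have h2 : StrongRankCondition L := inferInstance
  exact ⟨h1, h2, Module.finrank_mul_finrank K L D⟩

/-- A self-centralizing subalgebra of a central division algebra of dimension `n²` has
dimension `n`. -/
theorem finrank_mul_self_of_centralizer_eq (L : Subalgebra K D)
    (hL : Subalgebra.centralizer K (L : Set D) = L) :
    Module.finrank K L * Module.finrank K L = Module.finrank K D := by
  obtain ⟨hfree, hrank, hmul⟩ := finrank_mul_finrank_subalgebra L
  have hfin : Module.Finite L D := Module.Finite.of_restrictScalars_finite K L D
  have c := Module.finBasis L D
  have b := Module.finBasis K D
  -- The `L`-endomorphisms of `D` are counted twice: as dim `D` coefficients in `L`, and as images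
  -- in `D` of an `L`-basis of `D`. Hence `[L:K] = [D:L]`.
  have e := (LinearEquiv.ofBijective _ (endOfCoeffsOver_bijective L hL b)).trans (c.constr K).symm
  have h := e.finrank_eq
  rw [Module.finrank_pi_fintype, Module.finrank_pi_fintype] at h
  simp only [Finset.sum_const, Finset.card_univ, Fintype.card_fin, smul_eq_mul] at h
  have hpos : 0 < Module.finrank K D := Module.finrank_pos
  have h' : Module.finrank K L = Module.finrank L D := by
    rw [mul_comm] at h
    exact Nat.eq_of_mul_eq_mul_right hpos h
  rw [← hmul, ← h']

-- A commutative subalgebra of largest dimension above `S` works: adjoining an element of its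
-- centralizer keeps it commutative.
omit [IsDomain D] [Algebra.IsCentral K D] in
theorem exists_centralizer_eq (S : Subalgebra K D) (hS : ∀ a ∈ S, ∀ b ∈ S, a * b = b * a) :
    ∃ L : Subalgebra K D, S ≤ L ∧ Subalgebra.centralizer K (L : Set D) = L := by
  let P : Set (Subalgebra K D) := {L | S ≤ L ∧ ∀ a ∈ L, ∀ b ∈ L, a * b = b * a}
  have hne : P.Nonempty := ⟨S, le_rfl, hS⟩
  obtain ⟨L, ⟨hSL, hLc⟩, hmax⟩ : ∃ L ∈ P, ∀ L' ∈ P, L ≤ L' → L' = L := by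
    have hbdd : ∃ N, ∀ L ∈ P, Module.finrank K L ≤ N :=
      ⟨Module.finrank K D, fun L _ => Submodule.finrank_le L.toSubmodule⟩
    have him : ((fun L : Subalgebra K D => Module.finrank K L) '' P).Nonempty := hne.image _
    have hmem := Nat.sSup_mem him (by
      obtain ⟨N, hN⟩ := hbdd
      exact ⟨N, by rintro _ ⟨L, hL, rfl⟩; exact hN L hL⟩)
    obtain ⟨L, hL, hLs⟩ := hmem
    refine ⟨L, hL, fun L' hL' hle => ?_⟩
    have h1 : Module.finrank K L' ≤ Module.finrank K L := by
      simp only at hLs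
      rw [hLs]
      refine le_csSup ?_ ⟨L', hL', rfl⟩
      obtain ⟨N, hN⟩ := hbdd
      exact ⟨N, by rintro _ ⟨L, hL, rfl⟩; exact hN L hL⟩
    have := Submodule.eq_of_le_of_finrank_le (S₁ := L.toSubmodule) (S₂ := L'.toSubmodule) hle h1
    exact (Subalgebra.toSubmodule_injective this).symm
  refine ⟨L, hSL, le_antisymm ?_ fun a ha => ?_⟩
  · intro c hc
    rw [Subalgebra.mem_centralizer_iff] at hc
    have hcomm : ∀ a ∈ insert c (L : Set D), ∀ b ∈ insert c (L : Set D), a * b = b * a := by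
      rintro a (rfl | ha) b (rfl | hb)
      · rfl
      · exact (hc b hb).symm
      · exact hc a ha
      · exact hLc a ha b hb
    have hadj : ∀ a ∈ Algebra.adjoin K (insert c (L : Set D)),
        ∀ b ∈ Algebra.adjoin K (insert c (L : Set D)), a * b = b * a := by
      have := Algebra.isMulCommutative_adjoin K hcomm
      intro a ha b hb
      exact congrArg Subtype.val (mul_comm' (⟨a, ha⟩ : Algebra.adjoin K (insert c (L : Set D))) ⟨b, hb⟩)
    have hle : L ≤ Algebra.adjoin K (insert c (L : Set D)) :=
      fun a ha => Algebra.subset_adjoin (Set.mem_insert_of_mem _ ha)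
    have := hmax _ ⟨hSL.trans hle, hadj⟩ hle
    rw [← this]
    exact Algebra.subset_adjoin (Set.mem_insert _ _)
  · rw [Subalgebra.mem_centralizer_iff]
    exact fun l hl => hLc l hl a ha

/-- `S` lies in a self-centralizing `L`, of dimension √dim `D`, and `L` is free over the division
ring `S`. -/
theorem finrank_dvd_sqrt_finrank (S : Subalgebra K D) (hS : ∀ a ∈ S, ∀ b ∈ S, a * b = b * a) :
    Module.finrank K S ∣ (Module.finrank K D).sqrt := by
  obtain ⟨L, hSL, hL⟩ := exists_centralizer_eq S hS
  rw [← finrank_mul_self_of_centralizer_eq L hL, Nat.sqrt_eq]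
  let M : Submodule S D :=
    { L.toSubmodule.toAddSubmonoid with
      smul_mem' := fun s x hx => L.mul_mem (hSL s.2) hx }
  let : DivisionRing S := divisionRingOfFiniteDimensional K S
  have h1 : Module.Free S M := Module.Free.of_divisionRing S M
  have h := Module.finrank_mul_finrank K S M
  have e : M ≃ₗ[K] L :=
    { toFun := fun x => ⟨x.1, x.2⟩
      invFun := fun x => ⟨x.1, x.2⟩
      map_add' := fun _ _ => rfl
      map_smul' := fun _ _ => rfl
      left_inv := fun _ => rfl
      right_inv := fun _ => rfl }
  rw [← e.finrank_eq, ← h]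
  exact dvd_mul_right _ _

variable (K D) in
theorem exists_comm_subalgebra_finrank_eq :
    ∃ L : Subalgebra K D, (∀ a ∈ L, ∀ b ∈ L, a * b = b * a) ∧
      Module.finrank K L = (Module.finrank K D).sqrt := by
  obtain ⟨L, -, hL⟩ := exists_centralizer_eq (⊥ : Subalgebra K D) (by
    rintro a ⟨k, rfl⟩ b -
    exact Algebra.commutes k b)
  refine ⟨L, fun a ha b hb => ?_, ?_⟩
  · rw [← SetLike.mem_coe, ← hL, SetLike.mem_coe, Subalgebra.mem_centralizer_iff] at hb
    exact hb a ha
  · rw [← finrank_mul_self_of_centralizer_eq L hL, Nat.sqrt_eq]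

end MaximalSubfield

/-! ### The reduced norm in terms of minimal polynomials -/

section ReducedNorm

open Polynomial

/-- In the basis of matrix units, left multiplication by `M` is the Kronecker product of `M` with
the identity, and so is its characteristic matrix. -/
theorem charpoly_lmul_matrix {F : Type*} [Field F] {n : ℕ} (M : Matrix (Fin n) (Fin n) F) :
    (Algebra.lmul F (Matrix (Fin n) (Fin n) F) M).charpoly = M.charpoly ^ n := by
  rw [← LinearMap.charpoly_toMatrix _ (Matrix.stdBasis F (Fin n) (Fin n))]
  have h : LinearMap.toMatrix (Matrix.stdBasis F (Fin n) (Fin n)) (Matrix.stdBasis F (Fin n) (Fin n))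
      (Algebra.lmul F (Matrix (Fin n) (Fin n) F) M) =
      Matrix.kroneckerMap (fun x y => x * y) M (1 : Matrix (Fin n) (Fin n) F) := by
    ext ⟨i, j⟩ ⟨k, l⟩
    rw [LinearMap.toMatrix_apply, Matrix.stdBasis_eq_single]
    have : ∀ A : Matrix (Fin n) (Fin n) F, (Matrix.stdBasis F (Fin n) (Fin n)).repr A (i, j) = A i j :=
      fun A => by simp [Matrix.stdBasis]
    rw [this]
    by_cases hjl : j = l
    · subst hjl
      simp
    · simp [hjl]
  rw [h]
  have h2 : Matrix.charmatrix (Matrix.kroneckerMap (fun x y => x * y) M (1 : Matrix (Fin n) (Fin n) F)) =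
      Matrix.kroneckerMap (fun x y => x * y) (Matrix.charmatrix M) (1 : Matrix (Fin n) (Fin n) F[X]) := by
    ext1 ⟨i, j⟩ ⟨k, l⟩
    rw [Matrix.kroneckerMap_apply, Matrix.charmatrix_apply, Matrix.charmatrix_apply,
      Matrix.kroneckerMap_apply]
    by_cases hjl : j = l
    · subst hjl
      by_cases hik : i = k
      · subst hik; simp
      · simp [hik]
    · simp [hjl]
  rw [Matrix.charpoly, h2, Matrix.det_kronecker, Matrix.det_one, one_pow, mul_one, Fintype.card_fin,
    Matrix.charpoly]

theorem Polynomial.Monic.eq_of_pow_eq {F : Type*} [Field F] {f g : F[X]} (hf : f.Monic)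
    (hg : g.Monic) {n : ℕ} (hn : n ≠ 0) (h : f ^ n = g ^ n) : f = g := by
  apply eq_of_monic_of_associated hf hg
  exact associated_of_dvd_dvd ((UniqueFactorizationMonoid.pow_dvd_pow_iff_dvd hn).mp h.dvd)
    ((UniqueFactorizationMonoid.pow_dvd_pow_iff_dvd hn).mp h.symm.dvd)

/-- A monic polynomial all of whose irreducible factors are equal to `m`. -/
theorem Polynomial.Monic.eq_pow_of_forall_irreducible {F : Type*} [Field F] {c m : F[X]}
    (hc : c.Monic) (h : ∀ p : F[X], p.Monic → Irreducible p → p ∣ c → p = m) :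
    ∃ r, c = m ^ r := by
  induction hk : c.natDegree using Nat.strong_induction_on generalizing c with
  | _ k ih =>
    by_cases hu : IsUnit c
    · exact ⟨0, by rw [pow_zero]; exact hc.eq_one_of_isUnit hu⟩
    · obtain ⟨p, hp, hirr, hpc⟩ := exists_monic_irreducible_factor c hu
      have hpm := h p hp hirr hpc
      obtain ⟨q, rfl⟩ := hpc
      have hq : q.Monic := hp.of_mul_monic_left hc
      have hlt : q.natDegree < k := by
        rw [← hk, hp.natDegree_mul hq]
        have := hirr.natDegree_pos
        omega
      obtain ⟨r, hr⟩ := ih _ hlt hq (fun p hp hirr hpq => h p hp hirr (hpq.mul_left _)) rfl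
      exact ⟨r + 1, by rw [pow_succ', ← hr, hpm]⟩

theorem finrank_adjoin_singleton (K : Type*) {A : Type*} [Field K] [Ring A] [Algebra K A] (a : A) :
    Module.finrank K (Algebra.adjoin K {a}) = (minpoly K a).natDegree := by
  rw [Algebra.adjoin_singleton_eq_range_aeval]
  have h1 := (Ideal.quotientKerEquivRange (aeval (R := K) a)).toLinearEquiv.finrank_eq
  have h2 : Module.finrank K (K[X] ⧸ Ideal.span {minpoly K a}) = (minpoly K a).natDegree :=
    _root_.finrank_quotient_span_eq_natDegree
  rw [← h1, ← h2]
  exact congrArg (fun I : Ideal K[X] => Module.finrank K (K[X] ⧸ I))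
    (minpoly.ker_aeval_eq_span_minpoly K a)

variable {K D : Type*} [Field K] [Ring D] [IsDomain D] [Algebra K D] [FiniteDimensional K D]
  [Algebra.IsCentral K D]

variable (K) in
theorem natDegree_minpoly_dvd (a : D) :
    (minpoly K a).natDegree ∣ (Module.finrank K D).sqrt := by
  have h := finrank_dvd_sqrt_finrank (Algebra.adjoin K {a}) (by
    have := Algebra.isMulCommutative_adjoin K (s := {a}) (by
      rintro x rfl y rfl; rfl)
    intro x hx y hy
    exact congrArg Subtype.val (mul_comm' (⟨x, hx⟩ : Algebra.adjoin K {a}) ⟨y, hy⟩))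
  rwa [finrank_adjoin_singleton K a] at h

omit [IsDomain D] [FiniteDimensional K D] [Algebra.IsCentral K D] in
theorem aeval_matrix_eq_zero {n : ℕ} (φ : (AlgebraicClosure K ⊗[K] D) ≃ₐ[AlgebraicClosure K]
      Matrix (Fin n) (Fin n) (AlgebraicClosure K)) (a : D) :
    aeval (φ (1 ⊗ₜ a)) ((minpoly K a).map (algebraMap K (AlgebraicClosure K))) = 0 := by
  have h : (aeval ((1 : AlgebraicClosure K) ⊗ₜ[K] a)) (minpoly K a) = 0 := by
    have := aeval_algHom_apply
      (Algebra.TensorProduct.includeRight : D →ₐ[K] AlgebraicClosure K ⊗[K] D) a (minpoly K a)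
    rw [minpoly.aeval, map_zero] at this
    exact this
  have h2 := aeval_algHom_apply φ.toAlgHom
    ((1 : AlgebraicClosure K) ⊗ₜ[K] a) ((minpoly K a).map (algebraMap K (AlgebraicClosure K)))
  rw [aeval_map_algebraMap (AlgebraicClosure K) ((1 : AlgebraicClosure K) ⊗ₜ[K] a), h,
    map_zero] at h2
  exact h2

/-- Let c be the characteristic polynomial of left multiplication by a on `D`; over the closure c is
the n-th power of that of φ(a). Its roots are eigenvalues of φ(a), hence roots of the minimal
polynomial m, so c is a power of m over `K`. As deg m divides n, the exponent is a multiple of n,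
and n-th roots of monic polynomials are unique. -/
theorem charpoly_eq_minpoly_pow {n : ℕ} (φ : (AlgebraicClosure K ⊗[K] D) ≃ₐ[AlgebraicClosure K]
      Matrix (Fin n) (Fin n) (AlgebraicClosure K)) (a : D) :
    n = (Module.finrank K D).sqrt ∧ (φ (1 ⊗ₜ a)).charpoly =
      (minpoly K a ^ ((Module.finrank K D).sqrt / (minpoly K a).natDegree)).map
        (algebraMap K (AlgebraicClosure K)) := by
  have hint : IsIntegral K a := Algebra.IsIntegral.isIntegral a
  have hn : n * n = Module.finrank K D := by
    have h := φ.toLinearEquiv.finrank_eq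
    rw [Module.finrank_baseChange, Module.finrank_matrix] at h
    simp at h
    exact h.symm
  have hn' : n = (Module.finrank K D).sqrt := by rw [← hn, Nat.sqrt_eq]
  refine ⟨hn', ?_⟩
  have hpos : 0 < n := by
    have : 0 < Module.finrank K D := Module.finrank_pos
    rw [← hn] at this
    exact Nat.pos_of_mul_pos_left this
  rw [← hn']
  set m := minpoly K a with hm
  have hmm : m.Monic := minpoly.monic hint
  set c := (Algebra.lmul K D a).charpoly with hc
  have hcm : c.Monic := LinearMap.charpoly_monic _
  have hpow : c.map (algebraMap K (AlgebraicClosure K)) = (φ (1 ⊗ₜ a)).charpoly ^ n := by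
    rw [hc, ← LinearMap.charpoly_baseChange, Algebra.baseChange_lmul, ← charpoly_lmul_matrix]
    rw [← LinearEquiv.charpoly_conj φ.toLinearEquiv]
    congr 1
    ext x : 1
    simp [LinearEquiv.conj_apply]
  have hroot : ∀ α : AlgebraicClosure K, (φ (1 ⊗ₜ a)).charpoly.IsRoot α →
      (m.map (algebraMap K (AlgebraicClosure K))).eval α = 0 := by
    intro α hα
    set f := Matrix.toLinAlgEquiv' (φ (1 ⊗ₜ a)) with hf
    have h1 : f.charpoly.IsRoot α := by
      rw [hf]
      change (Matrix.toLin' (φ (1 ⊗ₜ a))).charpoly.IsRoot α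
      rwa [Matrix.charpoly_toLin']
    rw [← Module.End.hasEigenvalue_iff_isRoot_charpoly] at h1
    obtain ⟨v, hv⟩ := h1.exists_hasEigenvector
    have h2 := Module.End.aeval_apply_of_hasEigenvector
      (p := m.map (algebraMap K (AlgebraicClosure K))) hv
    have h3 : aeval f (m.map (algebraMap K (AlgebraicClosure K))) = 0 := by
      have := aeval_algHom_apply (Matrix.toLinAlgEquiv' : Matrix (Fin n) (Fin n) (AlgebraicClosure K)
        ≃ₐ[AlgebraicClosure K] _).toAlgHom (φ (1 ⊗ₜ a))
        (m.map (algebraMap K (AlgebraicClosure K)))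
      rw [aeval_matrix_eq_zero, map_zero] at this
      exact this
    rw [h3, LinearMap.zero_apply] at h2
    exact (smul_eq_zero.mp h2.symm).resolve_right hv.2
  obtain ⟨r, hr⟩ := hcm.eq_pow_of_forall_irreducible (m := m) (by
    intro p hp hirr hpc
    obtain ⟨α, hα⟩ := IsAlgClosed.exists_aeval_eq_zero (AlgebraicClosure K) p
      (by rw [degree_eq_natDegree hp.ne_zero]; exact_mod_cast hirr.natDegree_pos.ne')
    have h1 : (φ (1 ⊗ₜ a)).charpoly.IsRoot α := by
      have h2 : aeval α c = 0 := by
        obtain ⟨q, hq⟩ := hpc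
        rw [hq, map_mul, hα, zero_mul]
      rw [← eval_map_algebraMap, hpow, eval_pow] at h2
      exact pow_eq_zero_iff hpos.ne' |>.mp h2
    have h2 := hroot α h1
    rw [eval_map_algebraMap] at h2
    have e1 := minpoly.eq_of_irreducible_of_monic hirr hα hp
    have e2 := minpoly.eq_of_irreducible_of_monic (minpoly.irreducible hint) h2 hmm
    rw [e1, ← e2])
  obtain ⟨s, hs⟩ := natDegree_minpoly_dvd K a
  rw [← hn', ← hm] at hs
  have hdpos : 0 < m.natDegree := minpoly.natDegree_pos hint
  have hsn : n / m.natDegree = s := by rw [hs, Nat.mul_div_cancel_left _ hdpos]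
  have hrs : r = s * n := by
    have h1 := congrArg natDegree hr
    rw [hc, LinearMap.charpoly_natDegree, ← hn, natDegree_pow] at h1
    apply Nat.eq_of_mul_eq_mul_right hdpos
    rw [← h1]
    nth_rw 1 [hs]
    ring
  rw [hsn]
  apply (Matrix.charpoly_monic _).eq_of_pow_eq ((hmm.pow s).map _) hpos.ne'
  rw [← hpow, hr, hrs, pow_mul, Polynomial.map_pow]

theorem det_eq_minpoly_coeff {n : ℕ} (φ : (AlgebraicClosure K ⊗[K] D) ≃ₐ[AlgebraicClosure K]
      Matrix (Fin n) (Fin n) (AlgebraicClosure K)) (a : D) :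
    (φ (1 ⊗ₜ a)).det = algebraMap K (AlgebraicClosure K)
      ((-1) ^ (Module.finrank K D).sqrt *
        (minpoly K a).coeff 0 ^ ((Module.finrank K D).sqrt / (minpoly K a).natDegree)) := by
  obtain ⟨hn, h⟩ := charpoly_eq_minpoly_pow φ a
  rw [Matrix.det_eq_sign_charpoly_coeff, h, Fintype.card_fin, ← hn, coeff_map, coeff_zero_eq_eval_zero,
    eval_pow, coeff_zero_eq_eval_zero]
  simp

-- Over the closure the simple algebra is a matrix algebra. The determinant is multiplicative, and
-- its expression through minimal polynomials shows that it takes values in `K`.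
variable (K D) in
theorem exists_isReducedNorm : ∃ f : D →* K, IsReducedNorm K D f := by
  have : IsSimpleRing (AlgebraicClosure K ⊗[K] D) := by
    have := isSimpleRing_tensorProduct (K := K) (isUnit_of_finiteDimensional K (D := D))
      (A := AlgebraicClosure K) (fun a ha => ha.isUnit)
    exact IsSimpleRing.of_ringEquiv (Algebra.TensorProduct.comm K D (AlgebraicClosure K)).toRingEquiv this
  obtain ⟨n, _, ⟨φ⟩⟩ := IsSimpleRing.exists_algEquiv_matrix_of_isAlgClosed (AlgebraicClosure K)
    (AlgebraicClosure K ⊗[K] D)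
  have hinj := (algebraMap K (AlgebraicClosure K)).injective
  refine ⟨{ toFun := fun a => (-1) ^ (Module.finrank K D).sqrt *
        (minpoly K a).coeff 0 ^ ((Module.finrank K D).sqrt / (minpoly K a).natDegree)
            map_one' := ?_
            map_mul' := fun a b => ?_ }, n, φ, fun a => (det_eq_minpoly_coeff φ a).symm⟩
  · apply hinj
    rw [← det_eq_minpoly_coeff φ, ← Algebra.TensorProduct.one_def, map_one, Matrix.det_one, map_one]
  · apply hinj
    refine Eq.trans ?_ (map_mul _ _ _).symm
    rw [← det_eq_minpoly_coeff φ, ← det_eq_minpoly_coeff φ, ← det_eq_minpoly_coeff φ,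
      ← Matrix.det_mul, ← map_mul, Algebra.TensorProduct.tmul_mul_tmul, one_mul]

/-- The reduced norm of a central division algebra in terms of minimal polynomials. -/
theorem reducedNorm_apply (a : D) :
    reducedNorm K D a = (-1) ^ (Module.finrank K D).sqrt *
        (minpoly K a).coeff 0 ^ ((Module.finrank K D).sqrt / (minpoly K a).natDegree) := by
  have h := exists_isReducedNorm K D
  have h2 : IsReducedNorm K D (reducedNorm K D) := by
    rw [reducedNorm, dif_pos h]
    exact h.choose_spec
  obtain ⟨n, φ, hφ⟩ := h2
  apply (algebraMap K (AlgebraicClosure K)).injective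
  rw [hφ, det_eq_minpoly_coeff]

end ReducedNorm

/-! ### Unitary involutions of division rings -/

section Involutions

theorem isCentral_subring_center {A : Type*} [Ring A] :
    Algebra.IsCentral (Subring.center A) A where
  out := fun x hx => ⟨⟨x, by
    rw [Subring.mem_center_iff]
    intro g
    exact (Subalgebra.mem_center_iff.mp hx g)⟩, rfl⟩

theorem inv_mem_subring_center {A : Type*} [Ring A] {u : Aˣ} (hu : (u : A) ∈ Subring.center A) :
    ((u⁻¹ : Aˣ) : A) ∈ Subring.center A := by
  rw [Subring.mem_center_iff] at hu ⊢
  intro g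
  rw [Units.eq_inv_mul_iff_mul_eq, ← mul_assoc, ← hu, mul_assoc, Units.mul_inv, mul_one]

theorem isUnit_subring_center {A : Type*} [Ring A] [Nontrivial A]
    (hU : ∀ a : A, a ≠ 0 → IsUnit a) (z : Subring.center A) : IsUnit z ∨ z = 0 := by
  by_cases h : z = 0
  · exact Or.inr h
  · left
    obtain ⟨u, hu⟩ := hU (z : A) (fun h' => h (Subtype.ext h'))
    have hc : ((u⁻¹ : Aˣ) : A) ∈ Subring.center A := inv_mem_subring_center (hu ▸ z.2)
    refine ⟨⟨z, ⟨_, hc⟩, Subtype.ext ?_, Subtype.ext ?_⟩, rfl⟩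
    · change (z : A) * ((u⁻¹ : Aˣ) : A) = 1
      rw [← hu, Units.mul_inv]
    · change ((u⁻¹ : Aˣ) : A) * (z : A) = 1
      rw [← hu, Units.inv_mul]

namespace RingInvo

variable {A : Type*} [Ring A] (ρ : RingInvo A)

theorem unop_map_add (a b : A) : (ρ (a + b)).unop = (ρ a).unop + (ρ b).unop := by
  rw [map_add, MulOpposite.unop_add]

theorem unop_map_sub (a b : A) : (ρ (a - b)).unop = (ρ a).unop - (ρ b).unop := by
  rw [map_sub, MulOpposite.unop_sub]

theorem unop_map_neg (a : A) : (ρ (-a)).unop = -(ρ a).unop := by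
  rw [map_neg, MulOpposite.unop_neg]

theorem unop_map_zero : (ρ (0 : A)).unop = 0 := by
  rw [map_zero, MulOpposite.unop_zero]

theorem mem_sigma_of_symm {u : Aˣ} (h : (ρ (u : A)).unop = u) : u ∈ ρ.sigma :=
  Subgroup.subset_closure h

theorem unop_map_inv {u : Aˣ} (h : (ρ (u : A)).unop = u) :
    (ρ ((u⁻¹ : Aˣ) : A)).unop = ((u⁻¹ : Aˣ) : A) := by
  have h1 : ρ.unitsMap u = u := Units.ext h
  have h2 : ((ρ.unitsMap u)⁻¹ : Aˣ) = u⁻¹ := by rw [h1]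
  exact congrArg Units.val h2

theorem mem_center_unop_map {z : A} (hz : z ∈ Subring.center A) :
    (ρ z).unop ∈ Subring.center A := (ρ.onCenter ⟨z, hz⟩).2

/-- A unitary involution of a division ring moves some central `t`, by a central unit `d`. -/
theorem IsUnitary.exists_sub_eq {ρ : RingInvo A} (h : ρ.IsUnitary)
    (hU : ∀ a : A, a ≠ 0 → IsUnit a) :
    ∃ t ∈ Subring.center A, ∃ d : Aˣ, (d : A) ∈ Subring.center A ∧ t - (ρ t).unop = d := by
  obtain ⟨z, hz⟩ := h
  have h1 : (z : A) - (ρ z).unop ≠ 0 := by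
    intro h0
    exact hz (Subtype.ext (sub_eq_zero.mp h0).symm)
  obtain ⟨d, hd⟩ := hU _ h1
  exact ⟨z, z.2, d, by rw [hd]; exact sub_mem z.2 (ρ.mem_center_unop_map z.2), hd.symm⟩

/-- Every nonzero `u` has a central multiple whose symmetrization is nonzero. -/
theorem IsUnitary.exists_symm {ρ : RingInvo A} (h : ρ.IsUnitary)
    (hU : ∀ a : A, a ≠ 0 → IsUnit a) {u : A} (hu : u ≠ 0) :
    ∃ z ∈ Subring.center A, z * u + (ρ (z * u)).unop ≠ 0 := by
  by_cases h0 : u + (ρ u).unop = 0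
  · obtain ⟨t, ht, d, hd, htd⟩ := h.exists_sub_eq hU
    refine ⟨t, ht, ?_⟩
    have h1 : (ρ u).unop = -u := by rw [eq_neg_iff_add_eq_zero, add_comm, h0]
    have h2 := Subring.mem_center_iff.mp (ρ.mem_center_unop_map ht) u
    rw [unop_map_mul, h1, neg_mul, h2, ← sub_eq_add_neg, ← sub_mul, htd]
    intro h3
    exact hu ((Units.mul_right_eq_zero d).mp h3)
  · exact ⟨1, one_mem _, by simpa using h0⟩

/-- The center is spanned by 1 and a moved element t. With d = t − ρ(t), the element w = d⁻¹(z −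
ρ(z)) is fixed, being a product of two skew central elements, and z − wt is fixed as well. -/
theorem finite_fixedCenter [Nontrivial A] (hU : ∀ a : A, a ≠ 0 → IsUnit a)
    (h : ρ.IsUnitary) : Module.Finite ρ.fixedCenter (Subring.center A) := by
  obtain ⟨t, ht, d, hd, htd⟩ := h.exists_sub_eq hU
  let e : Subring.center A := ⟨((d⁻¹ : Aˣ) : A), inv_mem_subring_center hd⟩
  have hed : (d : A) * (e : A) = 1 := Units.mul_inv d
  have hfix : ∀ z : Subring.center A, e * (z - ρ.onCenter z) ∈ ρ.fixedCenter := by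
    intro z
    refine Subtype.ext ?_
    change (ρ ((e : A) * ((z : A) - (ρ z).unop))).unop = (e : A) * ((z : A) - (ρ z).unop)
    have he : (ρ (e : A)).unop = -(e : A) := by
      have h1 : (ρ (d : A)).unop = -(d : A) := by
        rw [← htd, unop_map_sub, involution, neg_sub]
      have h2 := congrArg (fun x => (ρ x).unop) hed
      simp only [unop_map_mul, unop_map_one, h1, mul_neg] at h2
      have h3 : (ρ (e : A)).unop * (d : A) = -1 := by rw [← h2, neg_neg]
      calc (ρ (e : A)).unop = (ρ (e : A)).unop * ((d : A) * e) := by rw [hed, mul_one]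
        _ = -(e : A) := by rw [← mul_assoc, h3, neg_mul, one_mul]
    rw [unop_map_mul, unop_map_sub, involution, he]
    have h4 := Subring.mem_center_iff.mp e.2 ((ρ (z : A)).unop - z)
    rw [mul_neg, h4, ← mul_neg, neg_sub]
  classical
  refine ⟨⟨{1, ⟨t, ht⟩}, ?_⟩⟩
  rw [eq_top_iff]
  intro z _
  simp only [Finset.coe_insert, Finset.coe_singleton]
  rw [Submodule.mem_span_pair]
  set w : Subring.center A := e * (z - ρ.onCenter z) with hw
  have hdz : (d : A) * (w : A) = (z : A) - (ρ z).unop := by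
    change (d : A) * ((e : A) * ((z : A) - (ρ z).unop)) = _
    rw [← mul_assoc, hed, one_mul]
  have hrest : z - w * ⟨t, ht⟩ ∈ ρ.fixedCenter := by
    refine Subtype.ext ?_
    change (ρ ((z : A) - (w : A) * t)).unop = (z : A) - (w : A) * t
    have hwf : (ρ (w : A)).unop = w := congrArg Subtype.val (hfix z)
    have h5 := Subring.mem_center_iff.mp w.2 (ρ t).unop
    have h6 := Subring.mem_center_iff.mp w.2 (d : A)
    rw [unop_map_sub, unop_map_mul, hwf, h5, sub_eq_sub_iff_sub_eq_sub, ← neg_inj, neg_sub, neg_sub,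
      ← hdz, ← mul_sub, htd, h6]
  refine ⟨⟨_, hrest⟩, ⟨w, hfix z⟩, ?_⟩
  rw [Subring.smul_def, Subring.smul_def, smul_eq_mul, smul_eq_mul, mul_one, sub_add_cancel]

/-- If `a` is not a quotient of symmetric elements, then each element is `v + a v'` with `v` and
`v'` symmetric. -/
theorem exists_eq_add_mul [IsDomain A] [Module.Finite (Subring.center A) A]
    (hU : ∀ a : A, a ≠ 0 → IsUnit a) (h : ρ.IsUnitary) (a : A)
    (ha : ∀ v v' : A, (ρ v).unop = v → (ρ v').unop = v' → v + a * v' = 0 → v' = 0) (b : A) :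
    ∃ v v' : A, (ρ v).unop = v ∧ (ρ v').unop = v' ∧ b = v + a * v' := by
  have hfin := ρ.finite_fixedCenter hU h
  obtain ⟨t, ht, d, hd, htd⟩ := h.exists_sub_eq hU
  have hdi : ((d⁻¹ : Aˣ) : A) ∈ Subring.center A := inv_mem_subring_center hd
  have he : (ρ ((d⁻¹ : Aˣ) : A)).unop = -((d⁻¹ : Aˣ) : A) := by
    have h1 : ρ.unitsMap d = -d := Units.ext (by
      change (ρ (d : A)).unop = -(d : A)
      rw [← htd, unop_map_sub, involution, neg_sub])
    have h2 : ((ρ.unitsMap d)⁻¹ : Aˣ) = -d⁻¹ := by rw [h1, neg_inv]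
    exact congrArg Units.val h2
  have hsym : ∀ x : A, (ρ (((d⁻¹ : Aˣ) : A) * (x - (ρ x).unop))).unop =
      ((d⁻¹ : Aˣ) : A) * (x - (ρ x).unop) := by
    intro x
    rw [unop_map_mul, unop_map_sub, involution, he, mul_neg,
      Subring.mem_center_iff.mp hdi, ← mul_neg, neg_sub]
  have hsym2 : ∀ x : A, (ρ (x - t * (((d⁻¹ : Aˣ) : A) * (x - (ρ x).unop)))).unop =
      x - t * (((d⁻¹ : Aˣ) : A) * (x - (ρ x).unop)) := by
    intro x
    rw [unop_map_sub, unop_map_mul, hsym, ← sub_eq_zero,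
      Subring.mem_center_iff.mp (ρ.mem_center_unop_map ht)]
    have h3 : (ρ x).unop - (ρ t).unop * (((d⁻¹ : Aˣ) : A) * (x - (ρ x).unop)) -
        (x - t * (((d⁻¹ : Aˣ) : A) * (x - (ρ x).unop))) =
        (t - (ρ t).unop) * (((d⁻¹ : Aˣ) : A) * (x - (ρ x).unop)) - (x - (ρ x).unop) := by
      noncomm_ring
    rw [h3, htd, ← mul_assoc, Units.mul_inv, one_mul, sub_self]
  have hk : ∀ (c : ρ.fixedCenter) (x : A), c • x = ((c : Subring.center A) : A) * x := fun c x => rfl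
  -- Each x equals v + tv' with v' = d⁻¹(x − ρ(x)) and v = x − tv' both symmetric; ψ replaces t by
  -- a. If ψ(x) = 0, the hypothesis on a gives v' = 0, whence x = ψ(x) = 0. So ψ is injective, and
  -- surjective by finite dimension over the fixed field.
  let ψ : A →ₗ[ρ.fixedCenter] A :=
    { toFun := fun x => (x - t * (((d⁻¹ : Aˣ) : A) * (x - (ρ x).unop))) +
        a * (((d⁻¹ : Aˣ) : A) * (x - (ρ x).unop))
      map_add' := fun x y => by
        rw [unop_map_add]
        noncomm_ring
      map_smul' := fun c x => by
        have hc : (ρ ((c : Subring.center A) : A)).unop = ((c : Subring.center A) : A) :=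
          congrArg Subtype.val c.2
        have hcc := Subring.mem_center_iff.mp (c : Subring.center A).2
        have h4 : (ρ (c • x)).unop = c • (ρ x).unop := by
          rw [hk, hk, unop_map_mul, hc, hcc]
        simp only [h4, RingHom.id_apply]
        rw [← smul_sub]
        simp only [hk]
        generalize ((c : Subring.center A) : A) = c' at hcc ⊢
        generalize x - (ρ x).unop = y
        have h5 : ∀ p : A, p * (((d⁻¹ : Aˣ) : A) * (c' * y)) = c' * (p * (((d⁻¹ : Aˣ) : A) * y)) := by
          intro p
          rw [← mul_assoc, ← mul_assoc, hcc, mul_assoc, mul_assoc]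
        rw [h5, h5, mul_add, mul_sub] }
  have hinj : Function.Injective ψ := by
    rw [← LinearMap.ker_eq_bot, LinearMap.ker_eq_bot']
    intro x hx
    have h0 := ha _ _ (hsym2 x) (hsym x) hx
    have h1 : ψ x = (x - t * (((d⁻¹ : Aˣ) : A) * (x - (ρ x).unop))) +
        a * (((d⁻¹ : Aˣ) : A) * (x - (ρ x).unop)) := rfl
    rw [h0, mul_zero, mul_zero, add_zero, sub_zero, hx] at h1
    exact h1.symm
  have hsurj : Function.Surjective ψ := by
    let _ : Field ρ.fixedCenter := Field.ofIsUnitOrEqZero (R := ρ.fixedCenter) fun c => by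
      rcases isUnit_subring_center hU (c : Subring.center A) with hc | hc
      · left
        obtain ⟨u, hu⟩ := hc
        have hfix : (u⁻¹ : (Subring.center A)ˣ).val ∈ ρ.fixedCenter := by
          have h1 : ρ.onCenter u = u := by rw [hu]; exact c.2
          refine Subtype.ext ?_
          let u' : Aˣ := Units.map (Subring.center A).subtype.toMonoidHom u
          exact ρ.unop_map_inv (u := u') (congrArg Subtype.val h1)
        refine ⟨⟨c, ⟨_, hfix⟩, Subtype.ext ?_, Subtype.ext ?_⟩, rfl⟩
        · change (c : Subring.center A) * (u⁻¹ : (Subring.center A)ˣ).val = 1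
          rw [← hu, Units.mul_inv]
        · change (u⁻¹ : (Subring.center A)ˣ).val * (c : Subring.center A) = 1
          rw [← hu, Units.inv_mul]
      · exact Or.inr (Subtype.ext hc)
    have hfinA : Module.Finite ρ.fixedCenter A := Module.Finite.trans (Subring.center A) A
    exact LinearMap.injective_iff_surjective.mp hinj
  obtain ⟨x, hx⟩ := hsurj b
  exact ⟨_, _, hsym2 x, hsym x, hx.symm⟩

/-- In a division ring with unitary involution the commutators are products of symmetric
elements. -/
theorem commutator_le_sigma [IsDomain A] [Module.Finite (Subring.center A) A]
    (hU : ∀ a : A, a ≠ 0 → IsUnit a) (h : ρ.IsUnitary) : commutator Aˣ ≤ ρ.sigma := by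
  have key : ∀ a b : Aˣ, (a : Aˣ ⧸ ρ.sigma) * b = b * a := by
    intro a b
    by_cases ha : a ∈ ρ.sigma
    · rw [(QuotientGroup.eq_one_iff a).mpr ha, one_mul, mul_one]
    -- A relation v + av' = 0 with v' ≠ 0 would make a a quotient of symmetric units, contrary to a
    -- ∉ Σ.
    obtain ⟨v, v', hv, hv', hb⟩ := ρ.exists_eq_add_mul hU h a (by
      intro v v' hv hv' h0
      by_contra hne
      apply ha
      obtain ⟨s', rfl⟩ := hU v' hne
      have h1 : v = -((a : A) * s') := eq_neg_of_add_eq_zero_left h0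
      have h2 : (ρ ((-(a * s') : Aˣ) : A)).unop = ((-(a * s') : Aˣ) : A) := by
        rw [Units.val_neg, Units.val_mul, ← h1, hv]
      have h3 : a = -(a * s') * (-s')⁻¹ := by
        rw [inv_neg, neg_mul_neg, mul_assoc, mul_inv_cancel, mul_one]
      rw [h3]
      refine mul_mem (ρ.mem_sigma_of_symm h2) (inv_mem (ρ.mem_sigma_of_symm ?_))
      rw [Units.val_neg, unop_map_neg, hv']) b
    by_cases hv0 : v = 0
    · have hv'0 : v' ≠ 0 := by
        rintro rfl
        rw [hv0, mul_zero, zero_add] at hb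
        exact b.ne_zero hb
      obtain ⟨s', rfl⟩ := hU v' hv'0
      have hb' : b = a * s' := Units.ext (by rw [hb, hv0, zero_add, Units.val_mul])
      rw [hb', QuotientGroup.mk_mul,
        (QuotientGroup.eq_one_iff s').mpr (ρ.mem_sigma_of_symm hv'), mul_one]
    obtain ⟨s, rfl⟩ := hU v hv0
    by_cases hv'0 : v' = 0
    · rw [hv'0, mul_zero, add_zero] at hb
      rw [Units.ext hb, (QuotientGroup.eq_one_iff s).mpr (ρ.mem_sigma_of_symm hv), one_mul, mul_one]
    obtain ⟨s', rfl⟩ := hU v' hv'0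
    set w := s * s'⁻¹ with hw
    have hwm : (w : Aˣ ⧸ ρ.sigma) = 1 :=
      (QuotientGroup.eq_one_iff w).mpr
        (mul_mem (ρ.mem_sigma_of_symm hv) (inv_mem (ρ.mem_sigma_of_symm hv')))
    -- From b = ws' + as' one gets c = 1 + w⁻¹a, which commutes with w⁻¹a. Modulo the normal
    -- subgroup Σ these two elements are b and a.
    set c := w⁻¹ * b * s'⁻¹ with hc
    have hcv : (c : A) = 1 + ((w⁻¹ * a : Aˣ) : A) := by
      have h1 : (b : A) = w * s' + a * s' := by
        rw [hb, ← Units.val_mul w, hw, inv_mul_cancel_right]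
      simp only [hc, Units.val_mul, h1]
      rw [mul_add, add_mul, ← mul_assoc, ← Units.val_mul, inv_mul_cancel, Units.val_one, one_mul,
        Units.mul_inv, mul_assoc, mul_assoc, Units.mul_inv, mul_one]
    have hcomm : (w⁻¹ * a) * c = c * (w⁻¹ * a) := by
      apply Units.ext
      rw [Units.val_mul (w⁻¹ * a) c, Units.val_mul c, hcv, mul_add, add_mul, mul_one, one_mul]
    have h1 := congrArg (QuotientGroup.mk (s := ρ.sigma)) hcomm
    have hs'm := (QuotientGroup.eq_one_iff s').mpr (ρ.mem_sigma_of_symm hv')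
    simpa only [hc, QuotientGroup.mk_mul, QuotientGroup.mk_inv, hwm, hs'm, inv_one, one_mul,
      mul_one] using h1
  rw [commutator_def, Subgroup.commutator_le]
  intro a _ b _
  rw [← QuotientGroup.eq_one_iff, commutatorElement_def]
  simp only [QuotientGroup.mk_mul, QuotientGroup.mk_inv]
  rw [key a b]
  group

/-- For unitary involutions, `Σ_ρ` depends only on the restriction of `ρ` to the center. -/
theorem sigma_le_of_onCenter_eq [IsDomain A] [Module.Finite (Subring.center A) A]
    (hU : ∀ a : A, a ≠ 0 → IsUnit a) (h : ρ.IsUnitary) (ρ' : RingInvo A)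
    (hρ : ρ.onCenter = ρ'.onCenter) : ρ'.sigma ≤ ρ.sigma := by
  let _ : Field (Subring.center A) := Field.ofIsUnitOrEqZero (R := Subring.center A)
    (isUnit_subring_center hU)
  have _ : Algebra.IsCentral (Subring.center A) A := isCentral_subring_center
  let ψ : A ≃+* A :=
    { toFun := fun a => (ρ' (ρ a).unop).unop
      invFun := fun a => (ρ (ρ' a).unop).unop
      left_inv := fun a => by simp only [involution]
      right_inv := fun a => by simp only [involution]
      map_mul' := fun a b => by simp only [unop_map_mul]
      map_add' := fun a b => by simp only [unop_map_add] }
  have hψ : ∀ z : Subring.center A, ψ z = z := by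
    intro z
    have h1 := congrArg Subtype.val (congrFun hρ (ρ.onCenter z))
    have h2 : (ρ' (ρ (z : A)).unop).unop = (ρ (ρ (z : A)).unop).unop := h1.symm
    exact h2.trans (ρ.involution z)
  -- The composite of the two involutions fixes the center, so it is inner: ρ'(b)u = uρ(b).
  -- Multiplying u by a central element and symmetrizing preserves this relation and gives a
  -- ρ-symmetric unit w.
  obtain ⟨u, hu0, hu⟩ := exists_ne_zero_forall_mul_eq (K := Subring.center A) ψ hψ
  have hu' : ∀ b, (ρ' b).unop * u = u * (ρ b).unop := by
    intro b
    have := hu (ρ b).unop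
    change (ρ' (ρ (ρ b).unop).unop).unop * u = u * (ρ b).unop at this
    rwa [involution] at this
  obtain ⟨z, hz, hne⟩ := h.exists_symm hU hu0
  have hzc := Subring.mem_center_iff.mp hz
  have h1 : ∀ b, (ρ' b).unop * (z * u) = (z * u) * (ρ b).unop := by
    intro b
    rw [← mul_assoc, hzc, mul_assoc, hu', mul_assoc]
  have h2 : ∀ b, (ρ' b).unop * (ρ (z * u)).unop = (ρ (z * u)).unop * (ρ b).unop := by
    intro b
    have h3 := congrArg (fun x => (ρ x).unop) (h1 (ρ' b).unop)
    simp only [unop_map_mul ρ _ (z * u), unop_map_mul ρ (z * u), involution] at h3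
    exact h3.symm
  obtain ⟨w, hw⟩ := hU _ hne
  have hwρ : (ρ (w : A)).unop = w := by
    rw [hw, unop_map_add, involution, add_comm]
  have h3 : ∀ b, (ρ' b).unop * w = w * (ρ b).unop := by
    intro b
    rw [hw, mul_add, add_mul, h1, h2]
  rw [sigma, Subgroup.closure_le]
  intro a ha
  -- For a ρ'-symmetric a: ρ(aw) = wρ(a) = ρ'(a)w = aw.
  have h4 : (ρ ((a * w : Aˣ) : A)).unop = ((a * w : Aˣ) : A) := by
    rw [Units.val_mul, unop_map_mul, hwρ, ← h3]
    rw [show (ρ' (a : A)).unop = a from ha]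
  have h5 : a = (a * w) * w⁻¹ := by group
  rw [h5]
  exact mul_mem (ρ.mem_sigma_of_symm h4) (inv_mem (ρ.mem_sigma_of_symm hwρ))

theorem IsUnitary.congr {ρ ρ' : RingInvo A} (h : ρ.IsUnitary) (hρ : ρ.onCenter = ρ'.onCenter) :
    ρ'.IsUnitary := by
  rwa [IsUnitary, ← hρ]

theorem sigma_eq_of_onCenter_eq [IsDomain A] [Module.Finite (Subring.center A) A]
    (hU : ∀ a : A, a ≠ 0 → IsUnit a) (h : ρ.IsUnitary) (ρ' : RingInvo A)
    (hρ : ρ.onCenter = ρ'.onCenter) : ρ'.sigma = ρ.sigma :=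
  le_antisymm (ρ.sigma_le_of_onCenter_eq hU h ρ' hρ)
    (ρ'.sigma_le_of_onCenter_eq hU (h.congr hρ) ρ hρ.symm)

end RingInvo

end Involutions

/-! ### Homogeneity of units and the conjugation action on the center of degree zero -/

section GradedUnits

variable {Γ E : Type*} [AddCommGroup Γ] [DecidableEq Γ] [Ring E]
variable (𝒜 : Γ → AddSubgroup E) [GradedRing 𝒜] [IsGradedDivisionRing 𝒜]

namespace IsGradedDivisionRing

theorem isDomain {Γ E : Type*} [AddCommGroup Γ] [DecidableEq Γ] [Ring E]
    (𝒜 : Γ → AddSubgroup E) [GradedRing 𝒜] [IsGradedDivisionRing 𝒜] : IsDomain E := by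
  have := IsGradedDivisionRing.noZeroDivisors 𝒜
  have := IsGradedDivisionRing.nontrivial 𝒜
  exact NoZeroDivisors.to_isDomain _

theorem isDomain_gradeZero : IsDomain (gradeZero 𝒜) := by
  have := isDomain 𝒜
  infer_instance

theorem isUnit_gradeZero (a : gradeZero 𝒜) (ha : a ≠ 0) : IsUnit a :=
  (isUnit_or_eq_zero 𝒜 a).resolve_right ha

/-- The units of a graded division ring are homogeneous. -/
theorem exists_mem_of_unit (u : Eˣ) : ∃ γ, (u : E) ∈ 𝒜 γ := by
  classical
  have := IsGradedDivisionRing.torsionFree 𝒜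
  have := isDomain 𝒜
  have hU : TwoUniqueSums Γ := TwoUniqueSums.of_injective_addHom
    (DivisibleHull.coeAddMonoidHom (M := Γ)).toAddHom DivisibleHull.coe_injective inferInstance
  set v : E := ((u⁻¹ : Eˣ) : E) with hv
  set S := (DirectSum.decompose 𝒜 (u : E)).support with hS
  set S' := (DirectSum.decompose 𝒜 v).support with hS'
  have hne : ∀ w : E, w ≠ 0 → (DirectSum.decompose 𝒜 w).support.Nonempty := by
    intro w hw
    rw [Finset.nonempty_iff_ne_empty]
    intro h
    rw [DFinsupp.support_eq_empty] at h
    exact hw ((DirectSum.decompose 𝒜).injective (h.trans (DirectSum.decompose_zero 𝒜).symm))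
  -- A sum attained by only one pair of degrees gives a nonzero component of u·u⁻¹ = 1, so it must
  -- be 0. With more than one pair there would be two distinct such pairs, both of sum 0, which
  -- contradicts uniqueness.
  have hprod : ∀ p ∈ S ×ˢ S', UniqueAdd S S' p.1 p.2 → p.1 + p.2 = 0 := by
    rintro ⟨i, j⟩ hp huniq
    rw [Finset.mem_product] at hp
    by_contra hij
    have h0 : ((DirectSum.decompose 𝒜 ((u : E) * v)) (i + j) : E) = 0 := by
      rw [hv, Units.mul_inv]
      exact DirectSum.decompose_of_mem_ne 𝒜 (SetLike.one_mem_graded 𝒜) (Ne.symm hij)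
    rw [DirectSum.decompose_mul, DirectSum.coe_mul_apply, Finset.sum_eq_single (i, j)] at h0
    · rcases mul_eq_zero.mp h0 with h | h
      · exact (DFinsupp.mem_support_iff.mp hp.1) (Subtype.ext h)
      · exact (DFinsupp.mem_support_iff.mp hp.2) (Subtype.ext h)
    · rintro ⟨k, l⟩ hkl hne'
      rw [Finset.mem_filter, Finset.mem_product] at hkl
      obtain ⟨rfl, rfl⟩ := huniq hkl.1.1 hkl.1.2 hkl.2
      exact absurd rfl hne'
    · intro h
      exact (h (Finset.mem_filter.mpr ⟨Finset.mem_product.mpr hp, rfl⟩)).elim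
  have hcard : S.card * S'.card ≤ 1 := by
    by_contra hcon
    push Not at hcon
    obtain ⟨p, hp, q, hq, hpq, hup, huq⟩ := TwoUniqueSums.uniqueAdd_of_one_lt_card hcon
    have h1 := hprod p hp hup
    have h2 := hprod q hq huq
    rw [Finset.mem_product] at hp hq
    obtain ⟨e1, e2⟩ := hup hq.1 hq.2 (h2.trans h1.symm)
    exact hpq (Prod.ext e1.symm e2.symm)
  have hS1 : S.card = 1 := by
    have h1 : 0 < S.card := Finset.card_pos.mpr (hne _ u.ne_zero)
    have h2 : 0 < S'.card := Finset.card_pos.mpr (hne _ (u⁻¹).ne_zero)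
    nlinarith
  obtain ⟨γ, hγ⟩ := Finset.card_eq_one.mp hS1
  refine ⟨γ, ?_⟩
  have h := DirectSum.sum_support_decompose 𝒜 (u : E)
  rw [← hS, hγ, Finset.sum_singleton] at h
  rw [← h]
  exact SetLike.coe_mem _

omit [IsGradedDivisionRing 𝒜] in
theorem inv_mem_of_mem {u : Eˣ} {γ : Γ} (hu : (u : E) ∈ 𝒜 γ) : ((u⁻¹ : Eˣ) : E) ∈ 𝒜 (-γ) := by
  have h1 : (u : E) * ((DirectSum.decompose 𝒜 ((u⁻¹ : Eˣ) : E)) (-γ) : E) = 1 := by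
    rw [← DirectSum.coe_decompose_mul_add_of_left_mem 𝒜 hu, Units.mul_inv, add_neg_cancel,
      DirectSum.decompose_of_mem_same 𝒜 (SetLike.one_mem_graded 𝒜)]
  have h2 : ((u⁻¹ : Eˣ) : E) = ((DirectSum.decompose 𝒜 ((u⁻¹ : Eˣ) : E)) (-γ) : E) :=
    Units.inv_eq_of_mul_eq_one_right h1
  rw [h2]
  exact SetLike.coe_mem _

omit [IsGradedDivisionRing 𝒜] in
theorem exists_unitsIncl_eq {u : Eˣ} (hu : (u : E) ∈ 𝒜 0) :
    ∃ a : (gradeZero 𝒜)ˣ, unitsIncl 𝒜 a = u := by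
  have hv : ((u⁻¹ : Eˣ) : E) ∈ 𝒜 0 := by simpa using inv_mem_of_mem 𝒜 hu
  exact ⟨⟨⟨u, hu⟩, ⟨_, hv⟩, Subtype.ext (Units.mul_inv u), Subtype.ext (Units.inv_mul u)⟩,
    Units.ext rfl⟩

omit [IsGradedDivisionRing 𝒜] in
theorem unitsIncl_mem (a : (gradeZero 𝒜)ˣ) : (unitsIncl 𝒜 a : E) ∈ 𝒜 0 := (a : gradeZero 𝒜).2

omit [IsGradedDivisionRing 𝒜] in
theorem mem_range_unitsIncl {u : Eˣ} : u ∈ (unitsIncl 𝒜).range ↔ (u : E) ∈ 𝒜 0 :=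
  ⟨fun ⟨a, ha⟩ => ha ▸ unitsIncl_mem 𝒜 a, fun h => exists_unitsIncl_eq 𝒜 h⟩

omit [IsGradedDivisionRing 𝒜] in
theorem unitsIncl_injective : Function.Injective (unitsIncl 𝒜) :=
  Units.map_injective Subtype.val_injective

omit [IsGradedDivisionRing 𝒜] in
/-- The center is a graded subring. -/
theorem decompose_mem_center {z : E} (hz : z ∈ Subring.center E) (γ : Γ) :
    (DirectSum.decompose 𝒜 z γ : E) ∈ Subring.center E := by
  rw [Subring.mem_center_iff] at hz ⊢
  intro g
  induction g using DirectSum.Decomposition.inductionOn 𝒜 with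
  | zero => simp
  | add a b ha hb => rw [add_mul, mul_add, ha, hb]
  | homogeneous a =>
    rename_i i
    have h := congrArg (fun w => (DirectSum.decompose 𝒜 w (γ + i) : E)) (hz (a : E))
    simp only at h
    rwa [DirectSum.coe_decompose_mul_add_of_right_mem 𝒜 a.2, add_comm,
      DirectSum.coe_decompose_mul_add_of_left_mem 𝒜 a.2] at h

omit [DecidableEq Γ] [GradedRing 𝒜] in
theorem exists_unit_of_mem {γ : Γ} {x : E} (hx : x ∈ 𝒜 γ) (h0 : x ≠ 0) : ∃ u : Eˣ, (u : E) = x :=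
  IsGradedDivisionRing.isUnit (𝒜 := 𝒜) γ x hx h0

omit [IsGradedDivisionRing 𝒜] in
theorem conj_mem (u : Eˣ) (hu : ∃ γ, (u : E) ∈ 𝒜 γ) {a : E} (ha : a ∈ 𝒜 0) :
    (u : E) * a * ((u⁻¹ : Eˣ) : E) ∈ 𝒜 0 := by
  obtain ⟨γ, hγ⟩ := hu
  have := SetLike.mul_mem_graded (SetLike.mul_mem_graded hγ ha) (inv_mem_of_mem 𝒜 hγ)
  simpa using this

/-- Conjugation by a unit of `E` as an automorphism of `E₀`. -/
def conjZero (u : Eˣ) : gradeZero 𝒜 ≃+* gradeZero 𝒜 where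
  toFun a := ⟨u * a * ((u⁻¹ : Eˣ) : E), conj_mem 𝒜 u (exists_mem_of_unit 𝒜 u) a.2⟩
  invFun a := ⟨((u⁻¹ : Eˣ) : E) * a * u, by
    have := conj_mem 𝒜 u⁻¹ (exists_mem_of_unit 𝒜 u⁻¹) a.2
    rwa [inv_inv] at this⟩
  left_inv a := Subtype.ext (by simp [mul_assoc])
  right_inv a := Subtype.ext (by simp [mul_assoc])
  map_mul' a b := Subtype.ext (by simp [mul_assoc])
  map_add' a b := Subtype.ext (by simp [mul_add, add_mul])

/-- The action `θ` of the units of `E` by conjugation on `Z(E₀)`. -/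
def conjCenter : Eˣ →* galH 𝒜 where
  toFun u := AlgEquiv.ofRingEquiv (f := Subring.centerCongr (conjZero 𝒜 u)) fun z => by
    refine Subtype.ext (Subtype.ext ?_)
    have hz : ((z : Subring.center (gradeZero 𝒜)) : E) ∈ Subring.center E := z.2
    change (u : E) * ((z : Subring.center (gradeZero 𝒜)) : E) * ((u⁻¹ : Eˣ) : E) = _
    rw [Subring.mem_center_iff.mp hz, mul_assoc, Units.mul_inv, mul_one]
    rfl
  map_one' := by
    ext z
    change ((1 : Eˣ) : E) * ((z : gradeZero 𝒜) : E) * (((1 : Eˣ)⁻¹ : Eˣ) : E) = z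
    simp
  map_mul' u v := by
    ext z
    change ((u * v : Eˣ) : E) * ((z : gradeZero 𝒜) : E) * (((u * v)⁻¹ : Eˣ) : E) =
      (u : E) * ((v : E) * ((z : gradeZero 𝒜) : E) * ((v⁻¹ : Eˣ) : E)) * ((u⁻¹ : Eˣ) : E)
    simp [mul_assoc]

theorem conjCenter_coe (u : Eˣ) (z : Subring.center (gradeZero 𝒜)) :
    ((conjCenter 𝒜 u z : gradeZero 𝒜) : E) = u * ((z : gradeZero 𝒜) : E) * ((u⁻¹ : Eˣ) : E) := rfl

theorem conjCenter_eq_one {u : Eˣ} (hu : (u : E) ∈ 𝒜 0) : conjCenter 𝒜 u = 1 := by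
  ext z
  rw [conjCenter_coe]
  have h := congrArg Subtype.val (Subring.mem_center_iff.mp z.2 ⟨u, hu⟩)
  change (u : E) * ((z : gradeZero 𝒜) : E) = ((z : gradeZero 𝒜) : E) * u at h
  rw [h, mul_assoc, Units.mul_inv, mul_one]
  rfl

theorem conjCenter_eq_of_mem {u v : Eˣ} {γ : Γ} (hu : (u : E) ∈ 𝒜 γ) (hv : (v : E) ∈ 𝒜 γ) :
    conjCenter 𝒜 u = conjCenter 𝒜 v := by
  have h : ((u * v⁻¹ : Eˣ) : E) ∈ 𝒜 0 := by
    have := SetLike.mul_mem_graded hu (inv_mem_of_mem 𝒜 hv)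
    rwa [add_neg_cancel] at this
  have h1 := conjCenter_eq_one 𝒜 h
  rwa [map_mul, map_inv, mul_inv_eq_one] at h1

omit [IsGradedDivisionRing 𝒜] in
theorem mul_mem_add {u v : Eˣ} {γ δ : Γ} (hu : (u : E) ∈ 𝒜 γ) (hv : (v : E) ∈ 𝒜 δ) :
    ((u * v : Eˣ) : E) ∈ 𝒜 (γ + δ) := SetLike.mul_mem_graded hu hv

/-- `uv` and `vu` have the same degree, and units of degree 0 act trivially on `Z(E₀)`. -/
theorem conjCenter_comm (u v : Eˣ) :
    conjCenter 𝒜 u * conjCenter 𝒜 v = conjCenter 𝒜 v * conjCenter 𝒜 u := by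
  obtain ⟨γ, hγ⟩ := exists_mem_of_unit 𝒜 u
  obtain ⟨δ, hδ⟩ := exists_mem_of_unit 𝒜 v
  rw [← map_mul, ← map_mul]
  refine conjCenter_eq_of_mem 𝒜 (mul_mem_add 𝒜 hγ hδ) ?_
  rw [add_comm]
  exact mul_mem_add 𝒜 hδ hγ

/-- Nonzero homogeneous elements are units and generate `E` additively, so commuting with all units
means being central. -/
theorem mem_centerZero_of_forall_conjCenter (z : Subring.center (gradeZero 𝒜))
    (hz : ∀ u : Eˣ, conjCenter 𝒜 u z = z) : z ∈ centerZero 𝒜 := by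
  change ((z : gradeZero 𝒜) : E) ∈ Subring.center E
  rw [Subring.mem_center_iff]
  intro g
  induction g using DirectSum.Decomposition.inductionOn 𝒜 with
  | zero => simp
  | add a b ha hb => rw [add_mul, mul_add, ha, hb]
  | homogeneous a =>
    by_cases h0 : (a : E) = 0
    · rw [h0, zero_mul, mul_zero]
    · obtain ⟨u, hu⟩ := exists_unit_of_mem 𝒜 a.2 h0
      have h := congrArg (fun w : Subring.center (gradeZero 𝒜) => ((w : gradeZero 𝒜) : E)) (hz u)
      simp only [conjCenter_coe] at h
      rw [← hu]
      rw [Units.mul_inv_eq_iff_eq_mul] at h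
      exact h

theorem fixedField_range_conjCenter :
    IntermediateField.fixedField (conjCenter 𝒜).range = ⊥ := by
  rw [eq_bot_iff]
  intro z hz
  rw [IntermediateField.mem_bot]
  exact ⟨⟨z, mem_centerZero_of_forall_conjCenter 𝒜 z
    fun u => hz ⟨conjCenter 𝒜 u, ⟨u, rfl⟩⟩⟩, rfl⟩

/-- Galois correspondence: the image is the group fixing its own fixed field, which is `T₀`. -/
theorem conjCenter_surjective [FiniteDimensional (centerZero 𝒜) (Subring.center (gradeZero 𝒜))] :
    Function.Surjective (conjCenter 𝒜) := by
  rw [← MonoidHom.range_eq_top,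
    ← IntermediateField.fixingSubgroup_fixedField (conjCenter 𝒜).range,
    fixedField_range_conjCenter, IntermediateField.fixingSubgroup_bot]

theorem isGalois_center_gradeZero
    [FiniteDimensional (centerZero 𝒜) (Subring.center (gradeZero 𝒜))] :
    IsGalois (centerZero 𝒜) (Subring.center (gradeZero 𝒜)) := by
  apply IsGalois.of_fixedField_eq_bot
  rw [← MonoidHom.range_eq_top.mpr (conjCenter_surjective 𝒜), fixedField_range_conjCenter]

end IsGradedDivisionRing
end GradedUnits

/-! ### The quotient division ring and finiteness over degree zero -/

section QuotRing

variable {Γ E : Type*} [AddCommGroup Γ] [DecidableEq Γ] [Ring E]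
variable (𝒜 : Γ → AddSubgroup E) [GradedRing 𝒜] [IsGradedDivisionRing 𝒜]

namespace IsGradedDivisionRing

/-- The embedding `E → q(E)`. -/
abbrev toQuot : E →ₐ[Subring.center E] quotRing 𝒜 := Algebra.TensorProduct.includeRight

instance isLocalizedModule_toQuot :
    IsLocalizedModule (nonZeroDivisors (Subring.center E))
      (TensorProduct.mk (Subring.center E) (quotCenter 𝒜) E 1) :=
  (isLocalizedModule_iff_isBaseChange (nonZeroDivisors (Subring.center E)) (quotCenter 𝒜) _).mpr
    (TensorProduct.isBaseChange (Subring.center E) E (quotCenter 𝒜))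

theorem toQuot_injective : Function.Injective (toQuot 𝒜) := by
  intro a b hab
  have := isDomain 𝒜
  obtain ⟨c, hc⟩ := (IsLocalizedModule.eq_iff_exists (nonZeroDivisors (Subring.center E))
    (TensorProduct.mk (Subring.center E) (quotCenter 𝒜) E 1)).mp hab
  have hc0 : ((c : Subring.center E) : E) ≠ 0 := by
    intro h0
    exact nonZeroDivisors.coe_ne_zero c (Subtype.ext h0)
  exact mul_left_cancel₀ hc0 hc

theorem exists_smul_eq_toQuot (x : quotRing 𝒜) :
    ∃ c : quotCenter 𝒜, c ≠ 0 ∧ ∃ a : E, c • x = toQuot 𝒜 a := by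
  obtain ⟨⟨a, s⟩, hs⟩ := IsLocalizedModule.surj (nonZeroDivisors (Subring.center E))
    (TensorProduct.mk (Subring.center E) (quotCenter 𝒜) E 1) x
  refine ⟨algebraMap _ _ (s : Subring.center E), ?_, a, ?_⟩
  · have := isDomain 𝒜
    exact IsFractionRing.to_map_ne_zero_of_mem_nonZeroDivisors s.2
  · rw [algebraMap_smul]
    exact hs

instance isDomain_quotRing : IsDomain (quotRing 𝒜) := by
  have := isDomain 𝒜
  have : Nontrivial (quotRing 𝒜) := (toQuot_injective 𝒜).nontrivial
  have : NoZeroDivisors (quotRing 𝒜) := by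
    refine ⟨fun {x y} hxy => ?_⟩
    obtain ⟨c, hc, a, ha⟩ := exists_smul_eq_toQuot 𝒜 x
    obtain ⟨d, hd, b, hb⟩ := exists_smul_eq_toQuot 𝒜 y
    have h : toQuot 𝒜 (a * b) = 0 := by
      rw [map_mul, ← ha, ← hb, smul_mul_smul_comm, hxy, smul_zero]
    have h' : a * b = 0 := toQuot_injective 𝒜 (h.trans (map_zero _).symm)
    rcases mul_eq_zero.mp h' with rfl | rfl
    · left
      rw [map_zero] at ha
      exact (smul_eq_zero.mp ha).resolve_left hc
    · right
      rw [map_zero] at hb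
      exact (smul_eq_zero.mp hb).resolve_left hd
  exact NoZeroDivisors.to_isDomain _

instance isCentral_quotRing : Algebra.IsCentral (quotCenter 𝒜) (quotRing 𝒜) where
  out x hx := by
    obtain ⟨c, hc, a, ha⟩ := exists_smul_eq_toQuot 𝒜 x
    rw [Subalgebra.mem_center_iff] at hx
    have hac : a ∈ Subring.center E := by
      rw [Subring.mem_center_iff]
      intro g
      apply toQuot_injective 𝒜
      rw [map_mul, map_mul, ← ha, mul_smul_comm, smul_mul_assoc, hx]
    refine ⟨c⁻¹ * algebraMap _ _ (⟨a, hac⟩ : Subring.center E), ?_⟩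
    change algebraMap (quotCenter 𝒜) (quotRing 𝒜) _ = x
    rw [map_mul, ← Algebra.smul_def, ← IsScalarTower.algebraMap_apply]
    have h2 : algebraMap (Subring.center E) (quotRing 𝒜) ⟨a, hac⟩ = toQuot 𝒜 a :=
      ((toQuot 𝒜).commutes ⟨a, hac⟩).symm
    rw [h2, ← ha, smul_smul, inv_mul_cancel₀ hc, one_smul]

theorem finrank_quotRing :
    Module.finrank (quotCenter 𝒜) (quotRing 𝒜) = Module.finrank (Subring.center E) E := by
  have := isDomain 𝒜
  rw [IsLocalization.finrank_eq (quotCenter 𝒜) (nonZeroDivisors (Subring.center E)) le_rfl]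
  exact IsLocalizedModule.finrank_eq (nonZeroDivisors (Subring.center E))
    (TensorProduct.mk (Subring.center E) (quotCenter 𝒜) E 1) le_rfl

/-- Elements of `E₀` which are independent over `T₀` are independent over `q(T)`. -/
theorem linearIndependent_toQuot {ι : Type*} (v : ι → gradeZero 𝒜)
    (hv : LinearIndependent (centerZero 𝒜) v) :
    LinearIndependent (quotCenter 𝒜) fun i => toQuot 𝒜 (v i : E) := by
  classical
  have := isDomain 𝒜
  have h : LinearIndependent (Subring.center E) fun i => (v i : E) := by
    rw [linearIndependent_iff'] at hv ⊢
    intro s g hg i hi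
    have hcomp : ∀ γ, ∑ i ∈ s, (DirectSum.decompose 𝒜 (g i : E) γ : E) * (v i : E) = 0 := by
      intro γ
      have h1 := congrArg (fun x => (DirectSum.decompose 𝒜 x γ : E)) hg
      simp only [DirectSum.decompose_sum, DirectSum.decompose_zero, DirectSum.zero_apply,
        ZeroMemClass.coe_zero] at h1
      rw [DFinsupp.finsetSum_apply, AddSubmonoidClass.coe_finsetSum] at h1
      rw [← h1]
      refine Finset.sum_congr rfl fun j _ => ?_
      rw [Subring.smul_def, smul_eq_mul, DirectSum.coe_decompose_mul_of_right_mem_zero 𝒜 (v j).2]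
    by_contra hne
    have hne' : (g i : E) ≠ 0 := fun h0 => hne (Subtype.ext h0)
    obtain ⟨γ, hγ⟩ : ∃ γ, (DirectSum.decompose 𝒜 (g i : E) γ : E) ≠ 0 := by
      by_contra hcon
      push Not at hcon
      apply hne'
      rw [← DirectSum.sum_support_decompose 𝒜 (g i : E)]
      exact Finset.sum_eq_zero fun γ _ => hcon γ
    -- The degree-γ components of the coefficients still form a relation, since the `v j` have
    -- degree 0. Dividing by one nonzero component, a central unit, moves them into `T₀` and makes
    -- the i-th coefficient 1.
    obtain ⟨u, hu⟩ := exists_unit_of_mem 𝒜 (SetLike.coe_mem (DirectSum.decompose 𝒜 (g i : E) γ)) hγ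
    have huγ : (u : E) ∈ 𝒜 γ := hu ▸ SetLike.coe_mem _
    have huc : (u : E) ∈ Subring.center E := hu ▸ decompose_mem_center 𝒜 (g i).2 γ
    have huic : ((u⁻¹ : Eˣ) : E) ∈ Subring.center E := inv_mem_subring_center huc
    have hmem : ∀ j, ((u⁻¹ : Eˣ) : E) * (DirectSum.decompose 𝒜 (g j : E) γ : E) ∈ 𝒜 0 := by
      intro j
      have := SetLike.mul_mem_graded (inv_mem_of_mem 𝒜 huγ)
        (SetLike.coe_mem (DirectSum.decompose 𝒜 (g j : E) γ))
      rwa [neg_add_cancel] at this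
    have hmemc : ∀ j, ((u⁻¹ : Eˣ) : E) * (DirectSum.decompose 𝒜 (g j : E) γ : E) ∈
        Subring.center E := fun j => mul_mem huic (decompose_mem_center 𝒜 (g j).2 γ)
    let c : ι → centerZero 𝒜 := fun j => ⟨⟨⟨_, hmem j⟩, by
      rw [Subring.mem_center_iff]
      intro x
      exact Subtype.ext (Subring.mem_center_iff.mp (hmemc j) x)⟩, hmemc j⟩
    have hc := hv s c (by
      apply Subtype.ext
      rw [AddSubmonoidClass.coe_finsetSum]
      change ∑ j ∈ s, ((u⁻¹ : Eˣ) : E) * (DirectSum.decompose 𝒜 (g j : E) γ : E) * (v j : E) = 0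
      simp only [mul_assoc]
      rw [← Finset.mul_sum, hcomp, mul_zero]) i hi
    have hc' : ((u⁻¹ : Eˣ) : E) * (DirectSum.decompose 𝒜 (g i : E) γ : E) = 0 :=
      congrArg (fun z : centerZero 𝒜 => (((z : Subring.center (gradeZero 𝒜)) : gradeZero 𝒜) : E)) hc
    rw [← hu, Units.inv_mul] at hc'
    exact one_ne_zero hc'
  exact h.of_isLocalizedModule (quotCenter 𝒜) (nonZeroDivisors (Subring.center E))
    (TensorProduct.mk (Subring.center E) (quotCenter 𝒜) E 1)

variable [Module.Finite (Subring.center E) E]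

instance finite_gradeZero : Module.Finite (centerZero 𝒜) (gradeZero 𝒜) := by
  have b := Module.Free.chooseBasis (centerZero 𝒜) (gradeZero 𝒜)
  have hli := linearIndependent_toQuot 𝒜 b b.linearIndependent
  have := hli.finite
  exact Module.Finite.of_basis b

instance finite_center_gradeZero :
    Module.Finite (centerZero 𝒜) (Subring.center (gradeZero 𝒜)) :=
  Module.Finite.of_injective
    ((IsScalarTower.toAlgHom (centerZero 𝒜) (Subring.center (gradeZero 𝒜))
      (gradeZero 𝒜)).toLinearMap) Subtype.val_injective

instance finite_gradeZero_over_center :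
    Module.Finite (Subring.center (gradeZero 𝒜)) (gradeZero 𝒜) :=
  Module.Finite.of_restrictScalars_finite (centerZero 𝒜) _ _

end IsGradedDivisionRing
end QuotRing

/-! ### Minimal polynomials and norms in a Galois tower -/

section NormOfMinpoly
open Polynomial

/-- The norm from a Galois extension of the constant coefficient of a minimal polynomial. -/
theorem norm_coeff_zero_minpoly (F Z : Type*) {A : Type*} [Field F] [Field Z] [Algebra F Z]
    [FiniteDimensional F Z] [IsGalois F Z] [Ring A] [IsDomain A] [Algebra F A] [Algebra Z A]
    [IsScalarTower F Z A] [FiniteDimensional F A] (a : A) :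
    ∃ k, k * (minpoly F a).natDegree = Module.finrank F Z * (minpoly Z a).natDegree ∧
      Algebra.norm F ((minpoly Z a).coeff 0) = (minpoly F a).coeff 0 ^ k := by
  classical
  have hF : IsIntegral F a := Algebra.IsIntegral.isIntegral a
  have hZ : IsIntegral Z a := hF.tower_top
  set f : Z[X] := ∏ h : Gal(Z/F), (minpoly Z a).map (h : Z →+* Z) with hf
  have hfm : f.Monic := monic_prod_of_monic _ _ fun h _ => (minpoly.monic hZ).map _
  have hfix : ∀ g : Gal(Z/F), f.map (g : Z →+* Z) = f := by
    intro g
    rw [hf, Polynomial.map_prod]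
    refine Fintype.prod_equiv (Equiv.mulLeft g) _ _ fun h => ?_
    rw [Polynomial.map_map]
    rfl
  have hlift : f ∈ lifts (algebraMap F Z) := by
    rw [lifts_iff_coeff_lifts]
    intro i
    rw [IsGalois.mem_range_algebraMap_iff_fixed]
    intro g
    have := congrArg (fun p => coeff p i) (hfix g)
    rw [coeff_map] at this
    exact this
  obtain ⟨f', hf', hdeg, hfm'⟩ := lifts_and_natDegree_eq_and_monic hlift hfm
  -- Every Galois conjugate of the minimal polynomial over `Z` divides the one over `F`. So the
  -- product f', which descends to `F`, divides a power of an irreducible polynomial and is itself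
  -- such a power.
  have hdvd : f' ∣ minpoly F a ^ Fintype.card Gal(Z/F) := by
    rw [← map_dvd_map' (algebraMap F Z), hf', Polynomial.map_pow, hf]
    refine (Finset.prod_dvd_prod_of_dvd _ (fun _ => (minpoly F a).map (algebraMap F Z))
      fun h _ => ?_).trans ?_
    · have h1 := Polynomial.map_dvd (h : Z →+* Z) (minpoly.dvd_map_of_isScalarTower F Z a)
      rw [Polynomial.map_map] at h1
      have h2 : ((h : Z →+* Z)).comp (algebraMap F Z) = algebraMap F Z := by
        ext x
        exact h.commutes x
      rwa [h2] at h1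
    · rw [Finset.prod_const, Finset.card_univ]
  obtain ⟨k, -, hk⟩ := (dvd_prime_pow (minpoly.irreducible hF).prime _).mp hdvd
  have hk' := eq_of_monic_of_associated hfm' ((minpoly.monic hF).pow k) hk
  refine ⟨k, ?_, ?_⟩
  · rw [← natDegree_pow, ← hk', hdeg, hf, natDegree_prod_of_monic _ _
      fun h _ => (minpoly.monic hZ).map _]
    simp only [natDegree_map, Finset.sum_const, Finset.card_univ, smul_eq_mul]
    rw [← Nat.card_eq_fintype_card, IsGalois.card_aut_eq_finrank]
  · apply (algebraMap F Z).injective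
    rw [Algebra.norm_eq_prod_automorphisms, map_pow, ← coeff_map, coeff_zero_eq_eval_zero,
      coeff_zero_eq_eval_zero, ← eval_pow, ← Polynomial.map_pow, ← hk', hf', hf, eval_prod]
    refine Finset.prod_congr rfl fun h _ => ?_
    rw [← coeff_zero_eq_eval_zero, ← coeff_zero_eq_eval_zero, coeff_map]
    rfl

end NormOfMinpoly

/-! ### The reduced norm on elements of degree zero -/

section GradedNorm
open Polynomial

variable {Γ E : Type*} [AddCommGroup Γ] [DecidableEq Γ] [Ring E]
variable (𝒜 : Γ → AddSubgroup E) [GradedRing 𝒜] [IsGradedDivisionRing 𝒜]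

namespace IsGradedDivisionRing

instance isCentral_gradeZero :
    Algebra.IsCentral (Subring.center (gradeZero 𝒜)) (gradeZero 𝒜) :=
  isCentral_subring_center

/-- The embedding `T₀ → q(T)`. -/
def centerZeroToQuot : centerZero 𝒜 →+* quotCenter 𝒜 :=
  (algebraMap (Subring.center E) (quotCenter 𝒜)).comp (centerZeroIncl 𝒜)

theorem algebraMap_centerZeroToQuot :
    (algebraMap (quotCenter 𝒜) (quotRing 𝒜)).comp (centerZeroToQuot 𝒜) =
      ((toQuot 𝒜 : E →+* quotRing 𝒜).comp (gradeZero 𝒜).subtype).comp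
        (algebraMap (centerZero 𝒜) (gradeZero 𝒜)) := by
  ext z
  exact ((toQuot 𝒜).commutes (centerZeroIncl 𝒜 z)).symm

variable [Module.Finite (Subring.center E) E]

theorem isIntegral_toQuot (a : E) : IsIntegral (quotCenter 𝒜) (toQuot 𝒜 a) :=
  Algebra.IsIntegral.isIntegral _

theorem isIntegral_gradeZero (a : gradeZero 𝒜) : IsIntegral (centerZero 𝒜) a :=
  Algebra.IsIntegral.isIntegral _

/-- The degree cannot drop over `q(T)`: the powers of a below the degree are independent over `T₀`,
hence over `q(T)`. -/
theorem minpoly_toQuot_gradeZero (a : gradeZero 𝒜) :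
    minpoly (quotCenter 𝒜) (toQuot 𝒜 (a : E)) =
      (minpoly (centerZero 𝒜) a).map (centerZeroToQuot 𝒜) := by
  have := isDomain_gradeZero 𝒜
  set m := minpoly (centerZero 𝒜) a with hm
  have hmm : m.Monic := minpoly.monic (isIntegral_gradeZero 𝒜 a)
  have hx := isIntegral_toQuot 𝒜 (a : E)
  have hroot : aeval (toQuot 𝒜 (a : E)) (m.map (centerZeroToQuot 𝒜)) = 0 := by
    rw [aeval_def, eval₂_map, algebraMap_centerZeroToQuot]
    have h0 : eval₂ (algebraMap (centerZero 𝒜) (gradeZero 𝒜)) a m = 0 := minpoly.aeval _ a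
    have h1 := congrArg ((toQuot 𝒜 : E →+* quotRing 𝒜).comp (gradeZero 𝒜).subtype) h0
    rw [hom_eval₂, map_zero] at h1
    exact h1
  have hdvd := minpoly.dvd (quotCenter 𝒜) _ hroot
  refine (eq_of_monic_of_dvd_of_natDegree_le (minpoly.monic hx) (hmm.map _) hdvd ?_).symm
  rw [natDegree_map]
  by_contra hlt
  push Not at hlt
  have hli := linearIndependent_toQuot 𝒜 _ (linearIndependent_pow (K := centerZero 𝒜) a)
  rw [Fintype.linearIndependent_iff] at hli
  have h0 := minpoly.aeval (quotCenter 𝒜) (toQuot 𝒜 (a : E))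
  rw [aeval_eq_sum_range' hlt, Finset.sum_range] at h0
  have h1 := hli (fun i => (minpoly (quotCenter 𝒜) (toQuot 𝒜 (a : E))).coeff i) (by
    rw [← h0]
    refine Finset.sum_congr rfl fun i _ => ?_
    rw [SubmonoidClass.coe_pow, map_pow]) ⟨_, hlt⟩
  exact one_ne_zero ((minpoly.monic hx).coeff_natDegree.symm.trans h1)

theorem gradedNrd_apply (a : E) :
    gradedNrd 𝒜 a = (-1) ^ centralIndex E * (minpoly (quotCenter 𝒜) (toQuot 𝒜 a)).coeff 0 ^
      (centralIndex E / (minpoly (quotCenter 𝒜) (toQuot 𝒜 a)).natDegree) := by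
  have h := reducedNorm_apply (K := quotCenter 𝒜) (toQuot 𝒜 a)
  rw [finrank_quotRing] at h
  exact h

theorem nrdZero_apply (a : gradeZero 𝒜) :
    nrdZero 𝒜 a = (-1) ^ centralIndex (gradeZero 𝒜) *
      (minpoly (Subring.center (gradeZero 𝒜)) a).coeff 0 ^
      (centralIndex (gradeZero 𝒜) / (minpoly (Subring.center (gradeZero 𝒜)) a).natDegree) := by
  have := isDomain_gradeZero 𝒜
  exact reducedNorm_apply (K := Subring.center (gradeZero 𝒜)) a

/-- A maximal commutative subalgebra of `E₀` has dimension `ind(E₀)[Z(E₀):T₀]` over `T₀`. Its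
`q(T)`-span in `q(E)` is commutative of the same dimension, which therefore divides `ind(E)`. -/
theorem centralIndex_gradeZero_mul_dvd :
    centralIndex (gradeZero 𝒜) *
      Module.finrank (centerZero 𝒜) (Subring.center (gradeZero 𝒜)) ∣ centralIndex E := by
  have := isDomain_gradeZero 𝒜
  obtain ⟨L, hLc, hL⟩ := exists_comm_subalgebra_finrank_eq (Subring.center (gradeZero 𝒜)) (gradeZero 𝒜)
  have hL' : Module.finrank (centerZero 𝒜) L = centralIndex (gradeZero 𝒜) *
      Module.finrank (centerZero 𝒜) (Subring.center (gradeZero 𝒜)) := by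
    rw [← Module.finrank_mul_finrank (centerZero 𝒜) (Subring.center (gradeZero 𝒜)) L, hL, mul_comm]
    rfl
  have hfin : Module.Finite (centerZero 𝒜) L :=
    Module.Finite.trans (Subring.center (gradeZero 𝒜)) L
  have b := Module.finBasis (centerZero 𝒜) L
  let j : gradeZero 𝒜 →+* quotRing 𝒜 := (toQuot 𝒜 : E →+* quotRing 𝒜).comp (gradeZero 𝒜).subtype
  have hli : LinearIndependent (centerZero 𝒜) fun i => (b i : gradeZero 𝒜) :=
    b.linearIndependent.map' ((L.val.restrictScalars (centerZero 𝒜)).toLinearMap)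
      (LinearMap.ker_eq_bot.mpr Subtype.val_injective)
  have hliq := linearIndependent_toQuot 𝒜 _ hli
  let S := Algebra.adjoin (quotCenter 𝒜) (j '' (L : Set (gradeZero 𝒜)))
  have hScomm : ∀ x ∈ S, ∀ y ∈ S, x * y = y * x := by
    have := Algebra.isMulCommutative_adjoin (quotCenter 𝒜) (s := j '' (L : Set (gradeZero 𝒜))) (by
      rintro _ ⟨x, hx, rfl⟩ _ ⟨y, hy, rfl⟩
      rw [← map_mul, ← map_mul, hLc x hx y hy])
    intro x hx y hy
    exact congrArg Subtype.val (mul_comm' (⟨x, hx⟩ : S) ⟨y, hy⟩)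
  have hdvd := finrank_dvd_sqrt_finrank S hScomm
  have hspan : S.toSubmodule = Submodule.span (quotCenter 𝒜)
      (Set.range fun i => toQuot 𝒜 ((b i : gradeZero 𝒜) : E)) := by
    rw [Algebra.adjoin_eq_span]
    apply le_antisymm
    · rw [Submodule.span_le]
      have hcl : (Submonoid.closure (j '' (L : Set (gradeZero 𝒜))) : Set (quotRing 𝒜)) ⊆
          j '' (L : Set (gradeZero 𝒜)) := by
        have := (Submonoid.closure_le (S := L.toSubmonoid.map j.toMonoidHom)).mpr
          (show j '' (L : Set (gradeZero 𝒜)) ⊆ _ from fun x hx => hx)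
        exact this
      intro x hx
      obtain ⟨l, hl, rfl⟩ := hcl hx
      have hrep := b.sum_repr ⟨l, hl⟩
      have h2 := congrArg (fun y : L => j (y : gradeZero 𝒜)) hrep
      simp only [AddSubmonoidClass.coe_finsetSum, map_sum] at h2
      rw [← h2]
      refine Submodule.sum_mem _ fun i _ => ?_
      have h3 : j ((b.repr ⟨l, hl⟩ i • b i : L) : gradeZero 𝒜) =
          centerZeroToQuot 𝒜 (b.repr ⟨l, hl⟩ i) • toQuot 𝒜 ((b i : gradeZero 𝒜) : E) := by
        have h4 : ((b.repr ⟨l, hl⟩ i • b i : L) : gradeZero 𝒜) =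
          algebraMap (centerZero 𝒜) (gradeZero 𝒜) (b.repr ⟨l, hl⟩ i) * (b i : gradeZero 𝒜) := rfl
        rw [h4, map_mul, Algebra.smul_def]
        congr 1
        exact (RingHom.congr_fun (algebraMap_centerZeroToQuot 𝒜) (b.repr ⟨l, hl⟩ i)).symm
      rw [h3]
      exact Submodule.smul_mem _ _ (Submodule.subset_span ⟨i, rfl⟩)
    · apply Submodule.span_mono
      rintro _ ⟨i, rfl⟩
      exact Submonoid.subset_closure ⟨b i, (b i).2, rfl⟩
  have hrank : Module.finrank (quotCenter 𝒜) S = Module.finrank (centerZero 𝒜) L := by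
    have h5 := finrank_span_eq_card hliq
    rw [← hspan, Fintype.card_fin] at h5
    exact h5
  rw [hrank, hL', finrank_quotRing] at hdvd
  exact hdvd

theorem centralIndex_eq : centralIndex E = gradedDel 𝒜 * (centralIndex (gradeZero 𝒜) *
    Module.finrank (centerZero 𝒜) (Subring.center (gradeZero 𝒜))) :=
  (Nat.div_mul_cancel (centralIndex_gradeZero_mul_dvd 𝒜)).symm

/-- `Nrd_E(a) = N_{Z(E₀)/T₀}(Nrd_{E₀}(a))^∂` for `a ∈ E₀`. -/
theorem gradedNrd_gradeZero (a : gradeZero 𝒜) :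
    gradedNrd 𝒜 (a : E) =
      centerZeroToQuot 𝒜 (Algebra.norm (centerZero 𝒜) (nrdZero 𝒜 a) ^ gradedDel 𝒜) := by
  have := isDomain_gradeZero 𝒜
  have := isGalois_center_gradeZero 𝒜
  obtain ⟨k, hk, hnorm⟩ := norm_coeff_zero_minpoly (centerZero 𝒜) (Subring.center (gradeZero 𝒜)) a
  have hn := centralIndex_eq 𝒜
  obtain ⟨s, hs⟩ : (minpoly (Subring.center (gradeZero 𝒜)) a).natDegree ∣
    centralIndex (gradeZero 𝒜) := natDegree_minpoly_dvd (Subring.center (gradeZero 𝒜)) a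
  have hd0 : 0 < (minpoly (Subring.center (gradeZero 𝒜)) a).natDegree :=
    minpoly.natDegree_pos (Algebra.IsIntegral.isIntegral a)
  have hd' : 0 < (minpoly (centerZero 𝒜) a).natDegree :=
    minpoly.natDegree_pos (isIntegral_gradeZero 𝒜 a)
  have hs' : centralIndex (gradeZero 𝒜) / (minpoly (Subring.center (gradeZero 𝒜)) a).natDegree = s :=
    Nat.div_eq_of_eq_mul_right hd0 hs
  have hexp : centralIndex E / (minpoly (centerZero 𝒜) a).natDegree = k * s * gradedDel 𝒜 := by
    apply Nat.div_eq_of_eq_mul_left hd'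
    rw [hn, hs]
    calc gradedDel 𝒜 * ((minpoly (Subring.center (gradeZero 𝒜)) a).natDegree * s *
          Module.finrank (centerZero 𝒜) (Subring.center (gradeZero 𝒜)))
        = s * gradedDel 𝒜 * (Module.finrank (centerZero 𝒜) (Subring.center (gradeZero 𝒜)) *
          (minpoly (Subring.center (gradeZero 𝒜)) a).natDegree) := by ring
      _ = _ := by rw [← hk]; ring
  have hneg : Algebra.norm (centerZero 𝒜) (-1 : Subring.center (gradeZero 𝒜)) =
      (-1) ^ Module.finrank (centerZero 𝒜) (Subring.center (gradeZero 𝒜)) := by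
    have := Algebra.norm_algebraMap (S := Subring.center (gradeZero 𝒜)) (-1 : centerZero 𝒜)
    rwa [map_neg, map_one] at this
  rw [gradedNrd_apply, nrdZero_apply, minpoly_toQuot_gradeZero, natDegree_map, coeff_map, hs', hexp,
    map_mul, map_pow (Algebra.norm (centerZero 𝒜)), map_pow (Algebra.norm (centerZero 𝒜)), hnorm,
    hneg]
  simp only [map_mul, map_pow, map_neg, map_one, mul_pow, ← pow_mul]
  congr 2
  rw [hn]
  ring

end IsGradedDivisionRing
end GradedNorm

/-! ### Reduced norms of homogeneous and symmetric elements -/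

section HomogeneousNorm
open Polynomial

variable {Γ E : Type*} [AddCommGroup Γ] [DecidableEq Γ] [Ring E]

namespace RingInvo

/-- The restriction of an involution to the center as a ring homomorphism. -/
def onCenterHom (τ : RingInvo E) : Subring.center E →+* Subring.center E where
  toFun := τ.onCenter
  map_one' := Subtype.ext τ.unop_map_one
  map_zero' := Subtype.ext τ.unop_map_zero
  map_add' a b := Subtype.ext (τ.unop_map_add (a : E) b)
  map_mul' a b := by
    rw [mul_comm]
    exact Subtype.ext (τ.unop_map_mul (b : E) a)

theorem unop_map_aeval (τ : RingInvo E) {a : E} (ha : (τ a).unop = a) (q : (Subring.center E)[X]) :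
    (τ (aeval a q)).unop = aeval a (q.map τ.onCenterHom) := by
  induction q using Polynomial.induction_on' with
  | add p q hp hq =>
    rw [map_add, unop_map_add, hp, hq, Polynomial.map_add, map_add]
  | monomial n c =>
    rw [map_monomial, aeval_monomial, aeval_monomial, unop_map_mul, map_pow, MulOpposite.unop_pow, ha]
    exact (Subring.mem_center_iff.mp (τ.onCenter c).2 (a ^ n))

end RingInvo

variable (𝒜 : Γ → AddSubgroup E) [GradedRing 𝒜] [IsGradedDivisionRing 𝒜]

namespace IsGradedDivisionRing

theorem aeval_map_eq_zero_iff (a : E) (p : (Subring.center E)[X]) :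
    aeval (toQuot 𝒜 a) (p.map (algebraMap (Subring.center E) (quotCenter 𝒜))) = 0 ↔
      aeval a p = 0 := by
  rw [aeval_map_algebraMap, aeval_algHom_apply, map_eq_zero_iff _ (toQuot_injective 𝒜)]

variable [Module.Finite (Subring.center E) E]

/-- The minimal polynomial of a homogeneous element over `q(T)` has coefficients in `T`. -/
theorem exists_monic_map_eq_minpoly {a : E} {γ : Γ} (ha : a ∈ 𝒜 γ) :
    ∃ p : (Subring.center E)[X], p.Monic ∧
      p.map (algebraMap (Subring.center E) (quotCenter 𝒜)) =
        minpoly (quotCenter 𝒜) (toQuot 𝒜 a) := by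
  classical
  have := isDomain 𝒜
  have hinj : Function.Injective (algebraMap (Subring.center E) (quotCenter 𝒜)) :=
    IsFractionRing.injective _ _
  have hx := isIntegral_toQuot 𝒜 a
  set m := minpoly (quotCenter 𝒜) (toQuot 𝒜 a) with hm
  set d := m.natDegree with hd
  have hmm : m.Monic := minpoly.monic hx
  obtain ⟨b, hbM, hb⟩ :=
    IsLocalization.integerNormalization_spec (nonZeroDivisors (Subring.center E)) m
  set P := IsLocalization.integerNormalization (nonZeroDivisors (Subring.center E)) m with hP
  have hcoeff : ∀ i, algebraMap _ (quotCenter 𝒜) (P.coeff i) =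
      algebraMap (Subring.center E) (quotCenter 𝒜) b * m.coeff i := by
    intro i
    rw [← coeff_map, hb, coeff_smul, Algebra.smul_def]
  have hPd : P.coeff d = b := by
    apply hinj
    rw [hcoeff, hd, hmm.coeff_natDegree, mul_one]
  have hPdeg : P.natDegree < d + 1 := by
    rw [Nat.lt_succ_iff, natDegree_le_iff_coeff_eq_zero]
    intro i hi
    apply hinj
    rw [hcoeff, coeff_eq_zero_of_natDegree_lt hi, mul_zero, map_zero]
  have hPa : aeval a P = 0 := by
    rw [← aeval_map_eq_zero_iff 𝒜, hb, ← algebraMap_smul (quotCenter 𝒜) b m, map_smul, minpoly.aeval,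
      smul_zero]
  have hb0 : (b : E) ≠ 0 := fun h0 => nonZeroDivisors.ne_zero hbM (Subtype.ext h0)
  obtain ⟨δ, hδ⟩ : ∃ δ, (DirectSum.decompose 𝒜 (b : E) δ : E) ≠ 0 := by
    by_contra hcon
    push Not at hcon
    apply hb0
    rw [← DirectSum.sum_support_decompose 𝒜 (b : E)]
    exact Finset.sum_eq_zero fun γ _ => hcon γ
  obtain ⟨u, hu⟩ := exists_unit_of_mem 𝒜 (SetLike.coe_mem (DirectSum.decompose 𝒜 (b : E) δ)) hδ
  have huc : ((u⁻¹ : Eˣ) : E) ∈ Subring.center E :=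
    inv_mem_subring_center (hu ▸ decompose_mem_center 𝒜 b.2 δ)
  -- In P(a) = 0, where P = b·m has coefficients in `T`, take the component of degree δ + dγ. The
  -- i-th coefficient contributes its part of degree δ + (d − i)γ; dividing by u, the δ-component of
  -- the leading coefficient b, makes the relation monic over `T`.
  let c : ℕ → Subring.center E := fun i =>
    ⟨((u⁻¹ : Eˣ) : E) * DirectSum.decompose 𝒜 (P.coeff i : E) (δ + (d - i) • γ),
      mul_mem huc (decompose_mem_center 𝒜 (P.coeff i).2 _)⟩
  have hsum : ∑ i ∈ Finset.range (d + 1), c i • a ^ i = 0 := by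
    have h1 := congrArg (fun x => ((u⁻¹ : Eˣ) : E) * (DirectSum.decompose 𝒜 x (δ + d • γ) : E)) hPa
    rw [aeval_eq_sum_range' hPdeg] at h1
    simp only [DirectSum.decompose_sum, DirectSum.decompose_zero, DirectSum.zero_apply,
      ZeroMemClass.coe_zero, mul_zero] at h1
    rw [DFinsupp.finsetSum_apply, AddSubmonoidClass.coe_finsetSum, Finset.mul_sum] at h1
    rw [← h1]
    refine Finset.sum_congr rfl fun i hi => ?_
    have hi' : i ≤ d := Nat.lt_succ_iff.mp (Finset.mem_range.mp hi)
    have hdeg : δ + d • γ = (δ + (d - i) • γ) + i • γ := by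
      rw [add_assoc, ← add_smul, Nat.sub_add_cancel hi']
    rw [Subring.smul_def, Subring.smul_def, smul_eq_mul, smul_eq_mul, hdeg,
      DirectSum.coe_decompose_mul_add_of_right_mem 𝒜 (SetLike.pow_mem_graded i ha), ← mul_assoc]
  have hcd : c d = 1 := by
    apply Subtype.ext
    change ((u⁻¹ : Eˣ) : E) * DirectSum.decompose 𝒜 (P.coeff d : E) (δ + (d - d) • γ) = 1
    rw [hPd, Nat.sub_self, zero_smul, add_zero, ← hu, Units.inv_mul]
  set r : (Subring.center E)[X] := ∑ i ∈ Finset.range d, monomial i (c i) with hr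
  have hrdeg : r.degree < d := by
    rw [← mem_degreeLT]
    refine Submodule.sum_mem _ fun i hi => ?_
    rw [mem_degreeLT]
    exact (degree_monomial_le i _).trans_lt (by exact_mod_cast Finset.mem_range.mp hi)
  have hpm : (X ^ d + r).Monic := monic_X_pow_add hrdeg
  refine ⟨X ^ d + r, hpm, ?_⟩
  have hpa : aeval a (X ^ d + r) = 0 := by
    rw [← hsum, Finset.sum_range_succ, hcd, one_smul, map_add, aeval_X_pow, hr, map_sum, add_comm]
    congr 1
    exact Finset.sum_congr rfl fun i _ => aeval_monomial _
  refine eq_of_monic_of_dvd_of_natDegree_le hmm (hpm.map _)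
    (minpoly.dvd _ _ ((aeval_map_eq_zero_iff 𝒜 a _).mpr hpa)) ?_
  rw [hpm.natDegree_map, natDegree_add_eq_left_of_degree_lt, natDegree_X_pow]
  rwa [degree_X_pow]

end IsGradedDivisionRing

namespace GradedInvolution

open IsGradedDivisionRing

variable {𝒜} [Module.Finite (Subring.center E) E] (τ : GradedInvolution 𝒜)

/-- The reduced norm of a symmetric unit lies in `R`. -/
theorem exists_fixedCenter_eq_gradedNrd {u : Eˣ} (hu : (τ.toRingInvo (u : E)).unop = u) :
    ∃ r ∈ τ.toRingInvo.fixedCenter,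
      algebraMap (Subring.center E) (quotCenter 𝒜) r = gradedNrd 𝒜 (u : E) := by
  have := isDomain 𝒜
  obtain ⟨γ, hγ⟩ := exists_mem_of_unit 𝒜 u
  obtain ⟨p, hp, hpm⟩ := exists_monic_map_eq_minpoly 𝒜 hγ
  have hroot : aeval (u : E) p = 0 := by
    rw [← aeval_map_eq_zero_iff 𝒜, hpm, minpoly.aeval]
  have hroot' : aeval (u : E) (p.map τ.toRingInvo.onCenterHom) = 0 := by
    rw [← RingInvo.unop_map_aeval _ hu, hroot, RingInvo.unop_map_zero]
  -- Applying τ to p(u) = 0 shows that the conjugate polynomial also kills u; it is monic of the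
  -- same degree, so it equals p.
  have heq : p.map τ.toRingInvo.onCenterHom = p := by
    apply map_injective _ (IsFractionRing.injective (Subring.center E) (quotCenter 𝒜))
    refine eq_of_monic_of_dvd_of_natDegree_le (hp.map _) ((hp.map _).map _) ?_ ?_
    · rw [hpm]
      exact minpoly.dvd _ _ ((aeval_map_eq_zero_iff 𝒜 _ _).mpr hroot')
    · rw [(hp.map _).natDegree_map, hp.natDegree_map, hp.natDegree_map]
  have hfix : p.coeff 0 ∈ τ.toRingInvo.fixedCenter := by
    have h := congrArg (fun q => coeff q 0) heq
    rw [coeff_map] at h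
    exact h
  refine ⟨(-1) ^ centralIndex E * p.coeff 0 ^ (centralIndex E / p.natDegree),
    mul_mem (pow_mem (neg_mem (one_mem _)) _) (pow_mem hfix _), ?_⟩
  rw [gradedNrd_apply, ← hpm, coeff_map, hp.natDegree_map]
  simp

omit [Module.Finite (Subring.center E) E] in
theorem mem_sigma'_iff (u : Eˣ) : u ∈ τ.sigma' ↔
    (∃ r ∈ τ.toRingInvo.fixedCenter,
      algebraMap (Subring.center E) (quotCenter 𝒜) r = gradedNrd 𝒜 (u : E)) ∧
    ∃ r ∈ τ.toRingInvo.fixedCenter,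
      algebraMap (Subring.center E) (quotCenter 𝒜) r = gradedNrd 𝒜 ((u⁻¹ : Eˣ) : E) := by
  have := isDomain 𝒜
  constructor
  · rintro ⟨r, hr⟩
    refine ⟨⟨(r : τ.toRingInvo.fixedCenter), Subtype.property _, congrArg Units.val hr⟩,
      ⟨((r⁻¹ : τ.toRingInvo.fixedCenterˣ) : τ.toRingInvo.fixedCenter), Subtype.property _, ?_⟩⟩
    have := congrArg (fun w : (quotCenter 𝒜)ˣ => ((w⁻¹ : (quotCenter 𝒜)ˣ) : quotCenter 𝒜)) hr
    simp only [← map_inv] at this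
    exact this
  · rintro ⟨⟨r, hr, h1⟩, s, hs, h2⟩
    have hrs : r * s = 1 := by
      apply IsFractionRing.injective (Subring.center E) (quotCenter 𝒜)
      rw [map_mul, h1, h2, ← map_mul, Units.mul_inv, map_one, map_one]
    exact ⟨⟨⟨r, hr⟩, ⟨s, hs⟩, Subtype.ext hrs, Subtype.ext (by rw [mul_comm] at hrs; exact hrs)⟩,
      Units.ext h1⟩

theorem sigma_le_sigma' : τ.toRingInvo.sigma ≤ τ.sigma' := by
  rw [RingInvo.sigma, Subgroup.closure_le]
  intro u hu
  rw [SetLike.mem_coe, mem_sigma'_iff]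
  exact ⟨τ.exists_fixedCenter_eq_gradedNrd hu,
    τ.exists_fixedCenter_eq_gradedNrd (τ.toRingInvo.unop_map_inv hu)⟩

/-- Lying in `Rˣ` also requires the inverse norm to be in `R`; this is automatic, as the inverse of
a τ-fixed unit is τ-fixed. -/
theorem mem_sigma'Zero_iff (a : (gradeZero 𝒜)ˣ) : a ∈ τ.sigma'Zero ↔
    (Algebra.norm (centerZero 𝒜) (nrdZero 𝒜 (a : gradeZero 𝒜))) ^ gradedDel 𝒜 ∈ τ.fixedZero := by
  have := isDomain 𝒜
  have hinj := IsFractionRing.injective (Subring.center E) (quotCenter 𝒜)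
  have h1 : gradedNrd 𝒜 (unitsIncl 𝒜 a : E) = centerZeroToQuot 𝒜
    (Algebra.norm (centerZero 𝒜) (nrdZero 𝒜 (a : gradeZero 𝒜)) ^ gradedDel 𝒜) :=
    gradedNrd_gradeZero 𝒜 a
  have h2 : gradedNrd 𝒜 (((unitsIncl 𝒜 a)⁻¹ : Eˣ) : E) = centerZeroToQuot 𝒜
    (Algebra.norm (centerZero 𝒜) (nrdZero 𝒜 ((a⁻¹ : (gradeZero 𝒜)ˣ) : gradeZero 𝒜)) ^
      gradedDel 𝒜) := gradedNrd_gradeZero 𝒜 ((a⁻¹ : (gradeZero 𝒜)ˣ) : gradeZero 𝒜)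
  rw [Subgroup.mem_comap, mem_sigma'_iff, h1, h2]
  set w := Algebra.norm (centerZero 𝒜) (nrdZero 𝒜 (a : gradeZero 𝒜)) ^ gradedDel 𝒜 with hw
  set w' := Algebra.norm (centerZero 𝒜) (nrdZero 𝒜 ((a⁻¹ : (gradeZero 𝒜)ˣ) : gradeZero 𝒜)) ^
    gradedDel 𝒜 with hw'
  have hww : w * w' = 1 := by
    rw [hw, hw', ← mul_pow, ← map_mul, ← map_mul, Units.mul_inv, map_one, map_one, one_pow]
  constructor
  · rintro ⟨⟨r, hr, h⟩, -⟩
    have h3 : r = centerZeroIncl 𝒜 w := hinj h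
    rw [h3] at hr
    exact hr
  · intro h
    have hfix : centerZeroIncl 𝒜 w ∈ τ.toRingInvo.fixedCenter := h
    refine ⟨⟨_, hfix, rfl⟩, _, ?_, rfl⟩
    let v : (Subring.center E)ˣ := ⟨centerZeroIncl 𝒜 w, centerZeroIncl 𝒜 w',
      by rw [← map_mul, hww, map_one], by rw [← map_mul, mul_comm, hww, map_one]⟩
    let v' : Eˣ := Units.map (Subring.center E).subtype.toMonoidHom v
    refine Subtype.ext ?_
    exact τ.toRingInvo.unop_map_inv (u := v') (congrArg Subtype.val hfix)

end GradedInvolution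
end HomogeneousNorm

/-! ### Products of normal subgroups and reduction of exponents -/

section GroupLemmas

theorem Subgroup.prod_map_coe_eq_iSup {ι G : Type*} [Group G] (W : ι → Subgroup G)
    [∀ i, (W i).Normal] (l : List ι) :
    (l.map fun i => (W i : Set G)).prod = ((⨆ i ∈ l, W i : Subgroup G) : Set G) := by
  induction l with
  | nil =>
    simp only [List.map_nil, List.prod_nil, List.not_mem_nil, iSup_false, iSup_bot, Subgroup.coe_bot]
    rfl
  | cons a l ih =>
    have h : (⨆ i ∈ a :: l, W i) = W a ⊔ ⨆ i ∈ l, W i := by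
      simp only [List.mem_cons, iSup_or, iSup_sup_eq, iSup_iSup_eq_left]
    rw [List.map_cons, List.prod_cons, ih, h, Subgroup.normal_mul]

theorem isProductOf_iSup {ι G : Type*} [Group G] [Finite ι] (W : ι → Subgroup G)
    (hW : ∀ i, (W i).Normal) : IsProductOf ((⨆ i, W i : Subgroup G) : Set G) W := by
  refine ⟨inferInstance, fun l _ hl => ?_⟩
  rw [Subgroup.prod_map_coe_eq_iSup]
  simp [hl]

/-- If `W (a ^ k * h) ≤ W h ⊔ W (a * h)` holds throughout, then all `W h` are contained in the
join of the `W (∏ gᵢ ^ εᵢ)`, `εᵢ ∈ {0, 1}`, for any generators `gᵢ`. -/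
theorem le_iSup_of_closure_range_eq_top {H G : Type*} [CommGroup H] [Group G] (W : H → Subgroup G)
    (hW : ∀ (a h : H) (k : ℤ), W (a ^ k * h) ≤ W h ⊔ W (a * h)) {m : ℕ} (g : Fin m → H)
    (hg : Subgroup.closure (Set.range g) = ⊤) (h : H) :
    W h ≤ ⨆ ε : Fin m → Fin 2, W (List.ofFn fun i => g i ^ (ε i : ℕ)).prod := by
  classical
  simp only [List.prod_ofFn]
  set N := ⨆ ε : Fin m → Fin 2, W (∏ i, g i ^ (ε i : ℕ)) with hN
  -- Exponents below index j are arbitrary, those from j on are 0 or 1. Passing from j + 1 to j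
  -- replaces the exponent at index j by 0 and by 1, using `hW`.
  have key : ∀ j : ℕ, j ≤ m → ∀ k : Fin m → ℤ, (∀ i : Fin m, j ≤ i → k i = 0 ∨ k i = 1) →
      W (∏ i, g i ^ k i) ≤ N := by
    intro j
    induction j with
    | zero =>
      intro _ k hk
      have h1 : ∀ i, ∃ e : Fin 2, k i = (e : ℕ) := by
        intro i
        rcases hk i (Nat.zero_le _) with h0 | h0
        · exact ⟨0, by simp [h0]⟩
        · exact ⟨1, by simp [h0]⟩
      choose ε hε using h1
      have h2 : ∏ i, g i ^ k i = ∏ i, g i ^ (ε i : ℕ) :=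
        Finset.prod_congr rfl fun i _ => by rw [hε, zpow_natCast]
      rw [h2]
      exact le_iSup (fun ε : Fin m → Fin 2 => W (∏ i, g i ^ (ε i : ℕ))) ε
    | succ j ih =>
      intro hj k hk
      let i₀ : Fin m := ⟨j, hj⟩
      have hupd : ∀ z : ℤ, ∏ i, g i ^ (Function.update k i₀ z) i =
          g i₀ ^ z * ∏ i ∈ Finset.univ.erase i₀, g i ^ k i := by
        intro z
        rw [← Finset.mul_prod_erase _ _ (Finset.mem_univ i₀), Function.update_self]
        congr 1
        exact Finset.prod_congr rfl fun i hi => by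
          rw [Function.update_of_ne (Finset.ne_of_mem_erase hi)]
      have hmem : ∀ z : ℤ, z = 0 ∨ z = 1 →
          W (∏ i, g i ^ (Function.update k i₀ z) i) ≤ N := by
        intro z hz
        refine ih (Nat.le_of_succ_le hj) _ fun i hi => ?_
        by_cases hii : i = i₀
        · rw [hii, Function.update_self]
          exact hz
        · rw [Function.update_of_ne hii]
          refine hk i (Nat.succ_le_of_lt (lt_of_le_of_ne hi fun he => hii (Fin.ext he.symm)))
      have h0 := hmem 0 (Or.inl rfl)
      have h1 := hmem 1 (Or.inr rfl)
      rw [hupd, zpow_zero, one_mul] at h0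
      rw [hupd, zpow_one] at h1
      have h2 := hupd (k i₀)
      rw [Function.update_eq_self] at h2
      rw [h2]
      exact (hW _ _ _).trans (sup_le h0 h1)
  have hex : ∃ k : Fin m → ℤ, h = ∏ i, g i ^ k i := by
    have hmem : h ∈ Subgroup.closure (Set.range g) := hg ▸ Subgroup.mem_top h
    induction hmem using Subgroup.closure_induction with
    | mem x hx =>
      obtain ⟨i, rfl⟩ := hx
      refine ⟨Pi.single i 1, ?_⟩
      rw [Finset.prod_eq_single i (fun j _ hj => by rw [Pi.single_eq_of_ne hj, zpow_zero])
        (fun hi => (hi (Finset.mem_univ i)).elim), Pi.single_eq_same, zpow_one]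
    | one => exact ⟨0, by simp⟩
    | mul x y _ _ hx hy =>
      obtain ⟨k, rfl⟩ := hx
      obtain ⟨l, rfl⟩ := hy
      exact ⟨k + l, by simp [zpow_add, Finset.prod_mul_distrib]⟩
    | inv x _ hx =>
      obtain ⟨k, rfl⟩ := hx
      exact ⟨-k, by simp⟩
  obtain ⟨k, rfl⟩ := hex
  exact key m le_rfl k fun i hi => absurd i.2 (not_lt.mpr hi)

/-- Two consecutive powers control the next one, and with `a⁻¹` the previous one, so the induction
carries pairs of neighbours in both directions. -/
theorem zpow_mul_le_sup {H G : Type*} [CommGroup H] [Group G] (W : H → Subgroup G)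
    (hW : ∀ a h : H, W (a ^ 2 * h) ≤ W h ⊔ W (a * h)) (a h : H) (k : ℤ) :
    W (a ^ k * h) ≤ W h ⊔ W (a * h) := by
  have key : W (a ^ k * h) ≤ W h ⊔ W (a * h) ∧ W (a ^ (k + 1) * h) ≤ W h ⊔ W (a * h) := by
    induction k using Int.induction_on with
    | zero => simp
    | succ n ih =>
      refine ⟨ih.2, ?_⟩
      have h1 := hW a (a ^ (n : ℤ) * h)
      have e1 : a ^ 2 * (a ^ (n : ℤ) * h) = a ^ ((n : ℤ) + 1 + 1) * h := by group
      have e2 : a * (a ^ (n : ℤ) * h) = a ^ ((n : ℤ) + 1) * h := by group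
      rw [e1, e2] at h1
      exact h1.trans (sup_le ih.1 ih.2)
    | pred n ih =>
      have e0 : -(n : ℤ) - 1 + 1 = -(n : ℤ) := by ring
      rw [e0]
      refine ⟨?_, ih.1⟩
      have h1 := hW a⁻¹ (a ^ (-(n : ℤ) + 1) * h)
      have e1 : a⁻¹ ^ 2 * (a ^ (-(n : ℤ) + 1) * h) = a ^ (-(n : ℤ) - 1) * h := by group
      have e2 : a⁻¹ * (a ^ (-(n : ℤ) + 1) * h) = a ^ (-(n : ℤ)) * h := by group
      rw [e1, e2] at h1
      exact h1.trans (sup_le ih.2 ih.1)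
  exact key.1

end GroupLemmas

/-! ### Symmetric units and the twisted involutions of degree zero -/

section Twists

variable {Γ E : Type*} [AddCommGroup Γ] [DecidableEq Γ] [Ring E]
variable {𝒜 : Γ → AddSubgroup E} [GradedRing 𝒜] [IsGradedDivisionRing 𝒜]

open IsGradedDivisionRing

theorem mem_gradeSet_top {γ : Γ} : γ ∈ gradeSet 𝒜 (⊤ : Subring E) ↔ ∃ u : Eˣ, (u : E) ∈ 𝒜 γ := by
  constructor
  · rintro ⟨s, -, hs, h0⟩
    obtain ⟨u, rfl⟩ := exists_unit_of_mem 𝒜 hs h0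
    exact ⟨u, hs⟩
  · rintro ⟨u, hu⟩
    have := isDomain 𝒜
    exact ⟨u, Subring.mem_top _, hu, u.ne_zero⟩

namespace GradedInvolution

variable (τ : GradedInvolution 𝒜)

/-- The image of a unit under the involution. -/
abbrev star (u : Eˣ) : Eˣ := τ.toRingInvo.unitsMap u

omit [AddCommGroup Γ] [DecidableEq Γ] [GradedRing 𝒜] [IsGradedDivisionRing 𝒜] in
theorem star_mul (u v : Eˣ) : τ.star (u * v) = τ.star v * τ.star u :=
  Units.ext (τ.toRingInvo.unop_map_mul (u : E) v)

omit [AddCommGroup Γ] [DecidableEq Γ] [GradedRing 𝒜] [IsGradedDivisionRing 𝒜] in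
theorem star_star (u : Eˣ) : τ.star (τ.star u) = u :=
  Units.ext (τ.toRingInvo.involution (u : E))

omit [AddCommGroup Γ] [DecidableEq Γ] [GradedRing 𝒜] [IsGradedDivisionRing 𝒜] in
theorem star_mem {u : Eˣ} {γ : Γ} (hu : (u : E) ∈ 𝒜 γ) : (τ.star u : E) ∈ 𝒜 γ :=
  τ.map_mem γ u hu

omit [AddCommGroup Γ] [DecidableEq Γ] [GradedRing 𝒜] [IsGradedDivisionRing 𝒜] in
theorem mem_sigma_of_star {u : Eˣ} (hu : τ.star u = u) : u ∈ τ.toRingInvo.sigma :=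
  τ.toRingInvo.mem_sigma_of_symm (congrArg Units.val hu)

omit [AddCommGroup Γ] [DecidableEq Γ] [GradedRing 𝒜] [IsGradedDivisionRing 𝒜] in
theorem sigma_le_iff {S : Subgroup Eˣ} :
    τ.toRingInvo.sigma ≤ S ↔ ∀ u : Eˣ, τ.star u = u → u ∈ S := by
  rw [RingInvo.sigma, Subgroup.closure_le]
  exact ⟨fun h u hu => h (congrArg Units.val hu), fun h u hu => h u (Units.ext hu)⟩

/-- `T₀` contains an element moved by `τ` if `T` is unramified over `R`. -/
theorem exists_center_zero_moved (hunitary : τ.toRingInvo.IsUnitary) (hunram : τ.IsUnramified) :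
    ∃ t ∈ Subring.center E, t ∈ 𝒜 0 ∧ (τ.toRingInvo t).unop ≠ t := by
  classical
  obtain ⟨z, hz⟩ := hunitary
  have hz' : (τ.toRingInvo (z : E)).unop ≠ z := fun h => hz (Subtype.ext h)
  obtain ⟨γ, hγ⟩ : ∃ γ, (τ.toRingInvo (DirectSum.decompose 𝒜 (z : E) γ : E)).unop ≠
      DirectSum.decompose 𝒜 (z : E) γ := by
    by_contra hcon
    push Not at hcon
    apply hz'
    rw [← DirectSum.sum_support_decompose 𝒜 (z : E), map_sum, Finset.unop_sum]
    exact Finset.sum_congr rfl fun γ _ => hcon γ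
  set w : E := (DirectSum.decompose 𝒜 (z : E) γ : E) with hw
  have hwc : w ∈ Subring.center E := decompose_mem_center 𝒜 z.2 γ
  have hwγ : w ∈ 𝒜 γ := SetLike.coe_mem _
  have hmem : γ ∈ gradeSet 𝒜 (Subring.center E) := by
    refine ⟨w, hwc, hwγ, fun h0 => hγ ?_⟩
    rw [h0, RingInvo.unop_map_zero]
  rw [hunram] at hmem
  obtain ⟨r, ⟨r', hr', rfl⟩, hrγ, hr0⟩ := hmem
  obtain ⟨u, hu⟩ := exists_unit_of_mem 𝒜 hrγ hr0
  have hus : (τ.toRingInvo (u : E)).unop = u := by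
    rw [hu]
    exact congrArg Subtype.val hr'
  have huc : ((u⁻¹ : Eˣ) : E) ∈ Subring.center E := inv_mem_subring_center (by rw [hu]; exact r'.2)
  refine ⟨w * ((u⁻¹ : Eˣ) : E), mul_mem hwc huc, ?_, ?_⟩
  · have := SetLike.mul_mem_graded hwγ (inv_mem_of_mem 𝒜 (u := u) (γ := γ) (by rw [hu]; exact hrγ))
    rwa [add_neg_cancel] at this
  · intro h
    rw [RingInvo.unop_map_mul, τ.toRingInvo.unop_map_inv hus,
      ← Subring.mem_center_iff.mp huc] at h
    exact hγ ((Units.mul_left_inj u⁻¹).mp h)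

section Moved

variable (hτ : ∃ t ∈ Subring.center E, t ∈ 𝒜 0 ∧ (τ.toRingInvo t).unop ≠ t)

-- Take y + τ(y) for a unit y of degree γ. If it vanishes, then τ(y) = −y and ty + τ(ty) = (t −
-- τ(t))y is nonzero.
include hτ in
theorem exists_symm_of_mem {γ : Γ} (hγ : γ ∈ gradeSet 𝒜 (⊤ : Subring E)) :
    ∃ x : Eˣ, (x : E) ∈ 𝒜 γ ∧ τ.star x = x := by
  obtain ⟨y, hy⟩ := mem_gradeSet_top.mp hγ
  have hsy := τ.map_mem γ _ hy
  have key : ∀ w ∈ 𝒜 γ, w + (τ.toRingInvo w).unop ≠ 0 → ∃ x : Eˣ, (x : E) ∈ 𝒜 γ ∧ τ.star x = x := by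
    intro w hw h0
    have hmem : w + (τ.toRingInvo w).unop ∈ 𝒜 γ := add_mem hw (τ.map_mem γ _ hw)
    obtain ⟨x, hx⟩ := exists_unit_of_mem 𝒜 hmem h0
    refine ⟨x, hx ▸ hmem, Units.ext ?_⟩
    change (τ.toRingInvo (x : E)).unop = x
    rw [hx, RingInvo.unop_map_add, RingInvo.involution, add_comm]
  by_cases h0 : (y : E) + (τ.toRingInvo (y : E)).unop = 0
  · obtain ⟨t, ht, ht0, hne⟩ := hτ
    refine key (t * y) ?_ ?_
    · have := SetLike.mul_mem_graded ht0 hy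
      rwa [zero_add] at this
    · have h1 : (τ.toRingInvo (y : E)).unop = -(y : E) := by
        rw [eq_neg_iff_add_eq_zero, add_comm, h0]
      rw [RingInvo.unop_map_mul, h1, neg_mul,
        Subring.mem_center_iff.mp (τ.toRingInvo.mem_center_unop_map ht), ← sub_eq_add_neg, ← sub_mul]
      intro h2
      exact hne (sub_eq_zero.mp ((Units.mul_left_eq_zero y).mp h2)).symm
  · exact key y hy h0

include hτ in
theorem exists_isSymmetricChoice : ∃ x : Γ → Eˣ, τ.IsSymmetricChoice x := by
  classical
  refine ⟨fun γ => if h : γ ∈ gradeSet 𝒜 (⊤ : Subring E) then (τ.exists_symm_of_mem hτ h).choose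
    else 1, fun γ hγ => ?_⟩
  simp only [dif_pos hγ]
  have h := (τ.exists_symm_of_mem hτ hγ).choose_spec
  exact ⟨h.1, congrArg Units.val h.2⟩

include hτ in
theorem exists_symm_same_degree (u : Eˣ) :
    ∃ (γ : Γ) (x : Eˣ), (u : E) ∈ 𝒜 γ ∧ (x : E) ∈ 𝒜 γ ∧ τ.star x = x := by
  obtain ⟨γ, hγ⟩ := exists_mem_of_unit 𝒜 u
  obtain ⟨x, hx, hsx⟩ := τ.exists_symm_of_mem hτ (mem_gradeSet_top.mpr ⟨u, hγ⟩)
  exact ⟨γ, x, hγ, hx, hsx⟩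

/-- The involution `a ↦ x τ(a) x⁻¹` of `E₀`, for a symmetric unit `x` of `E`. -/
def twistInvo (x : Eˣ) (hx : τ.star x = x) : RingInvo (gradeZero 𝒜) :=
  have hinv : ∀ a : gradeZero 𝒜, conjZero 𝒜 x (τ.zero (conjZero 𝒜 x (τ.zero a).unop)).unop = a := by
    intro a
    have hx1 : (τ.toRingInvo (x : E)).unop = x := congrArg Units.val hx
    refine Subtype.ext ?_
    change (x : E) * (τ.toRingInvo ((x : E) * (τ.toRingInvo (a : E)).unop * ((x⁻¹ : Eˣ) : E))).unop *
      ((x⁻¹ : Eˣ) : E) = a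
    rw [RingInvo.unop_map_mul, RingInvo.unop_map_mul, RingInvo.involution, hx1,
      τ.toRingInvo.unop_map_inv hx1]
    simp [mul_assoc]
  { toFun := fun a => MulOpposite.op (conjZero 𝒜 x (τ.zero a).unop)
    invFun := fun a => conjZero 𝒜 x (τ.zero a.unop).unop
    left_inv := hinv
    right_inv := fun a => MulOpposite.unop_injective (hinv a.unop)
    map_mul' := fun a b => MulOpposite.unop_injective (by
      simp only [map_mul, MulOpposite.unop_op, MulOpposite.unop_mul])
    map_add' := fun a b => MulOpposite.unop_injective (by
      simp only [map_add, MulOpposite.unop_op, MulOpposite.unop_add])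
    involution' := hinv }

theorem twistInvo_coe (x : Eˣ) (hx : τ.star x = x) (a : gradeZero 𝒜) :
    (((τ.twistInvo x hx a).unop : gradeZero 𝒜) : E) =
      x * (τ.toRingInvo (a : E)).unop * ((x⁻¹ : Eˣ) : E) := rfl

theorem twistInvo_onCenter (x : Eˣ) (hx : τ.star x = x) :
    (τ.twistInvo x hx).onCenter = τ.twist (conjCenter 𝒜 x) := rfl

/-- The condition xτ(a)x⁻¹ = a reads τ(ax) = ax. This is the bridge between the groups `Σ_{h
τ̄}(E₀)` and `Σ_τ`. -/
theorem twistInvo_symm_iff (x : Eˣ) (hx : τ.star x = x) (a : (gradeZero 𝒜)ˣ) :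
    (τ.twistInvo x hx (a : gradeZero 𝒜)).unop = a ↔
      τ.star (unitsIncl 𝒜 a * x) = unitsIncl 𝒜 a * x := by
  rw [star_mul, hx, Subtype.ext_iff, twistInvo_coe, Units.ext_iff]
  exact Units.mul_inv_eq_iff_eq_mul x

-- h fixes `T₀`, so on the moved t in `T₀` the involution acts as τ.
include hτ in
theorem isUnitary_of_onCenter_eq_twist (ρ : RingInvo (gradeZero 𝒜)) (h : galH 𝒜)
    (hρ : ρ.onCenter = τ.twist h) : ρ.IsUnitary := by
  obtain ⟨t, ht, ht0, hne⟩ := hτ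
  have hc : ∀ s ∈ Subring.center E, ∀ hs : s ∈ 𝒜 0,
      (⟨s, hs⟩ : gradeZero 𝒜) ∈ Subring.center (gradeZero 𝒜) := by
    intro s hs hs0
    rw [Subring.mem_center_iff]
    exact fun g => Subtype.ext (Subring.mem_center_iff.mp hs g)
  refine ⟨⟨⟨t, ht0⟩, hc t ht ht0⟩, ?_⟩
  rw [hρ]
  have hfix := h.commutes ⟨⟨⟨_, τ.map_mem 0 t ht0⟩, hc _ (τ.toRingInvo.mem_center_unop_map ht) _⟩,
    τ.toRingInvo.mem_center_unop_map ht⟩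
  intro heq
  apply hne
  exact congrArg (fun z : Subring.center (gradeZero 𝒜) => ((z : gradeZero 𝒜) : E)) (hfix.symm.trans heq)

variable [Module.Finite (Subring.center E) E]

include hτ in
theorem sigma_eq_sigmaTwist (ρ : RingInvo (gradeZero 𝒜)) (h : galH 𝒜)
    (hρ : ρ.onCenter = τ.twist h) : ρ.sigma = τ.sigmaTwist h := by
  have := isDomain_gradeZero 𝒜
  apply le_antisymm
  · exact le_iSup (fun ρ : {ρ : RingInvo (gradeZero 𝒜) // ρ.onCenter = τ.twist h} => ρ.1.sigma) ⟨ρ, hρ⟩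
  · refine iSup_le fun ρ' => ?_
    exact (RingInvo.sigma_eq_of_onCenter_eq ρ (isUnit_gradeZero 𝒜)
      (τ.isUnitary_of_onCenter_eq_twist hτ ρ h hρ) ρ'.1 (hρ.trans ρ'.2.symm)).le

include hτ in
theorem exists_symm_conjCenter_eq (h : galH 𝒜) :
    ∃ x : Eˣ, τ.star x = x ∧ conjCenter 𝒜 x = h := by
  obtain ⟨u, hu⟩ := conjCenter_surjective 𝒜 h
  obtain ⟨γ, x, huγ, hxγ, hx⟩ := τ.exists_symm_same_degree hτ u
  exact ⟨x, hx, (conjCenter_eq_of_mem 𝒜 hxγ huγ).trans hu⟩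

include hτ in
theorem sigmaTwist_normal (h : galH 𝒜) : (τ.sigmaTwist h).Normal := by
  obtain ⟨x, hx, rfl⟩ := τ.exists_symm_conjCenter_eq hτ h
  rw [← τ.sigma_eq_sigmaTwist hτ _ _ (τ.twistInvo_onCenter x hx)]
  infer_instance

include hτ in
theorem sigmaTwist_le_iff (x : Eˣ) (hx : τ.star x = x) (S : Subgroup (gradeZero 𝒜)ˣ) :
    τ.sigmaTwist (conjCenter 𝒜 x) ≤ S ↔
      ∀ a : (gradeZero 𝒜)ˣ, τ.star (unitsIncl 𝒜 a * x) = unitsIncl 𝒜 a * x → a ∈ S := by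
  rw [← τ.sigma_eq_sigmaTwist hτ _ _ (τ.twistInvo_onCenter x hx), RingInvo.sigma,
    Subgroup.closure_le]
  simp only [Set.subset_def, Set.mem_ofPred_eq, twistInvo_symm_iff, SetLike.mem_coe]

include hτ in
theorem mem_sigmaTwist_of_star (x : Eˣ) (hx : τ.star x = x) (a : (gradeZero 𝒜)ˣ)
    (ha : τ.star (unitsIncl 𝒜 a * x) = unitsIncl 𝒜 a * x) :
    a ∈ τ.sigmaTwist (conjCenter 𝒜 x) :=
  (τ.sigmaTwist_le_iff hτ x hx _).mp le_rfl a ha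

/-- Conjugation by a unit of `E` on the units of `E₀`. -/
abbrev conjUnits (𝒜 : Γ → AddSubgroup E) [GradedRing 𝒜] [IsGradedDivisionRing 𝒜] (u : Eˣ) :
    (gradeZero 𝒜)ˣ →* (gradeZero 𝒜)ˣ :=
  Units.map (conjZero 𝒜 u).toMonoidHom

omit [Module.Finite (Subring.center E) E] in
theorem unitsIncl_conjUnits (u : Eˣ) (a : (gradeZero 𝒜)ˣ) :
    unitsIncl 𝒜 (conjUnits 𝒜 u a) = u * unitsIncl 𝒜 a * u⁻¹ := Units.ext rfl

-- If ax is symmetric, so is u(ax)τ(u) = (uau⁻¹)(uxτ(u)); and uxτ(u) is symmetric and acts as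
-- θ(u)²θ(x), since τ(u) has the degree of u.
include hτ in
theorem conjUnits_mem_sigmaTwist (u : Eˣ) (h : galH 𝒜) {a : (gradeZero 𝒜)ˣ}
    (ha : a ∈ τ.sigmaTwist h) :
    conjUnits 𝒜 u a ∈ τ.sigmaTwist (conjCenter 𝒜 u ^ 2 * h) := by
  obtain ⟨x, hx, rfl⟩ := τ.exists_symm_conjCenter_eq hτ h
  revert a
  change τ.sigmaTwist (conjCenter 𝒜 x) ≤ (τ.sigmaTwist _).comap (conjUnits 𝒜 u)
  rw [τ.sigmaTwist_le_iff hτ x hx]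
  intro a ha
  have hy : τ.star (u * x * τ.star u) = u * x * τ.star u := by
    rw [star_mul, star_mul, star_star, hx, mul_assoc]
  have hconj : conjCenter 𝒜 (u * x * τ.star u) = conjCenter 𝒜 u ^ 2 * conjCenter 𝒜 x := by
    obtain ⟨γ, hγ⟩ := exists_mem_of_unit 𝒜 u
    rw [map_mul, map_mul, conjCenter_eq_of_mem 𝒜 (τ.star_mem hγ) hγ, pow_two, mul_assoc,
      conjCenter_comm 𝒜 x u, ← mul_assoc]
  rw [Subgroup.mem_comap, ← hconj]
  refine τ.mem_sigmaTwist_of_star hτ _ hy _ ?_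
  have h1 : unitsIncl 𝒜 (conjUnits 𝒜 u a) * (u * x * τ.star u) =
      u * (unitsIncl 𝒜 a * x) * τ.star u := by
    rw [unitsIncl_conjUnits]
    group
  rw [h1, star_mul, star_mul, star_star, ha, ← mul_assoc]

-- Take symmetric x, y acting as h and αh, so u = yx⁻¹ acts as α. If ax is symmetric then uau⁻¹ =
-- yτ(a)y⁻¹, and (uau⁻¹)a lies in `Σ_{αhτ̄}` because yτ(a)y⁻¹ay is symmetric. Hence conjugation by u
-- sends `Σ_{hτ̄}` into the join, while conjugation by u⁻¹ sends `Σ_{α²hτ̄}` into `Σ_{hτ̄}`.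
include hτ in
theorem sigmaTwist_sq_mul_le (α h : galH 𝒜) :
    τ.sigmaTwist (α ^ 2 * h) ≤ τ.sigmaTwist h ⊔ τ.sigmaTwist (α * h) := by
  obtain ⟨x, hx, rfl⟩ := τ.exists_symm_conjCenter_eq hτ h
  obtain ⟨y, hy, hyα⟩ := τ.exists_symm_conjCenter_eq hτ (α * conjCenter 𝒜 x)
  have hu : conjCenter 𝒜 (y * x⁻¹) = α := by
    rw [map_mul, map_inv, hyα, mul_inv_cancel_right]
  have key : τ.sigmaTwist (conjCenter 𝒜 x) ≤
      (τ.sigmaTwist (conjCenter 𝒜 x) ⊔ τ.sigmaTwist (α * conjCenter 𝒜 x)).comap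
        (conjUnits 𝒜 (y * x⁻¹)) := by
    rw [τ.sigmaTwist_le_iff hτ x hx]
    intro a ha
    rw [Subgroup.mem_comap]
    have ha' : x * τ.star (unitsIncl 𝒜 a) = unitsIncl 𝒜 a * x := by
      rwa [star_mul, hx] at ha
    have h1 : unitsIncl 𝒜 (conjUnits 𝒜 (y * x⁻¹) a) = y * τ.star (unitsIncl 𝒜 a) * y⁻¹ := by
      rw [unitsIncl_conjUnits, eq_inv_mul_of_mul_eq ha']
      group
    have h2 : conjUnits 𝒜 (y * x⁻¹) a * a ∈ τ.sigmaTwist (α * conjCenter 𝒜 x) := by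
      rw [← hyα]
      refine τ.mem_sigmaTwist_of_star hτ y hy _ ?_
      rw [map_mul, h1, star_mul, star_mul, star_mul, star_mul, hy, star_star]
      have h3 : τ.star y⁻¹ = y⁻¹ := by
        refine Units.ext ?_
        exact τ.toRingInvo.unop_map_inv (congrArg Units.val hy)
      rw [h3]
      group
    have h3 := mul_mem (Subgroup.mem_sup_right (S := τ.sigmaTwist (conjCenter 𝒜 x)) h2)
      (inv_mem (Subgroup.mem_sup_left (T := τ.sigmaTwist (α * conjCenter 𝒜 x))
        (τ.mem_sigmaTwist_of_star hτ x hx a ha)))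
    rwa [mul_inv_cancel_right] at h3
  intro b hb
  have h1 := τ.conjUnits_mem_sigmaTwist hτ (y * x⁻¹)⁻¹ _ hb
  have h2 : conjCenter 𝒜 (y * x⁻¹)⁻¹ ^ 2 * (α ^ 2 * conjCenter 𝒜 x) = conjCenter 𝒜 x := by
    rw [map_inv, hu]
    group
  rw [h2] at h1
  have h3 := key h1
  rw [Subgroup.mem_comap] at h3
  have h4 : conjUnits 𝒜 (y * x⁻¹) (conjUnits 𝒜 (y * x⁻¹)⁻¹ b) = b := by
    apply unitsIncl_injective 𝒜
    rw [unitsIncl_conjUnits, unitsIncl_conjUnits]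
    group
  rwa [h4] at h3

end Moved
end GradedInvolution
end Twists

/-! ### The decomposition of symmetric products and the isomorphism onto the Whitehead group -/

section SymmetricGroups

variable {Γ E : Type*} [AddCommGroup Γ] [DecidableEq Γ] [Ring E]
variable {𝒜 : Γ → AddSubgroup E} [GradedRing 𝒜] [IsGradedDivisionRing 𝒜]

open IsGradedDivisionRing

theorem add_mem_gradeSet_top {γ δ : Γ} (hγ : γ ∈ gradeSet 𝒜 (⊤ : Subring E))
    (hδ : δ ∈ gradeSet 𝒜 (⊤ : Subring E)) : γ + δ ∈ gradeSet 𝒜 (⊤ : Subring E) := by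
  obtain ⟨u, hu⟩ := mem_gradeSet_top.mp hγ
  obtain ⟨v, hv⟩ := mem_gradeSet_top.mp hδ
  exact mem_gradeSet_top.mpr ⟨u * v, mul_mem_add 𝒜 hu hv⟩

theorem neg_mem_gradeSet_top {γ : Γ} (hγ : γ ∈ gradeSet 𝒜 (⊤ : Subring E)) :
    -γ ∈ gradeSet 𝒜 (⊤ : Subring E) := by
  obtain ⟨u, hu⟩ := mem_gradeSet_top.mp hγ
  exact mem_gradeSet_top.mpr ⟨u⁻¹, inv_mem_of_mem 𝒜 hu⟩

variable (𝒜) in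
theorem zero_mem_gradeSet_top : (0 : Γ) ∈ gradeSet 𝒜 (⊤ : Subring E) :=
  mem_gradeSet_top.mpr ⟨1, SetLike.one_mem_graded 𝒜⟩

section GroupX

variable (x : Γ → Eˣ)

omit [DecidableEq Γ] [GradedRing 𝒜] [IsGradedDivisionRing 𝒜] in
theorem mul_mem_groupX {γ δ : Γ} (hγ : γ ∈ gradeSet 𝒜 (⊤ : Subring E))
    (hδ : δ ∈ gradeSet 𝒜 (⊤ : Subring E)) : x γ * x δ * (x (γ + δ))⁻¹ ∈ groupX 𝒜 x :=
  Subgroup.subset_closure ⟨γ, hγ, δ, hδ, rfl⟩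

theorem apply_zero_mem_groupX : x 0 ∈ groupX 𝒜 x := by
  have h := mul_mem_groupX x (zero_mem_gradeSet_top 𝒜) (zero_mem_gradeSet_top 𝒜)
  rwa [add_zero, mul_inv_cancel_right] at h

theorem conj_mem_groupX {γ : Γ} (hγ : γ ∈ gradeSet 𝒜 (⊤ : Subring E)) {c : Eˣ}
    (hc : c ∈ groupX 𝒜 x) : x γ * c * (x γ)⁻¹ ∈ groupX 𝒜 x := by
  have hle : groupX 𝒜 x ≤ (groupX 𝒜 x).comap (MulAut.conj (x γ)).toMonoidHom := by
    conv_lhs => rw [groupX]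
    rw [Subgroup.closure_le]
    rintro _ ⟨α, hα, β, hβ, rfl⟩
    change x γ * (x α * x β * (x (α + β))⁻¹) * (x γ)⁻¹ ∈ groupX 𝒜 x
    have h1 := mul_mem_groupX x hγ hα
    have h2 := mul_mem_groupX x (add_mem_gradeSet_top hγ hα) hβ
    have h3 := mul_mem_groupX x hγ (add_mem_gradeSet_top hα hβ)
    -- Cocycle identity: the conjugate by x_γ of the generator for (α, β) is the product of those
    -- for (γ, α) and (γ + α, β) and the inverse of the one for (γ, α + β).
    have h4 := mul_mem (mul_mem h1 h2) (inv_mem h3)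
    rw [← add_assoc] at h4
    convert h4 using 1
    group
  exact hle hc

/-- Words in the `x γ` are of the form `c * x γ` with `c ∈ X`. -/
theorem exists_eq_mul_of_mem_closure {y : Eˣ}
    (hy : y ∈ Subgroup.closure (x '' gradeSet 𝒜 (⊤ : Subring E))) :
    ∃ c ∈ groupX 𝒜 x, ∃ γ ∈ gradeSet 𝒜 (⊤ : Subring E), y = c * x γ := by
  have step : ∀ γ ∈ gradeSet 𝒜 (⊤ : Subring E), ∀ c ∈ groupX 𝒜 x,
      ∀ δ ∈ gradeSet 𝒜 (⊤ : Subring E), ∃ c' ∈ groupX 𝒜 x,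
        ∃ ε ∈ gradeSet 𝒜 (⊤ : Subring E), x γ * (c * x δ) = c' * x ε := by
    intro γ hγ c hc δ hδ
    refine ⟨x γ * c * (x γ)⁻¹ * (x γ * x δ * (x (γ + δ))⁻¹),
      mul_mem (conj_mem_groupX x hγ hc) (mul_mem_groupX x hγ hδ), γ + δ,
      add_mem_gradeSet_top hγ hδ, ?_⟩
    group
  induction hy using Subgroup.closure_induction_left with
  | one => exact ⟨(x 0)⁻¹, inv_mem (apply_zero_mem_groupX x), 0, zero_mem_gradeSet_top 𝒜, by group⟩
  | mul_left a ha y _ ih =>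
    obtain ⟨γ, hγ, rfl⟩ := ha
    obtain ⟨c, hc, δ, hδ, rfl⟩ := ih
    exact step γ hγ c hc δ hδ
  | inv_mul_cancel a ha y _ ih =>
    obtain ⟨γ, hγ, rfl⟩ := ha
    obtain ⟨c, hc, δ, hδ, rfl⟩ := ih
    have h1 := mul_mem_groupX x hγ (neg_mem_gradeSet_top hγ)
    rw [add_neg_cancel] at h1
    -- Since x_γ x_{−γ} lies in `X`, the factor x_γ⁻¹ can be written as x_{−γ} times an element of
    -- `X`, which reduces this case to `step`.
    have h2 := inv_mem (mul_mem h1 (apply_zero_mem_groupX x))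
    obtain ⟨c', hc', ε, hε, h⟩ := step (-γ) (neg_mem_gradeSet_top hγ) _ (mul_mem h2 hc) δ hδ
    refine ⟨c', hc', ε, hε, ?_⟩
    rw [← h]
    group

end GroupX

namespace GradedInvolution

variable (τ : GradedInvolution 𝒜)

theorem groupX_le_range {x : Γ → Eˣ} (hx : τ.IsSymmetricChoice x) :
    groupX 𝒜 x ≤ (unitsIncl 𝒜).range := by
  rw [groupX, Subgroup.closure_le]
  rintro _ ⟨γ, hγ, δ, hδ, rfl⟩
  rw [SetLike.mem_coe, mem_range_unitsIncl]
  have h := mul_mem_add 𝒜 (mul_mem_add 𝒜 (hx γ hγ).1 (hx δ hδ).1)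
    (inv_mem_of_mem 𝒜 (hx _ (add_mem_gradeSet_top hγ hδ)).1)
  rwa [add_neg_cancel] at h

theorem groupX_le_sigma {x : Γ → Eˣ} (hx : τ.IsSymmetricChoice x) :
    groupX 𝒜 x ≤ τ.toRingInvo.sigma := by
  rw [groupX, Subgroup.closure_le]
  rintro _ ⟨γ, hγ, δ, hδ, rfl⟩
  exact mul_mem (mul_mem (τ.toRingInvo.mem_sigma_of_symm (hx γ hγ).2)
    (τ.toRingInvo.mem_sigma_of_symm (hx δ hδ).2))
    (inv_mem (τ.toRingInvo.mem_sigma_of_symm (hx _ (add_mem_gradeSet_top hγ hδ)).2))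

variable [Module.Finite (Subring.center E) E]
variable (hτ : ∃ t ∈ Subring.center E, t ∈ 𝒜 0 ∧ (τ.toRingInvo t).unop ≠ t)

include hτ in
theorem groupP_le_sigmaZero : τ.groupP ≤ τ.sigmaZero := by
  refine iSup_le fun h => ?_
  obtain ⟨x, hx, rfl⟩ := τ.exists_symm_conjCenter_eq hτ h
  rw [τ.sigmaTwist_le_iff hτ x hx]
  intro a ha
  have h1 := mul_mem (τ.mem_sigma_of_star ha) (inv_mem (τ.mem_sigma_of_star hx))
  rwa [mul_inv_cancel_right] at h1

include hτ in
theorem map_groupP_normal : (τ.groupP.map (unitsIncl 𝒜)).Normal := by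
  refine ⟨?_⟩
  rintro _ ⟨p, hp, rfl⟩ u
  refine ⟨conjUnits 𝒜 u p, ?_, unitsIncl_conjUnits u p⟩
  have hle : τ.groupP ≤ τ.groupP.comap (conjUnits 𝒜 u) := by
    refine iSup_le fun h => ?_
    intro a ha
    exact le_iSup (fun h => τ.sigmaTwist h) _ (τ.conjUnits_mem_sigmaTwist hτ u h ha)
  exact hle hp

-- For symmetric u of degree γ, the unit a = u x_γ⁻¹ of `E₀` has a·x_γ symmetric, so it lies in the
-- Σ twisted by θ(x_γ).
include hτ in
theorem sigma_le_sup {x : Γ → Eˣ} (hx : τ.IsSymmetricChoice x) :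
    τ.toRingInvo.sigma ≤ τ.groupP.map (unitsIncl 𝒜) ⊔
      Subgroup.closure (x '' gradeSet 𝒜 (⊤ : Subring E)) := by
  rw [τ.sigma_le_iff]
  intro u hu
  obtain ⟨γ, hγ⟩ := exists_mem_of_unit 𝒜 u
  have hγ' := mem_gradeSet_top.mpr ⟨u, hγ⟩
  have hxs : τ.star (x γ) = x γ := Units.ext (hx γ hγ').2
  have hdeg := mul_mem_add 𝒜 hγ (inv_mem_of_mem 𝒜 (hx γ hγ').1)
  rw [add_neg_cancel] at hdeg
  obtain ⟨a, ha⟩ := exists_unitsIncl_eq 𝒜 hdeg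
  have h1 : a ∈ τ.groupP := by
    refine le_iSup (fun h => τ.sigmaTwist h) _ (τ.mem_sigmaTwist_of_star hτ (x γ) hxs a ?_)
    rw [ha, inv_mul_cancel_right, hu]
  have h2 : u = unitsIncl 𝒜 a * x γ := by rw [ha, inv_mul_cancel_right]
  rw [h2]
  exact mul_mem (Subgroup.mem_sup_left ⟨a, h1, rfl⟩)
    (Subgroup.mem_sup_right (Subgroup.subset_closure ⟨γ, hγ', rfl⟩))

include hτ in
/-- `Σ_τ ∩ E₀ = P · X`. -/
theorem sigmaZero_eq_groupP_mul {x : Γ → Eˣ} (hx : τ.IsSymmetricChoice x) :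
    (τ.sigmaZero : Set (gradeZero 𝒜)ˣ) =
      (τ.groupP : Set (gradeZero 𝒜)ˣ) * ((groupX 𝒜 x).comap (unitsIncl 𝒜) : Set _) := by
  apply Set.Subset.antisymm
  · intro a ha
    have h1 := τ.sigma_le_sup hτ hx (show unitsIncl 𝒜 a ∈ τ.toRingInvo.sigma from ha)
    have := τ.map_groupP_normal hτ
    rw [← SetLike.mem_coe, Subgroup.normal_mul] at h1
    obtain ⟨_, ⟨p, hp, rfl⟩, y, hy, hpy⟩ := h1
    obtain ⟨c, hc, γ, hγ, rfl⟩ := exists_eq_mul_of_mem_closure x hy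
    have hc0 := (mem_range_unitsIncl 𝒜).mp (τ.groupX_le_range hx hc)
    simp only at hpy
    have hxγ : x γ = c⁻¹ * ((unitsIncl 𝒜 p)⁻¹ * unitsIncl 𝒜 a) := by
      rw [← hpy]
      group
    have hx0 : (x γ : E) ∈ 𝒜 0 := by
      rw [hxγ]
      have := mul_mem_add 𝒜 (inv_mem_of_mem 𝒜 hc0)
        (mul_mem_add 𝒜 (inv_mem_of_mem 𝒜 (unitsIncl_mem 𝒜 p)) (unitsIncl_mem 𝒜 a))
      simpa using this
    have hdom := isDomain 𝒜
    -- In a = p·c·x_γ the factors p and c have degree 0, hence so does x_γ; and x_0 itself belongs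
    -- to `X`.
    have hγ0 : γ = 0 := DirectSum.degree_eq_of_mem_mem 𝒜 (hx γ hγ).1 hx0 (x γ).ne_zero
    have hyX : c * x γ ∈ groupX 𝒜 x := mul_mem hc (by rw [hγ0]; exact apply_zero_mem_groupX x)
    refine ⟨p, hp, p⁻¹ * a, ?_, mul_inv_cancel_left p a⟩
    rw [SetLike.mem_coe, Subgroup.mem_comap, map_mul, map_inv, ← hpy, inv_mul_cancel_left]
    exact hyX
  · rintro _ ⟨p, hp, y, hy, rfl⟩
    exact mul_mem (τ.groupP_le_sigmaZero hτ hp) (τ.groupX_le_sigma hx hy)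

omit [Module.Finite (Subring.center E) E] in
include hτ in
theorem exists_eq_mul_unitsIncl (u : Eˣ) :
    ∃ s ∈ τ.toRingInvo.sigma, ∃ a : (gradeZero 𝒜)ˣ, u = s * unitsIncl 𝒜 a := by
  obtain ⟨γ, x, hu, hx, hsx⟩ := τ.exists_symm_same_degree hτ u
  have hdeg := mul_mem_add 𝒜 (inv_mem_of_mem 𝒜 hx) hu
  rw [neg_add_cancel] at hdeg
  obtain ⟨a, ha⟩ := exists_unitsIncl_eq 𝒜 hdeg
  exact ⟨x, τ.mem_sigma_of_star hsx, a, by rw [ha, mul_inv_cancel_left]⟩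

-- As `Eˣ = Σ_τ · E₀ˣ`, the quotient `Eˣ/Σ_τ` is an image of `E₀ˣ`. It is abelian because
-- commutators of `E₀ˣ` lie in Σ of the restricted involution, which is still unitary.
include hτ in
theorem commutator_le_sigma : commutator Eˣ ≤ τ.toRingInvo.sigma := by
  have := isDomain_gradeZero 𝒜
  have hzero : commutator (gradeZero 𝒜)ˣ ≤ τ.sigmaZero := by
    refine (τ.zero.commutator_le_sigma (isUnit_gradeZero 𝒜)
      (τ.isUnitary_of_onCenter_eq_twist hτ τ.zero 1 rfl)).trans ?_
    rw [RingInvo.sigma, Subgroup.closure_le]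
    intro a ha
    exact τ.toRingInvo.mem_sigma_of_symm (congrArg Subtype.val ha)
  have hcomm : ∀ a b : (gradeZero 𝒜)ˣ, ((unitsIncl 𝒜 a : Eˣ) : Eˣ ⧸ τ.toRingInvo.sigma) *
      (unitsIncl 𝒜 b : Eˣ) = (unitsIncl 𝒜 b : Eˣ) * (unitsIncl 𝒜 a : Eˣ) := by
    intro a b
    have h1 : a * b * a⁻¹ * b⁻¹ ∈ commutator (gradeZero 𝒜)ˣ :=
      Subgroup.commutator_mem_commutator (Subgroup.mem_top a) (Subgroup.mem_top b)
    have h2 : unitsIncl 𝒜 (a * b * a⁻¹ * b⁻¹) ∈ τ.toRingInvo.sigma := hzero h1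
    rw [← QuotientGroup.eq_one_iff] at h2
    simp only [map_mul, map_inv, QuotientGroup.mk_mul, QuotientGroup.mk_inv] at h2
    rw [mul_inv_eq_one, mul_inv_eq_iff_eq_mul] at h2
    exact h2
  rw [commutator_def, Subgroup.commutator_le]
  intro u _ v _
  obtain ⟨s, hs, a, rfl⟩ := τ.exists_eq_mul_unitsIncl hτ u
  obtain ⟨t, ht, b, rfl⟩ := τ.exists_eq_mul_unitsIncl hτ v
  rw [← QuotientGroup.eq_one_iff] at hs ht ⊢
  rw [commutatorElement_def]
  simp only [QuotientGroup.mk_mul, QuotientGroup.mk_inv, hs, ht, one_mul]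
  rw [hcomm a b]
  group

include hτ in
theorem sigmaComm_eq : τ.sigmaComm = τ.toRingInvo.sigma :=
  sup_eq_left.mpr (τ.commutator_le_sigma hτ)

include hτ in
/-- The inclusion of `E₀ˣ` into `Eˣ` induces an isomorphism onto `SK₁(E, τ)`. -/
theorem exists_mulEquiv_SK1 :
    ∃ e : (τ.sigma'Zero ⧸ τ.sigmaZero.subgroupOf τ.sigma'Zero) ≃* τ.SK1,
      ∀ a : τ.sigma'Zero,
        e (QuotientGroup.mk a) = QuotientGroup.mk (⟨unitsIncl 𝒜 a, a.2⟩ : τ.sigma') := by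
  let ι : τ.sigma'Zero →* τ.sigma' := (unitsIncl 𝒜).subgroupComap τ.sigma'
  have hcomp : ∀ a : τ.sigma'Zero, a ∈ τ.sigmaZero.subgroupOf τ.sigma'Zero ↔
      ι a ∈ τ.sigmaComm.subgroupOf τ.sigma' := by
    intro a
    rw [Subgroup.mem_subgroupOf, Subgroup.mem_subgroupOf, τ.sigmaComm_eq hτ]
    rfl
  let f : (τ.sigma'Zero ⧸ τ.sigmaZero.subgroupOf τ.sigma'Zero) →* τ.SK1 :=
    QuotientGroup.map _ _ ι fun a ha => (hcomp a).mp ha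
  refine ⟨MulEquiv.ofBijective f ⟨?_, ?_⟩, fun a => rfl⟩
  · rw [← MonoidHom.ker_eq_bot_iff, eq_bot_iff]
    intro q hq
    induction q using QuotientGroup.induction_on with
    | H a =>
      have h1 : (QuotientGroup.mk (ι a) : τ.SK1) = 1 := hq
      rw [QuotientGroup.eq_one_iff] at h1
      rw [Subgroup.mem_bot, QuotientGroup.eq_one_iff]
      exact (hcomp a).mpr h1
  · intro q
    induction q using QuotientGroup.induction_on with
    | H u =>
      obtain ⟨s, hs, a, ha⟩ := τ.exists_eq_mul_unitsIncl hτ (u : Eˣ)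
      have ha' : unitsIncl 𝒜 a ∈ τ.sigma' := by
        have h1 := mul_mem (inv_mem (τ.sigma_le_sigma' hs)) u.2
        rwa [ha, inv_mul_cancel_left] at h1
      refine ⟨QuotientGroup.mk (⟨a, ha'⟩ : τ.sigma'Zero), ?_⟩
      change (QuotientGroup.mk (ι ⟨a, ha'⟩) : τ.SK1) = QuotientGroup.mk u
      rw [QuotientGroup.eq, Subgroup.mem_subgroupOf, τ.sigmaComm_eq hτ]
      change (unitsIncl 𝒜 a)⁻¹ * (u : Eˣ) ∈ τ.toRingInvo.sigma
      rw [ha, ← mul_assoc]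
      have h2 := (RingInvo.sigma_normal τ.toRingInvo).conj_mem s hs (unitsIncl 𝒜 a)⁻¹
      rwa [inv_inv] at h2

include hτ in
theorem sigmaTwist_le_iSup_of_closure_eq_top {m : ℕ} (g : Fin m → galH 𝒜)
    (hg : Subgroup.closure (Set.range g) = ⊤) (h : galH 𝒜) :
    τ.sigmaTwist h ≤
      ⨆ ε : Fin m → Fin 2, τ.sigmaTwist (List.ofFn fun i => g i ^ (ε i : ℕ)).prod := by
  -- `H` is abelian, being the image of the conjugation action.
  let _ : CommGroup (galH 𝒜) :=
    { (inferInstance : Group (galH 𝒜)) with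
      mul_comm := fun a b => by
        obtain ⟨u, rfl⟩ := conjCenter_surjective 𝒜 a
        obtain ⟨v, rfl⟩ := conjCenter_surjective 𝒜 b
        exact conjCenter_comm 𝒜 u v }
  exact le_iSup_of_closure_range_eq_top τ.sigmaTwist
    (zpow_mul_le_sup τ.sigmaTwist (τ.sigmaTwist_sq_mul_le hτ)) g hg h

end GradedInvolution
end SymmetricGroups

end

theorem theorem4p6 {Γ E : Type*} [AddCommGroup Γ] [DecidableEq Γ] [Ring E]
    (𝒜 : Γ → AddSubgroup E) [GradedRing 𝒜] [IsGradedDivisionRing 𝒜]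
    [Module.Finite (Subring.center E) E]
    (τ : GradedInvolution 𝒜) (hunitary : τ.toRingInvo.IsUnitary) (hunram : τ.IsUnramified) :
    -- the inclusion of `E₀ˣ` in `Eˣ` induces `(Σ' ∩ E₀) / (Σ ∩ E₀) ≅ SK₁(E, τ)`
    (τ.sigmaComm ≤ τ.sigma' ∧ τ.sigmaZero ≤ τ.sigma'Zero ∧
      ∃ e : (τ.sigma'Zero ⧸ τ.sigmaZero.subgroupOf τ.sigma'Zero) ≃* τ.SK1,
        ∀ a : τ.sigma'Zero,
          e (QuotientGroup.mk a) = QuotientGroup.mk (⟨unitsIncl 𝒜 a, a.2⟩ : τ.sigma')) ∧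
    -- the description of `Σ' ∩ E₀`; the quotient defining `∂` is exact
    (centralIndex E = gradedDel 𝒜 * (centralIndex (gradeZero 𝒜) *
        Module.finrank (centerZero 𝒜) (Subring.center (gradeZero 𝒜))) ∧
      ∀ a : (gradeZero 𝒜)ˣ, a ∈ τ.sigma'Zero ↔
        (Algebra.norm (centerZero 𝒜) (nrdZero 𝒜 (a : gradeZero 𝒜))) ^ gradedDel 𝒜
          ∈ τ.fixedZero) ∧
    -- `Σ_{h τ̄}(E₀)` is `Σ_ρ(E₀)` for any involution `ρ` of `E₀` restricting to `h τ̄`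
    (∀ h : galH 𝒜, (∃ ρ : RingInvo (gradeZero 𝒜), ρ.onCenter = τ.twist h) ∧
      ∀ ρ : RingInvo (gradeZero 𝒜), ρ.onCenter = τ.twist h → ρ.sigma = τ.sigmaTwist h) ∧
    -- `P` is the product of the `Σ_{h τ̄}(E₀)`
    IsProductOf (τ.groupP : Set (gradeZero 𝒜)ˣ) τ.sigmaTwist ∧
    -- `Σ ∩ E₀ = P · X` for every choice of the `x_γ`
    (∃ x : Γ → Eˣ, τ.IsSymmetricChoice x) ∧
    (∀ x : Γ → Eˣ, τ.IsSymmetricChoice x →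
      groupX 𝒜 x ≤ (unitsIncl 𝒜).range ∧
      (τ.sigmaZero : Set (gradeZero 𝒜)ˣ) =
        (τ.groupP : Set (gradeZero 𝒜)ˣ) * ((groupX 𝒜 x).comap (unitsIncl 𝒜) : Set _)) ∧
    -- it suffices to take products of subsets of a set of generators of `H`
    (∀ (m : ℕ) (g : Fin m → galH 𝒜), Subgroup.closure (Set.range g) = ⊤ →
      IsProductOf (τ.groupP : Set (gradeZero 𝒜)ˣ)
        fun ε : Fin m → Fin 2 =>
          τ.sigmaTwist (List.ofFn fun i => g i ^ (ε i : ℕ)).prod) := by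
  have hτ := τ.exists_center_zero_moved hunitary hunram
  have hfin : Finite (galH 𝒜) := inferInstance
  refine ⟨⟨?_, ?_, τ.exists_mulEquiv_SK1 hτ⟩,
    ⟨IsGradedDivisionRing.centralIndex_eq 𝒜, τ.mem_sigma'Zero_iff⟩, fun h => ⟨?_, ?_⟩,
    isProductOf_iSup _ (τ.sigmaTwist_normal hτ), τ.exists_isSymmetricChoice hτ,
    fun x hx => ⟨τ.groupX_le_range hx, τ.sigmaZero_eq_groupP_mul hτ hx⟩, fun m g hg => ?_⟩
  · rw [τ.sigmaComm_eq hτ]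
    exact τ.sigma_le_sigma'
  · exact Subgroup.comap_mono τ.sigma_le_sigma'
  · obtain ⟨x, hx, rfl⟩ := τ.exists_symm_conjCenter_eq hτ h
    exact ⟨_, τ.twistInvo_onCenter x hx⟩
  · exact fun ρ hρ => τ.sigma_eq_sigmaTwist hτ ρ h hρ
  · have hP : τ.groupP =
        ⨆ ε : Fin m → Fin 2, τ.sigmaTwist (List.ofFn fun i => g i ^ (ε i : ℕ)).prod :=
      le_antisymm (iSup_le fun h => τ.sigmaTwist_le_iSup_of_closure_eq_top hτ g hg h)
        (iSup_le fun ε => le_iSup τ.sigmaTwist _)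
    rw [hP]
    exact isProductOf_iSup _ fun ε => τ.sigmaTwist_normal hτ _
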